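/- Let $(\mathcal D,\otimes,1)$ be a symmetric monoidal category which also carries a model structure (no compatibility between the two is assumed). *Hypotheses.* $\mathcal D$ is complete and cocomplete and has a zero object; it is **cofree-friendly**: every functor $D\otimes -$ preserves colimits, and for every finite family $(D_j)_{j\in J}$ the morphism $\bigoplus_j D_j\to\prod_j D_j$ induced by the identities of the $D_j$ is an isomorphism; and it is **permutation-friendly**: for all $X$ and all $a,b\ge 0$ the morphism $(X^{\otimes a})^{\Sigma_a}\otimes (X^{\otimes b})^{\Sigma_b}\to (X^{\otimes a}\otimes X^{\otimes b})^{\Sigma_a\times\Sigma_b}$ induced by the inclusions of fixed points is an isomorphism. Here $\Sigma_n$ permutes the factors of $X^{\otimes n}$, and the fixed points of a $G$-action $(\phi_g)_{g\in G}$ on $Y$ are the equalizer of $(\phi_g)_g,(\mathrm{id}_Y)_g\colon Y\rightrightarrows\prod_{g\in G}Y$. *Cofree coalgebra.* Let $S^c(X)=\bigoplus_{n\ge 0}(X^{\otimes n})^{\Sigma_n}$, functorially in $X$. Its counit $\epsilon$ is the isomorphism $(X^{\otimes 0})^{\Sigma_0}\cong 1$ on the summand $n=0$ and zero on the other summands.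 Its comultiplication $\triangle$ is, on the $n$-th summand, the diagonal $$(X^{\otimes n})^{\Sigma_n}\to\prod_{a+b=n}(X^{\otimes n})^{\Sigma_n}\cong\bigoplus_{a+b=n}(X^{\otimes n})^{\Sigma_n}$$ followed on the $(a,b)$ component by the restriction to $(X^{\otimes a}\otimes X^{\otimes b})^{\Sigma_a\times\Sigma_b}\cong (X^{\otimes a})^{\Sigma_a}\otimes (X^{\otimes b})^{\Sigma_b}$ and by the inclusion into $S^c(X)\otimes S^c(X)$. *Cosimplicial objects.* For a counital coassociative coalgebra $(C,\triangle,\epsilon)$ in a symmetric monoidal category, $\mathrm{coTHH}^\bullet(C)$ is the cosimplicial object with $\mathrm{coTHH}^n(C)=C^{\otimes n+1}$, cofaces $\delta_i=C^{\otimes i}\otimes\triangle\otimes C^{\otimes n-i}$ for $0\le i\le n$ and $\delta_{n+1}=\tau_{C,C^{\otimes n+1}}(\triangle\otimes C^{\otimes n})$, where $\tau$ is the symmetry, and codegeneracies $\sigma_i=C^{\otimes i+1}\otimes\epsilon\otimes C^{\otimes n-i}$. Write $\mathrm{coTHH}_\otimes^\bullet$ when this is formed in $(\mathcal D,\otimes,1)$.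 Write $\mathrm{coTHH}_\times^\bullet(X)$ when it is formed in $(\mathcal D,\times,*)$ for an object $X$ with its diagonal $X\to X\times X$ and the map $X\to *$. *Homotopy limits.* For a cosimplicial object $X^\bullet$ in $\mathcal D$, $\mathrm{holim}_\Delta X^\bullet$ is the totalization $\int_{[n]\in\Delta}\widehat Y_n^{\,n}$, where $X^\bullet\to Y^\bullet$ is a degreewise weak equivalence to a Reedy fibrant $Y^\bullet$ and $\widehat Y$ is a simplicial frame on $Y^\bullet$ in the Reedy model structure: a Reedy fibrant simplicial object in $\mathcal D^\Delta$ with a weak equivalence from the constant simplicial object $Y^\bullet$ to $\widehat Y$ that is an isomorphism in simplicial degree $0$. Write $A\sim B$ if $A$ and $B$ are joined by a zigzag of weak equivalences, and call $H$ a homotopy limit of $X^\bullet$ if $H\sim\int_n\widehat Y_n^{\,n}$ for some such choice. Set $\mathrm{coTHH}_\otimes(C)=\mathrm{holim}_\Delta\mathrm{coTHH}_\otimes^\bullet(C)$. **Theorem.** For every object $X$ of $\mathcal D$, $(S^c(X),\triangle,\epsilon)$ is a counital, coassociative and cocommutative coalgebra in $(\mathcal D,\otimes,1)$, and $$\mathrm{coTHH}_\otimes(S^c(X))\;\sim\;\mathrm{holim}_\Delta\,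 S^c\bigl(\mathrm{coTHH}_\times^\bullet(X)\bigr).$$ That is, the cosimplicial objects $\mathrm{coTHH}^\bullet_\otimes(S^c(X))$ and $S^c(\mathrm{coTHH}^\bullet_\times(X))$ have the same homotopy limits, and for every choice of a functorial Reedy fibrant replacement and a functorial simplicial framing, the two resulting homotopy limits are joined by a zigzag of weak equivalences. -/

import Mathlib

open CategoryTheory Limits MonoidalCategory HomotopicalAlgebra
open Opposite

universe v u

namespace SimplexPresentation
open SimplexCategoryGenRel

/-- Composites of cofaces, with explicit source and target. -/
inductive IsD : ∀ (a b : ℕ), (mk a ⟶ mk b) → Prop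
  | id (a : ℕ) : IsD a a (𝟙 (mk a))
  | comp {a b : ℕ} (f : mk a ⟶ mk b) (i : Fin (b + 2)) : IsD a b f → IsD a (b + 1) (f ≫ δ i)

/-- Composites of codegeneracies, with explicit source and target. -/
inductive IsS : ∀ (a b : ℕ), (mk a ⟶ mk b) → Prop
  | id (a : ℕ) : IsS a a (𝟙 (mk a))
  | comp {a b : ℕ} (i : Fin (a + 1)) (f : mk a ⟶ mk b) : IsS a b f → IsS (a + 1) b (σ i ≫ f)

lemma IsD_of_P {x y : SimplexCategoryGenRel} (f : x ⟶ y) (hf : P_δ f) :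
    IsD x.len y.len f := by
  induction hf with
  | of f hf => cases hf with
    | δ i => simpa using IsD.comp _ i (IsD.id _)
  | id x => exact IsD.id _
  | comp_of f g hf hg ih => cases hg with
    | δ i => exact IsD.comp _ i ih

lemma IsS_of_P {x y : SimplexCategoryGenRel} (f : x ⟶ y) (hf0 : P_σ f) :
    IsS x.len y.len f := by
  have hf : degeneracies.multiplicativeClosure' f := by
    rw [← MorphismProperty.multiplicativeClosure_eq_multiplicativeClosure']; exact hf0
  induction hf with
  | of f hf => cases hf with
    | σ i => simpa using IsS.comp i _ (IsS.id _)
  | id x => exact IsS.id _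
  | of_comp f g hf hg ih => cases hf with
    | σ i => exact IsS.comp i _ (ih (by
      rw [P_σ, MorphismProperty.multiplicativeClosure_eq_multiplicativeClosure']; exact hg))

/-- the monotone map underlying a morphism -/
abbrev ev {a b : ℕ} (f : mk a ⟶ mk b) (t : Fin (a + 1)) : Fin (b + 1) :=
  (toSimplexCategory.map f).toOrderHom t

lemma ev_comp {a b c : ℕ} (f : mk a ⟶ mk b) (g : mk b ⟶ mk c) (t : Fin (a + 1)) :
    ev (f ≫ g) t = ev g (ev f t) := by
  simp only [ev, Functor.map_comp]; rfl

lemma ev_δ {a : ℕ} (i : Fin (a + 2)) (t : Fin (a + 1)) : ev (δ i) t = i.succAbove t := rfl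
lemma ev_σ {a : ℕ} (i : Fin (a + 1)) (t : Fin (a + 2)) : ev (σ i) t = i.predAbove t := rfl
lemma ev_id {a : ℕ} (t : Fin (a + 1)) : ev (𝟙 (mk a)) t = t := by
  simp only [ev, CategoryTheory.Functor.map_id]; rfl

def MissD : ∀ (a b : ℕ), (mk a ⟶ mk b) → Prop
  | _, 0, _ => True
  | a, k + 1, f => ∀ i : Fin (k + 2), (∀ t, ev f t ≠ i) →
      ∃ g : mk a ⟶ mk k, IsD a k g ∧ f = g ≫ δ i

lemma missD {a b : ℕ} (f : mk a ⟶ mk b) (hf : IsD a b f) : MissD a b f := by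
  induction hf with
  | id => cases a with
    | zero => trivial
    | succ k => intro i hi; exact absurd (ev_id i) (hi i)
  | @comp b f l hf ih =>
    intro i hi
    by_cases hil : i = l
    · subst hil; exact ⟨f, hf, rfl⟩
    cases b with
    | zero =>
      exfalso
      apply hi 0
      rw [ev_comp, ev_δ]
      have : ev f 0 = 0 := Fin.ext (by omega)
      rw [this]
      have key : ∀ l i : Fin 2, ¬ i = l → l.succAbove 0 = i := by decide
      exact key l i hil
    | succ b =>
      obtain h | h := lt_or_gt_of_ne hil
      · obtain ⟨i', rfl⟩ := Fin.eq_castSucc_of_ne_last (Fin.ne_last_of_lt h)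
        obtain ⟨l', rfl⟩ := Fin.eq_succ_of_ne_zero (Fin.ne_zero_of_lt h)
        obtain ⟨g, hg, rfl⟩ := ih i' (fun t ht => hi t (by
          rw [ev_comp, ev_δ, ht]; exact Fin.succAbove_of_castSucc_lt _ _ h))
        refine ⟨g ≫ δ l', .comp _ _ hg, ?_⟩
        rw [Category.assoc, Category.assoc, δ_comp_δ (show i' ≤ l' from Nat.lt_succ_iff.1 h)]
      · obtain ⟨i', rfl⟩ := Fin.eq_succ_of_ne_zero (Fin.ne_zero_of_lt h)
        obtain ⟨l', rfl⟩ := Fin.eq_castSucc_of_ne_last (Fin.ne_last_of_lt h)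
        obtain ⟨g, hg, rfl⟩ := ih i' (fun t ht => hi t (by
          rw [ev_comp, ev_δ, ht]; exact Fin.succAbove_of_lt_succ _ _ h))
        refine ⟨g ≫ δ l', .comp _ _ hg, ?_⟩
        rw [Category.assoc, Category.assoc, ← δ_comp_δ (show l' ≤ i' from Nat.lt_succ_iff.1 h)]

def MergeS : ∀ (a b : ℕ), (mk a ⟶ mk b) → Prop
  | 0, _, _ => True
  | k + 1, b, f => ∀ i : Fin (k + 1), ev f i.castSucc = ev f i.succ →
      ∃ g : mk k ⟶ mk b, IsS k b g ∧ f = σ i ≫ g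

lemma mergeS {a b : ℕ} (f : mk a ⟶ mk b) (hf : IsS a b f) : MergeS a b f := by
  induction hf with
  | id a => cases a with
    | zero => trivial
    | succ k =>
      intro i hi
      simp only [ev_id] at hi
      simp [Fin.ext_iff] at hi
  | @comp a b l f hf ih =>
    intro i hi
    by_cases hil : i = l
    · subst hil; exact ⟨f, hf, rfl⟩
    cases a with
    | zero => exact absurd (Fin.ext (by omega)) hil
    | succ a =>
      rw [ev_comp, ev_comp, ev_σ, ev_σ] at hi
      obtain h | h := lt_or_gt_of_ne hil
      · obtain ⟨i', rfl⟩ := Fin.eq_castSucc_of_ne_last (Fin.ne_last_of_lt h)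
        obtain ⟨l', rfl⟩ := Fin.eq_succ_of_ne_zero (Fin.ne_zero_of_lt h)
        have hh : i'.val ≤ l'.val := Nat.lt_succ_iff.1 h
        obtain ⟨g, hg, rfl⟩ := ih i' (by
          convert hi using 2
          · rw [Fin.predAbove_of_le_castSucc _ _ (show i'.val ≤ l'.val + 1 by omega)]; rfl
          · rw [Fin.predAbove_of_le_castSucc _ _ (show i'.val + 1 ≤ l'.val + 1 by omega)]; rfl)
        refine ⟨σ l' ≫ g, .comp _ _ hg, ?_⟩
        rw [← Category.assoc, ← Category.assoc, ← σ_comp_σ hh]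
      · obtain ⟨i', rfl⟩ := Fin.eq_succ_of_ne_zero (Fin.ne_zero_of_lt h)
        obtain ⟨l', rfl⟩ := Fin.eq_castSucc_of_ne_last (Fin.ne_last_of_lt h)
        have hh : l'.val ≤ i'.val := Nat.lt_succ_iff.1 h
        obtain ⟨g, hg, rfl⟩ := ih i' (by
          convert hi using 2
          · rw [Fin.predAbove_of_castSucc_lt _ _ (by simp [Fin.lt_def]; omega)]; ext; simp
          · rw [Fin.predAbove_of_castSucc_lt _ _ (by simp [Fin.lt_def]; omega)]; ext; simp)
        refine ⟨σ l' ≫ g, .comp _ _ hg, ?_⟩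
        rw [← Category.assoc, ← Category.assoc, σ_comp_σ hh]

lemma exists_fac {a b : ℕ} (f : mk a ⟶ mk b) :
    ∃ (c : ℕ) (e : mk a ⟶ mk c) (m : mk c ⟶ mk b), IsS a c e ∧ IsD c b m ∧ f = e ≫ m := by
  obtain ⟨z, e, m, he, hm, h⟩ := exists_P_σ_P_δ_factorization f
  exact ⟨z.len, e, m, IsS_of_P e he, IsD_of_P m hm, h⟩

lemma IsD.injective {a b : ℕ} {f : mk a ⟶ mk b} (hf : IsD a b f) : Function.Injective (ev f) := by
  induction hf with
  | id => intro s t h; simpa only [ev_id] using h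
  | comp f i hf ih =>
    intro s t h
    rw [ev_comp, ev_comp, ev_δ, ev_δ] at h
    exact ih (Fin.succAbove_right_injective h)

lemma IsS.surjective {a b : ℕ} {f : mk a ⟶ mk b} (hf : IsS a b f) :
    Function.Surjective (ev f) := by
  induction hf with
  | id a => intro t; exact ⟨t, ev_id t⟩
  | comp i f hf ih =>
    intro t
    obtain ⟨s, rfl⟩ := ih t
    obtain ⟨r, rfl⟩ := Fin.predAbove_surjective i s
    exact ⟨r, by rw [ev_comp, ev_σ]⟩

lemma IsS.eq_id {a b : ℕ} {f : mk a ⟶ mk b} (hf : IsS a b f) (h : Function.Injective (ev f)) :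
    ∃ h : a = b, f = eqToHom (by rw [h]) := by
  cases hf with
  | id => exact ⟨rfl, rfl⟩
  | comp i f hf =>
    exfalso
    have : ev (σ i ≫ f) i.castSucc = ev (σ i ≫ f) i.succ := by
      rw [ev_comp, ev_comp, ev_σ, ev_σ]; simp
    exact absurd (h this) (by simp [Fin.ext_iff])

lemma IsD.eq_id {a b : ℕ} {f : mk a ⟶ mk b} (hf : IsD a b f) (h : Function.Surjective (ev f)) :
    ∃ h : a = b, f = eqToHom (by rw [h]) := by
  cases hf with
  | id => exact ⟨rfl, rfl⟩
  | comp f i hf =>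
    exfalso
    obtain ⟨t, ht⟩ := h i
    rw [ev_comp, ev_δ] at ht
    exact Fin.succAbove_ne _ _ ht

lemma monotone_ev {a b : ℕ} (f : mk a ⟶ mk b) : Monotone (ev f) :=
  (toSimplexCategory.map f).toOrderHom.monotone

lemma faithful_aux (N : ℕ) : ∀ (a b : ℕ) (_ : a + b ≤ N) (f g : mk a ⟶ mk b),
    (∀ t, ev f t = ev g t) → f = g := by
  induction N with
  | zero =>
    intro a b hab
    obtain ⟨rfl, rfl⟩ : a = 0 ∧ b = 0 := by omega
    intro f g _
    have key : ∀ f : mk 0 ⟶ mk 0, f = 𝟙 _ := fun f => by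
      obtain ⟨c, e, m, he, hm, rfl⟩ := exists_fac f
      obtain ⟨rfl, rfl⟩ := he.eq_id (fun _ _ _ => Fin.ext (by omega))
      obtain ⟨-, rfl⟩ := hm.eq_id (fun t => ⟨0, Fin.ext (by omega)⟩)
      simp
    rw [key f, key g]
  | succ N ih =>
    intro a b hab f g hfg
    obtain ⟨c, e, m, he, hm, rfl⟩ := exists_fac f
    obtain ⟨c', e', m', he', hm', rfl⟩ := exists_fac g
    by_cases h1 : Function.Injective (ev (e ≫ m))
    · by_cases h2 : Function.Surjective (ev (e ≫ m))
      · have h3 : Function.Injective (ev (e' ≫ m')) := by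
          have : ev (e ≫ m) = ev (e' ≫ m') := funext hfg
          rwa [← this]
        have h4 : Function.Surjective (ev (e' ≫ m')) := by
          have : ev (e ≫ m) = ev (e' ≫ m') := funext hfg
          rwa [← this]
        obtain ⟨rfl, rfl⟩ := he.eq_id (fun s t h => h1 (by rw [ev_comp, ev_comp, h]))
        obtain ⟨rfl, rfl⟩ := he'.eq_id (fun s t h => h3 (by rw [ev_comp, ev_comp, h]))
        obtain ⟨rfl, rfl⟩ := hm.eq_id (fun t => by
          obtain ⟨s, hs⟩ := h2 t; rw [ev_comp] at hs; exact ⟨_, hs⟩)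
        obtain ⟨-, rfl⟩ := hm'.eq_id (fun t => by
          obtain ⟨s, hs⟩ := h4 t; rw [ev_comp] at hs; exact ⟨_, hs⟩)
        simp
      · simp only [Function.Surjective, not_forall, not_exists] at h2
        obtain ⟨i, hi⟩ := h2
        cases b with
        | zero => exact absurd (Fin.ext (by omega)) (hi 0)
        | succ b =>
          obtain ⟨u, -, rfl⟩ := missD m hm i (fun t ht => by
            obtain ⟨s, rfl⟩ := he.surjective t
            exact hi s (by rw [ev_comp, ht]))
          obtain ⟨u', -, rfl⟩ := missD m' hm' i (fun t ht => by
            obtain ⟨s, rfl⟩ := he'.surjective t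
            exact hi s (by rw [hfg, ev_comp, ht]))
          rw [← Category.assoc, ← Category.assoc]
          congr 1
          refine ih a b (by omega) _ _ (fun t => ?_)
          have := hfg t
          rw [← Category.assoc, ← Category.assoc, ev_comp, ev_comp _ (δ i), ev_δ, ev_δ] at this
          exact Fin.succAbove_right_injective this
    · have hne : ∃ (k : ℕ) (hk : k < a), ev (e ≫ m) ⟨k, by omega⟩ = ev (e ≫ m) ⟨k + 1, by omega⟩ := by
        by_contra hcon
        push Not at hcon
        apply h1
        apply StrictMono.injective
        apply Fin.strictMono_iff_lt_succ.2
        intro i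
        exact lt_of_le_of_ne (monotone_ev _ (Fin.castSucc_lt_succ).le) (hcon i.1 i.2)
      obtain ⟨k, hk, hkk⟩ := hne
      cases a with
      | zero => omega
      | succ a =>
        obtain ⟨u, -, rfl⟩ := mergeS e he ⟨k, hk⟩ (by
          apply hm.injective
          rw [← ev_comp, ← ev_comp]; exact hkk)
        obtain ⟨u', -, rfl⟩ := mergeS e' he' ⟨k, hk⟩ (by
          apply hm'.injective
          rw [← ev_comp, ← ev_comp, ← hfg, ← hfg]; exact hkk)
        rw [Category.assoc, Category.assoc]
        congr 1
        refine ih a b (by omega) _ _ (fun t => ?_)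
        obtain ⟨s, rfl⟩ := Fin.predAbove_surjective ⟨k, hk⟩ t
        have := hfg s
        rwa [Category.assoc, Category.assoc, ev_comp, ev_comp (σ _), ev_σ] at this

instance : toSimplexCategory.Faithful where
  map_injective {x y} f g h := faithful_aux _ x.len y.len le_rfl f g (fun t => by
    simp only [ev]
    exact congrArg (fun q => q.toOrderHom t) h)
end SimplexPresentation

namespace SimplexPresentation
open SimplexCategoryGenRel

instance : toSimplexCategory.Full where
  map_surjective {x y} f := by
    let W : MorphismProperty SimplexCategory := fun a b f =>
      ∃ g : mk a.len ⟶ mk b.len, toSimplexCategory.map g = f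
    have : W.IsMultiplicative :=
      { id_mem := fun a => ⟨𝟙 _, toSimplexCategory.map_id _⟩
        comp_mem := by
          rintro a b c _ _ ⟨f, rfl⟩ ⟨g, rfl⟩
          exact ⟨f ≫ g, toSimplexCategory.map_comp f g⟩ }
    have hW : W = ⊤ := SimplexCategory.morphismProperty_eq_top W
      (fun {n} i => ⟨δ i, rfl⟩) (fun {n} i => ⟨σ i, rfl⟩)
    have hf : W f := by rw [hW]; trivial
    exact hf

end SimplexPresentation

section CosimplicialObjects

variable {D : Type*} [Category* D]

/-- A sequence of objects with cofaces and codegeneracies satisfying the cosimplicial identities. -/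
structure CosimplicialData (D : Type*) [Category* D] where
  obj : ℕ → D
  δ : ∀ {n : ℕ}, Fin (n + 2) → (obj n ⟶ obj (n + 1))
  σ : ∀ {n : ℕ}, Fin (n + 1) → (obj (n + 1) ⟶ obj n)
  δ_comp_δ : ∀ {n : ℕ} {i j : Fin (n + 2)}, i ≤ j → δ i ≫ δ j.succ = δ j ≫ δ i.castSucc
  δ_comp_σ_of_le : ∀ {n : ℕ} {i : Fin (n + 2)} {j : Fin (n + 1)}, i ≤ j.castSucc →
    δ i.castSucc ≫ σ j.succ = σ j ≫ δ i
  δ_comp_σ_self : ∀ {n : ℕ} {i : Fin (n + 1)}, δ i.castSucc ≫ σ i = 𝟙 (obj n)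
  δ_comp_σ_succ : ∀ {n : ℕ} {i : Fin (n + 1)}, δ i.succ ≫ σ i = 𝟙 (obj n)
  δ_comp_σ_of_gt : ∀ {n : ℕ} {i : Fin (n + 2)} {j : Fin (n + 1)}, j.castSucc < i →
    δ i.succ ≫ σ j.castSucc = σ j ≫ δ i
  σ_comp_σ : ∀ {n : ℕ} {i j : Fin (n + 1)}, i ≤ j → σ i.castSucc ≫ σ j = σ j.succ ≫ σ i

namespace CosimplicialData

variable (X : CosimplicialData D)

lemma lift_map_two {V : Type*} [Quiver V] (φ : V ⥤q D) {a b c : V} (f : a ⟶ b) (g : b ⟶ c) :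
    (Paths.lift φ).map ((Paths.of V).map f ≫ (Paths.of V).map g) = φ.map f ≫ φ.map g :=
  congrArg (fun q => q ≫ φ.map g) (Category.id_comp (φ.map f))

/-- The cofaces and codegeneracies, as a map of quivers. -/
def prefunctor : FreeSimplexQuiver ⥤q D where
  obj := X.obj
  map := fun f => match f with
    | FreeSimplexQuiver.Hom.δ i => X.δ i
    | FreeSimplexQuiver.Hom.σ i => X.σ i

/-- The functor on the category presented by the simplicial identities. -/
def ofGenRel : SimplexCategoryGenRel ⥤ D :=
  CategoryTheory.Quotient.lift _ (Paths.lift X.prefunctor) (by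
    intro _ _ _ _ h
    have key := fun {a b c : FreeSimplexQuiver} (f : a ⟶ b) (g : b ⟶ c) =>
      lift_map_two X.prefunctor f g
    cases h with
    | @δ_comp_δ n i j H => exact (key _ _).trans ((X.δ_comp_δ H).trans (key (.δ j) (.δ i.castSucc)).symm)
    | @δ_comp_σ_of_le n i j H => exact (key _ _).trans ((X.δ_comp_σ_of_le H).trans (key (.σ j) (.δ i)).symm)
    | δ_comp_σ_self => exact (key _ _).trans X.δ_comp_σ_self
    | δ_comp_σ_succ => exact (key _ _).trans X.δ_comp_σ_succ
    | @δ_comp_σ_of_gt n i j H => exact (key _ _).trans ((X.δ_comp_σ_of_gt H).trans (key (.σ j) (.δ i)).symm)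
    | @σ_comp_σ n i j H => exact (key _ _).trans ((X.σ_comp_σ H).trans (key (.σ j.succ) (.σ i)).symm))

/-- The cosimplicial object (functor on the simplex category) with the given objects, cofaces
and codegeneracies. -/
noncomputable def toFunctor : SimplexCategory ⥤ D where
  obj n := X.obj n.len
  map {a b} f := X.ofGenRel.map (SimplexCategoryGenRel.toSimplexCategory.preimage
    (X := SimplexCategoryGenRel.mk a.len) (Y := SimplexCategoryGenRel.mk b.len) f)
  map_id a := by
    refine Eq.trans (congrArg X.ofGenRel.map ?_) (X.ofGenRel.map_id _)
    exact SimplexCategoryGenRel.toSimplexCategory.preimage_id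
  map_comp f g := by
    refine Eq.trans (congrArg X.ofGenRel.map ?_) (X.ofGenRel.map_comp _ _)
    exact SimplexCategoryGenRel.toSimplexCategory.preimage_comp
      (X := SimplexCategoryGenRel.mk _) (Y := SimplexCategoryGenRel.mk _)
      (Z := SimplexCategoryGenRel.mk _) f g

@[simp]
lemma toFunctor_obj (n : SimplexCategory) : X.toFunctor.obj n = X.obj n.len := rfl

lemma toFunctor_map_δ {n : ℕ} (i : Fin (n + 2)) :
    X.toFunctor.map (SimplexCategory.δ i) = X.δ i := by
  refine Eq.trans (congrArg X.ofGenRel.map (a₂ := SimplexCategoryGenRel.δ i) ?_) ?_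
  · exact SimplexCategoryGenRel.toSimplexCategory.preimage_map (SimplexCategoryGenRel.δ i)
  · exact Category.id_comp _

lemma toFunctor_map_σ {n : ℕ} (i : Fin (n + 1)) :
    X.toFunctor.map (SimplexCategory.σ i) = X.σ i := by
  refine Eq.trans (congrArg X.ofGenRel.map (a₂ := SimplexCategoryGenRel.σ i) ?_) ?_
  · exact SimplexCategoryGenRel.toSimplexCategory.preimage_map (SimplexCategoryGenRel.σ i)
  · exact Category.id_comp _

end CosimplicialData

end CosimplicialObjects

section TensorPowers

variable {C : Type*} [Category* C] [MonoidalCategory C]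

/-- The tensor power `X^{⊗ n} = X ⊗ (X ⊗ (⋯ ⊗ 1))`. -/
def tpow (X : C) : ℕ → C
  | 0 => 𝟙_ C
  | n + 1 => X ⊗ tpow X n

/-- The functoriality of tensor powers. -/
def tpowMap {X Y : C} (f : X ⟶ Y) : ∀ n : ℕ, tpow X n ⟶ tpow Y n
  | 0 => 𝟙 _
  | n + 1 => f ⊗ₘ tpowMap f n

/-- The canonical isomorphism `X^{⊗ a} ⊗ X^{⊗ b} ≅ X^{⊗ (b + a)}` (concatenation). -/
def tpowAdd (X : C) (a b : ℕ) : tpow X a ⊗ tpow X b ≅ tpow X (b + a) :=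
  match a with
  | 0 => λ_ _
  | a + 1 => α_ _ _ _ ≪≫ whiskerLeftIso X (tpowAdd X a b)

/-- The canonical isomorphism `X^{⊗ n} ⊗ X ≅ X^{⊗ (n + 1)}` putting the factor at the end. -/
def tpowSnoc (X : C) : ∀ n : ℕ, tpow X n ⊗ X ≅ tpow X (n + 1)
  | 0 => λ_ X ≪≫ (ρ_ X).symm
  | n + 1 => α_ _ _ _ ≪≫ whiskerLeftIso X (tpowSnoc X n)

/-- Comultiply the `i`-th factor: `C^{⊗ i} ⊗ Δ ⊗ C^{⊗ (n - 1 - i)}`. -/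
def comulAt (X : C) [ComonObj X] : ∀ {n : ℕ}, Fin n → (tpow X n ⟶ tpow X (n + 1))
  | 0 => Fin.elim0
  | n + 1 => Fin.cases
      (ComonObj.comul (X := X) ▷ tpow X n ≫ (α_ X X (tpow X n)).hom)
      (fun i => X ◁ comulAt X i)

/-- Apply the counit to the `i`-th factor: `C^{⊗ i} ⊗ ε ⊗ C^{⊗ (n - i)}`. -/
def counitAt (X : C) [ComonObj X] : ∀ {n : ℕ}, Fin (n + 1) → (tpow X (n + 1) ⟶ tpow X n)
  | 0 => fun _ => ComonObj.counit (X := X) ▷ tpow X 0 ≫ (λ_ (tpow X 0)).hom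
  | n + 1 => Fin.cases
      (ComonObj.counit (X := X) ▷ tpow X (n + 1) ≫ (λ_ (tpow X (n + 1))).hom)
      (fun i => X ◁ counitAt X i)

section

variable (X : C) [ComonObj X]

lemma comulAt_zero {n : ℕ} : comulAt X (0 : Fin (n + 1)) =
    ComonObj.comul (X := X) ▷ tpow X n ≫ (α_ X X (tpow X n)).hom := rfl

lemma comulAt_succ {n : ℕ} (i : Fin n) : comulAt X i.succ = X ◁ comulAt X i := rfl

lemma counitAt_zero {n : ℕ} : counitAt X (0 : Fin (n + 1)) =
    ComonObj.counit (X := X) ▷ tpow X n ≫ (λ_ (tpow X n)).hom := by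
  cases n <;> rfl

lemma counitAt_succ {n : ℕ} (i : Fin (n + 1)) :
    counitAt X i.succ = X ◁ counitAt X i := rfl

lemma whiskerLeft_congr {P Q R S : C} {f : P ⟶ Q} {g : Q ⟶ R} {f' : P ⟶ S} {g' : S ⟶ R}
    (h : f ≫ g = f' ≫ g') : X ◁ f ≫ X ◁ g = X ◁ f' ≫ X ◁ g' := by
  rw [← MonoidalCategory.whiskerLeft_comp, h, MonoidalCategory.whiskerLeft_comp]

lemma whiskerLeft_congr_id {P Q : C} {f : P ⟶ Q} {g : Q ⟶ P}
    (h : f ≫ g = 𝟙 P) : X ◁ f ≫ X ◁ g = 𝟙 (X ⊗ P) := by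
  rw [← MonoidalCategory.whiskerLeft_comp, h, MonoidalCategory.whiskerLeft_id]

lemma comul_base (P : C) :
    (ComonObj.comul (X := X) ▷ P ≫ (α_ X X P).hom) ≫
      X ◁ (ComonObj.comul (X := X) ▷ P ≫ (α_ X X P).hom) =
    (ComonObj.comul (X := X) ▷ P ≫ (α_ X X P).hom) ≫
      (ComonObj.comul (X := X) ▷ (X ⊗ P) ≫ (α_ X X (X ⊗ P)).hom) := by
  calc _ = (ComonObj.comul (X := X) ≫ X ◁ ComonObj.comul (X := X)) ▷ P ≫
        (α_ X (X ⊗ X) P).hom ≫ X ◁ (α_ X X P).hom := by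
        simp only [comp_whiskerRight, Category.assoc, MonoidalCategory.whiskerLeft_comp,
          associator_naturality_middle_assoc]
    _ = _ := by
        rw [ComonObj.comul_assoc]
        simp

lemma comul_exchange {P Q : C} (f : P ⟶ Q) :
    (ComonObj.comul (X := X) ▷ P ≫ (α_ X X P).hom) ≫ X ◁ (X ◁ f) =
    X ◁ f ≫ (ComonObj.comul (X := X) ▷ Q ≫ (α_ X X Q).hom) := by
  rw [whisker_exchange_assoc]
  simp

lemma counit_exchange {P Q : C} (f : P ⟶ Q) :
    (ComonObj.counit (X := X) ▷ P ≫ (λ_ P).hom) ≫ f =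
    X ◁ f ≫ (ComonObj.counit (X := X) ▷ Q ≫ (λ_ Q).hom) := by
  rw [whisker_exchange_assoc]
  simp

lemma counit_comul_base (P : C) :
    (ComonObj.comul (X := X) ▷ P ≫ (α_ X X P).hom) ≫
      (ComonObj.counit (X := X) ▷ (X ⊗ P) ≫ (λ_ (X ⊗ P)).hom) = 𝟙 (X ⊗ P) := by
  calc _ = (ComonObj.comul (X := X) ≫ ComonObj.counit (X := X) ▷ X) ▷ P ≫ (λ_ X).hom ▷ P := by
        simp [-ComonObj.counit_comul, -ComonObj.counit_comul_assoc]
    _ = _ := by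
        rw [ComonObj.counit_comul, ← comp_whiskerRight, Iso.inv_hom_id, id_whiskerRight]

lemma comul_counit_base (P : C) :
    (ComonObj.comul (X := X) ▷ P ≫ (α_ X X P).hom) ≫
      X ◁ (ComonObj.counit (X := X) ▷ P ≫ (λ_ P).hom) = 𝟙 (X ⊗ P) := by
  calc _ = (ComonObj.comul (X := X) ≫ X ◁ ComonObj.counit (X := X)) ▷ P ≫ (ρ_ X).hom ▷ P := by
        simp [-ComonObj.comul_counit, -ComonObj.comul_counit_assoc]
    _ = _ := by
        rw [ComonObj.comul_counit, ← comp_whiskerRight, Iso.inv_hom_id, id_whiskerRight]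

lemma comulAt_comp_comulAt {n : ℕ} : ∀ {i j : Fin n}, i ≤ j →
    comulAt X i ≫ comulAt X j.succ = comulAt X j ≫ comulAt X i.castSucc := by
  induction n with
  | zero => intro i; exact i.elim0
  | succ n ih =>
    intro i j
    induction i using Fin.cases with
    | zero =>
      intro _
      induction j using Fin.cases with
      | zero => exact comul_base X (tpow X n)
      | succ j => exact comul_exchange X (comulAt X j)
    | succ i =>
      intro hij
      induction j using Fin.cases with
      | zero => exact absurd hij (by simp)
      | succ j => exact whiskerLeft_congr X (ih (Fin.succ_le_succ_iff.1 hij))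

lemma comulAt_comp_counitAt_castSucc {n : ℕ} : ∀ (i : Fin n),
    comulAt X i ≫ counitAt X i.castSucc = 𝟙 _ := by
  induction n with
  | zero => intro i; exact i.elim0
  | succ n ih =>
    intro i
    induction i using Fin.cases with
    | zero => exact counit_comul_base X (tpow X n)
    | succ i => exact whiskerLeft_congr_id X (ih i)

lemma comulAt_comp_counitAt_succ {n : ℕ} : ∀ (i : Fin n),
    comulAt X i ≫ counitAt X i.succ = 𝟙 _ := by
  induction n with
  | zero => intro i; exact i.elim0
  | succ n ih =>
    intro i
    induction i using Fin.cases with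
    | zero => rw [counitAt_succ, counitAt_zero]; exact comul_counit_base X (tpow X n)
    | succ i => exact whiskerLeft_congr_id X (ih i)

lemma comulAt_comp_counitAt_of_le {n : ℕ} : ∀ {i j : Fin n}, i ≤ j →
    comulAt X i.castSucc ≫ counitAt X j.succ.succ = counitAt X j.succ ≫ comulAt X i := by
  induction n with
  | zero => intro i; exact i.elim0
  | succ n ih =>
    intro i j
    induction i using Fin.cases with
    | zero => intro _; exact comul_exchange X (counitAt X j)
    | succ i =>
      intro hij
      induction j using Fin.cases with
      | zero => exact absurd hij (by simp)
      | succ j => exact whiskerLeft_congr X (ih (Fin.succ_le_succ_iff.1 hij))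

lemma comulAt_comp_counitAt_of_gt {n : ℕ} : ∀ {i : Fin n} {j : Fin (n + 1)}, j ≤ i.castSucc →
    comulAt X i.succ ≫ counitAt X j.castSucc = counitAt X j ≫ comulAt X i := by
  induction n with
  | zero => intro i; exact i.elim0
  | succ n ih =>
    intro i j
    induction j using Fin.cases with
    | zero => intro _; exact (counit_exchange X (comulAt X i)).symm
    | succ j =>
      intro hij
      induction i using Fin.cases with
      | zero => exact absurd hij (by simp)
      | succ i => exact whiskerLeft_congr X (ih (Fin.succ_le_succ_iff.1 hij))

lemma counitAt_comp_counitAt {n : ℕ} : ∀ {i j : Fin (n + 1)}, i ≤ j →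
    counitAt X i.castSucc ≫ counitAt X j = counitAt X j.succ ≫ counitAt X i := by
  induction n with
  | zero =>
    intro i j _
    obtain rfl : i = 0 := Fin.ext (by omega)
    obtain rfl : j = 0 := Fin.ext (by omega)
    exact counit_exchange X (counitAt X (0 : Fin 1))
  | succ n ih =>
    intro i j
    induction i using Fin.cases with
    | zero => intro _; exact counit_exchange X (counitAt X j)
    | succ i =>
      intro hij
      induction j using Fin.cases with
      | zero => exact absurd hij (by simp)
      | succ j => exact whiskerLeft_congr X (ih (Fin.succ_le_succ_iff.1 hij))

lemma snoc_exchange {P Q P' Q' : C} (u : P ⊗ X ≅ P') (v : Q ⊗ X ≅ Q') (f : P ⟶ Q) (g : P' ⟶ Q')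
    (h : u.hom ≫ g = f ▷ X ≫ v.hom) :
    ((α_ X P X).hom ≫ X ◁ u.hom) ≫ X ◁ g = (X ◁ f) ▷ X ≫ ((α_ X Q X).hom ≫ X ◁ v.hom) := by
  rw [Category.assoc, ← MonoidalCategory.whiskerLeft_comp, h]
  simp

lemma snoc_comulAt {n : ℕ} : ∀ i : Fin n,
    (tpowSnoc X n).hom ≫ comulAt X i.castSucc = comulAt X i ▷ X ≫ (tpowSnoc X (n + 1)).hom := by
  induction n with
  | zero => intro i; exact i.elim0
  | succ n ih =>
    intro i
    induction i using Fin.cases with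
    | zero =>
      have key : ∀ {P P' : C} (u : P ⊗ X ≅ P'),
          ((α_ X P X).hom ≫ X ◁ u.hom) ≫ (ComonObj.comul (X := X) ▷ P' ≫ (α_ X X P').hom) =
          (ComonObj.comul (X := X) ▷ P ≫ (α_ X X P).hom) ▷ X ≫
            ((α_ X (X ⊗ P) X).hom ≫ X ◁ ((α_ X P X).hom ≫ X ◁ u.hom)) := by
        intro P P' u
        rw [Category.assoc, whisker_exchange_assoc]
        simp
      exact key (tpowSnoc X n)
    | succ i => exact snoc_exchange X _ _ _ _ (ih i)

lemma snoc_counitAt_base {P P' : C} (u : P ⊗ X ≅ P') :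
    ((α_ X P X).hom ≫ X ◁ u.hom) ≫ (ComonObj.counit (X := X) ▷ P' ≫ (λ_ P').hom) =
    (ComonObj.counit (X := X) ▷ P ≫ (λ_ P).hom) ▷ X ≫ u.hom := by
  rw [Category.assoc, whisker_exchange_assoc]
  simp

lemma snoc_counitAt {n : ℕ} : ∀ i : Fin (n + 1),
    (tpowSnoc X (n + 1)).hom ≫ counitAt X i.castSucc =
      counitAt X i ▷ X ≫ (tpowSnoc X n).hom := by
  induction n with
  | zero =>
    intro i
    obtain rfl : i = 0 := Fin.ext (by omega)
    exact snoc_counitAt_base X (tpowSnoc X 0)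
  | succ n ih =>
    intro i
    induction i using Fin.cases with
    | zero => exact snoc_counitAt_base X (tpowSnoc X (n + 1))
    | succ i => exact snoc_exchange X _ _ _ _ (ih i)

lemma snoc_counitAt_last : ∀ n : ℕ,
    (tpowSnoc X n).hom ≫ counitAt X (Fin.last n) =
      tpow X n ◁ ComonObj.counit (X := X) ≫ (ρ_ (tpow X n)).hom
  | 0 => by
    change ((λ_ X).hom ≫ (ρ_ X).inv) ≫ ComonObj.counit (X := X) ▷ 𝟙_ C ≫ (λ_ (𝟙_ C)).hom =
      𝟙_ C ◁ ComonObj.counit (X := X) ≫ (ρ_ (𝟙_ C)).hom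
    rw [← unitors_equal]
    simp [unitors_inv_equal]
  | n + 1 => by
    have key : ∀ {P P' : C} (u : P ⊗ X ≅ P') (g : P' ⟶ P)
        (_ : u.hom ≫ g = P ◁ ComonObj.counit (X := X) ≫ (ρ_ P).hom),
        ((α_ X P X).hom ≫ X ◁ u.hom) ≫ X ◁ g =
          (X ⊗ P) ◁ ComonObj.counit (X := X) ≫ (ρ_ (X ⊗ P)).hom := by
      intro P P' u g h
      rw [Category.assoc, ← MonoidalCategory.whiskerLeft_comp, h]
      simp
    exact key _ _ (snoc_counitAt_last n)

lemma snoc_comulAt_last : ∀ n : ℕ,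
    (tpowSnoc X n).hom ≫ comulAt X (Fin.last n) =
      tpow X n ◁ ComonObj.comul (X := X) ≫ (α_ (tpow X n) X X).inv ≫
        (tpowSnoc X n).hom ▷ X ≫ (tpowSnoc X (n + 1)).hom
  | 0 => by
    change ((λ_ X).hom ≫ (ρ_ X).inv) ≫ ComonObj.comul (X := X) ▷ 𝟙_ C ≫ (α_ X X (𝟙_ C)).hom =
      𝟙_ C ◁ ComonObj.comul (X := X) ≫ (α_ (𝟙_ C) X X).inv ≫
        ((λ_ X).hom ≫ (ρ_ X).inv) ▷ X ≫ (α_ X (𝟙_ C) X).hom ≫ X ◁ ((λ_ X).hom ≫ (ρ_ X).inv)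
    simp
  | n + 1 => by
    have key : ∀ {P P' P'' : C} (u : P ⊗ X ≅ P') (v : P' ⊗ X ≅ P'') (g : P' ⟶ P'')
        (_ : u.hom ≫ g = P ◁ ComonObj.comul (X := X) ≫ (α_ P X X).inv ≫ u.hom ▷ X ≫ v.hom),
        ((α_ X P X).hom ≫ X ◁ u.hom) ≫ X ◁ g =
          (X ⊗ P) ◁ ComonObj.comul (X := X) ≫ (α_ (X ⊗ P) X X).inv ≫
            ((α_ X P X).hom ≫ X ◁ u.hom) ▷ X ≫ ((α_ X P' X).hom ≫ X ◁ v.hom) := by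
      intro P P' P'' u v g h
      rw [Category.assoc, ← MonoidalCategory.whiskerLeft_comp, h]
      simp
    exact key _ _ _ (snoc_comulAt_last n)

end

section Rotation

variable [SymmetricCategory C] (X : C)

/-- Moving the first factor to the end, by the symmetry `X ⊗ X^{⊗ n} ≅ X^{⊗ n} ⊗ X`. -/
def tpowRot (n : ℕ) : tpow X (n + 1) ⟶ tpow X (n + 1) :=
  (β_ X (tpow X n)).hom ≫ (tpowSnoc X n).hom

variable [ComonObj X]

lemma rot_exchange {P Q P' Q' : C} (u : P ⊗ X ≅ P') (v : Q ⊗ X ≅ Q') (f : P ⟶ Q) (g : P' ⟶ Q')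
    (h : u.hom ≫ g = f ▷ X ≫ v.hom) :
    ((β_ X P).hom ≫ u.hom) ≫ g = X ◁ f ≫ ((β_ X Q).hom ≫ v.hom) := by
  rw [Category.assoc, h, BraidedCategory.braiding_naturality_right_assoc]

lemma rot_comulAt {n : ℕ} (i : Fin n) :
    tpowRot X n ≫ comulAt X i.castSucc = comulAt X i.succ ≫ tpowRot X (n + 1) :=
  rot_exchange X _ _ _ _ (snoc_comulAt X i)

lemma rot_counitAt {n : ℕ} (i : Fin (n + 1)) :
    tpowRot X (n + 1) ≫ counitAt X i.castSucc = counitAt X i.succ ≫ tpowRot X n :=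
  rot_exchange X _ _ _ _ (snoc_counitAt X i)

lemma rot_counitAt_last (n : ℕ) :
    tpowRot X n ≫ counitAt X (Fin.last n) = counitAt X 0 := by
  have key : ∀ {P P' : C} (u : P ⊗ X ≅ P') (g : P' ⟶ P)
      (_ : u.hom ≫ g = P ◁ ComonObj.counit (X := X) ≫ (ρ_ P).hom),
      ((β_ X P).hom ≫ u.hom) ≫ g = ComonObj.counit (X := X) ▷ P ≫ (λ_ P).hom := by
    intro P P' u g h
    rw [Category.assoc, h, ← BraidedCategory.braiding_naturality_left_assoc]
    simp
  rw [counitAt_zero]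
  exact key _ _ (snoc_counitAt_last X n)

lemma rot_rot_base {P P' P'' : C} (u : P ⊗ X ≅ P') (v : P' ⊗ X ≅ P'') :
    (α_ X X P).hom ≫ ((β_ X (X ⊗ P)).hom ≫ ((α_ X P X).hom ≫ X ◁ u.hom)) ≫
      ((β_ X P').hom ≫ v.hom) =
    (β_ (X ⊗ X) P).hom ≫ (α_ P X X).inv ≫ u.hom ▷ X ≫ v.hom := by
  simp only [Category.assoc]
  rw [BraidedCategory.braiding_naturality_right_assoc]
  have h : (β_ X X).hom ▷ P ≫ (β_ (X ⊗ X) P).hom ≫ P ◁ (β_ X X).hom =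
      (β_ (X ⊗ X) P).hom := by
    rw [← BraidedCategory.braiding_naturality_left, ← comp_whiskerRight_assoc,
      SymmetricCategory.symmetry]
    simp
  rw [← h]
  simp

lemma rot_comulAt_last (n : ℕ) :
    tpowRot X n ≫ comulAt X (Fin.last n) =
      comulAt X 0 ≫ tpowRot X (n + 1) ≫ tpowRot X (n + 1) := by
  have h : comulAt X (0 : Fin (n + 1)) ≫ tpowRot X (n + 1) ≫ tpowRot X (n + 1) =
      (ComonObj.comul (X := X) ▷ tpow X n) ≫ _ :=
    (Category.assoc _ _ _).trans (congrArg (fun q => (ComonObj.comul (X := X) ▷ tpow X n) ≫ q)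
      (rot_rot_base X (tpowSnoc X n) (tpowSnoc X (n + 1))))
  have key : ∀ {P P' P'' : C} (u : P ⊗ X ≅ P') (v : P' ⊗ X ≅ P'') (g : P' ⟶ P'')
      (_ : u.hom ≫ g = P ◁ ComonObj.comul (X := X) ≫ (α_ P X X).inv ≫ u.hom ▷ X ≫ v.hom),
      ((β_ X P).hom ≫ u.hom) ≫ g = ComonObj.comul (X := X) ▷ P ≫
        (β_ (X ⊗ X) P).hom ≫ (α_ P X X).inv ≫ u.hom ▷ X ≫ v.hom := by
    intro P P' P'' u v g h
    rw [Category.assoc, h, BraidedCategory.braiding_naturality_left_assoc]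
  rw [h]
  exact key _ _ _ (snoc_comulAt_last X n)

end Rotation

end TensorPowers

section CoHochschild

variable {C : Type*} [Category* C] [MonoidalCategory C] [SymmetricCategory C]

/-- The cofaces of the coHochschild object: `δ_i = C^{⊗ i} ⊗ Δ ⊗ C^{⊗ (n - i)}` for `i ≤ n`, and
`δ_{n + 1}` comultiplies the first factor and moves the first tensor factor of the result to the
end. -/
def coTHHδ (X : C) [ComonObj X] {n : ℕ} (i : Fin (n + 2)) : tpow X (n + 1) ⟶ tpow X (n + 2) :=
  Fin.lastCases (comulAt X 0 ≫ tpowRot X (n + 1)) (fun j => comulAt X j) i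

/-- The codegeneracies of the coHochschild object: `σ_i = C^{⊗ (i + 1)} ⊗ ε ⊗ C^{⊗ (n - i)}`. -/
def coTHHσ (X : C) [ComonObj X] {n : ℕ} (i : Fin (n + 1)) : tpow X (n + 2) ⟶ tpow X (n + 1) :=
  counitAt X i.succ

section

variable (X : C) [ComonObj X]

lemma coTHHδ_last (n : ℕ) :
    coTHHδ X (Fin.last (n + 1)) = comulAt X (0 : Fin (n + 1)) ≫ tpowRot X (n + 1) := by
  simp [coTHHδ]

lemma coTHHδ_castSucc {n : ℕ} (j : Fin (n + 1)) : coTHHδ X j.castSucc = comulAt X j := by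
  simp [coTHHδ]

end

/-- The cosimplicial coHochschild object `coTHH^•(C)` of a counital coalgebra, given by its
cofaces and codegeneracies. -/
def coTHHData (A : Comon C) : CosimplicialData C where
  obj n := tpow A.X (n + 1)
  δ i := coTHHδ A.X i
  σ i := coTHHσ A.X i
  δ_comp_δ := by
    intro n i j
    have h0 {m : ℕ} (i : Fin (m + 1)) : comulAt A.X (0 : Fin (m + 1)) ≫ comulAt A.X i.succ =
        comulAt A.X i ≫ comulAt A.X 0 := comulAt_comp_comulAt A.X (Fin.zero_le i)
    induction j using Fin.lastCases with
    | last =>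
      intro _
      rw [Fin.succ_last, coTHHδ_last, coTHHδ_castSucc, coTHHδ_last]
      induction i using Fin.lastCases with
      | last =>
        rw [coTHHδ_last, Category.assoc, Category.assoc, rot_comulAt_last]
        have h1 : tpowRot A.X (n + 1) ≫ comulAt A.X (0 : Fin (n + 2)) =
          comulAt A.X (0 : Fin (n + 1)).succ ≫ tpowRot A.X (n + 2) :=
          rot_comulAt A.X (0 : Fin (n + 1))
        rw [← Category.assoc (tpowRot _ _), h1, Category.assoc, ← Category.assoc, h0,
          Category.assoc]
      | cast i =>
        rw [coTHHδ_castSucc, Category.assoc, rot_comulAt, ← Category.assoc, ← Category.assoc, h0]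
    | cast j =>
      intro hij
      obtain ⟨i, rfl⟩ := Fin.eq_castSucc_of_ne_last
        (Fin.ne_last_of_lt (hij.trans_lt (Fin.castSucc_lt_last j)))
      rw [Fin.succ_castSucc, coTHHδ_castSucc, coTHHδ_castSucc, coTHHδ_castSucc, coTHHδ_castSucc]
      exact comulAt_comp_comulAt _ hij
  δ_comp_σ_of_le := by
    intro n i j hij
    obtain ⟨i, rfl⟩ := Fin.eq_castSucc_of_ne_last
        (Fin.ne_last_of_lt (hij.trans_lt (Fin.castSucc_lt_last j)))
    rw [coTHHδ_castSucc, coTHHδ_castSucc]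
    exact comulAt_comp_counitAt_of_le _ hij
  δ_comp_σ_self := by
    intro n i
    rw [coTHHδ_castSucc]
    exact comulAt_comp_counitAt_succ _ i
  δ_comp_σ_succ := by
    intro n i
    induction i using Fin.lastCases with
    | last =>
      rw [Fin.succ_last, coTHHδ_last, Category.assoc, coTHHσ, Fin.succ_last, rot_counitAt_last]
      exact comulAt_comp_counitAt_castSucc _ 0
    | cast i =>
      rw [Fin.succ_castSucc, coTHHδ_castSucc, coTHHσ, Fin.succ_castSucc]
      exact comulAt_comp_counitAt_castSucc _ i.succ
  δ_comp_σ_of_gt := by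
    intro n i j hij
    induction i using Fin.lastCases with
    | last =>
      rw [Fin.succ_last, coTHHδ_last, coTHHδ_last, coTHHσ, coTHHσ, Category.assoc,
        Fin.succ_castSucc, rot_counitAt, ← Category.assoc, ← Category.assoc]
      congr 1
      exact comulAt_comp_counitAt_of_le _ (Fin.zero_le j)
    | cast i =>
      rw [Fin.succ_castSucc, coTHHδ_castSucc, coTHHδ_castSucc, coTHHσ, coTHHσ, Fin.succ_castSucc]
      exact comulAt_comp_counitAt_of_gt _ (Fin.succ_le_castSucc_iff.2 hij)
  σ_comp_σ := by
    intro n i j hij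
    exact counitAt_comp_counitAt A.X (i := i.succ) (j := j.succ) (Fin.succ_le_succ_iff.2 hij)

/-- The cosimplicial coHochschild object `coTHH^•(C)` of a counital coalgebra `C`. -/
noncomputable def coTHHObj (A : Comon C) : SimplexCategory ⥤ C := (coTHHData A).toFunctor

end CoHochschild

section CartesianCoHochschild

/-- The cosimplicial object `coTHH^•_×(X)`: the coHochschild object of `X`, seen as a coalgebra
via the diagonal `X ⟶ X × X` and `X ⟶ *`, in the cartesian symmetric monoidal category
`(D, ×, *)`. -/
noncomputable def coTHHCart {D : Type*} [Category* D] [HasFiniteProducts D] (X : D) :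
    SimplexCategory ⥤ D :=
  letI : CartesianMonoidalCategory D := CartesianMonoidalCategory.ofHasFiniteProducts
  letI : BraidedCategory D := BraidedCategory.ofCartesianMonoidalCategory
  coTHHObj ((cartesianComon D).obj X)

end CartesianCoHochschild

section Permutations

variable {C : Type*} [Category* C] [MonoidalCategory C] [SymmetricCategory C]

/-- Insert the first factor of `X ⊗ X^{⊗ n}` at position `p` of `X^{⊗ (n + 1)}`, keeping the order
of the other factors. -/
def insertAt (X : C) : ∀ n : ℕ, Fin (n + 1) → (X ⊗ tpow X n ⟶ tpow X (n + 1))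
  | 0 => fun _ => 𝟙 (X ⊗ tpow X 0)
  | n + 1 => Fin.cases (𝟙 (X ⊗ tpow X (n + 1)))
      (fun q => (α_ X X (tpow X n)).inv ≫ (β_ X X).hom ▷ tpow X n ≫ (α_ X X (tpow X n)).hom ≫
        X ◁ insertAt X n q)

/-- The permutation induced by `σ` on `{1, …, n}` and `{0, …, n} \ {σ 0}`, after relabelling both
in increasing order. -/
def tailPerm {n : ℕ} (σ : Equiv.Perm (Fin (n + 1))) : Equiv.Perm (Fin n) :=
  (finSuccAboveEquiv 0).trans
    ((σ.subtypeEquiv (fun a => by simp : ∀ a, a ≠ 0 ↔ σ a ≠ σ 0)).trans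
      (finSuccAboveEquiv (σ 0)).symm)

lemma succAbove_tailPerm {n : ℕ} (σ : Equiv.Perm (Fin (n + 1))) (k : Fin n) :
    (σ 0).succAbove (tailPerm σ k) = σ k.succ := by
  have h : finSuccAboveEquiv (σ 0) (tailPerm σ k) =
      σ.subtypeEquiv (fun a => by simp : ∀ a, a ≠ 0 ↔ σ a ≠ σ 0) (finSuccAboveEquiv 0 k) :=
    Equiv.apply_symm_apply _ _
  exact congrArg Subtype.val h

/-- A permutation is determined by the image of `0` and the induced permutation of the rest, and
both can be prescribed. -/
lemma exists_perm_cons {n : ℕ} (q : Fin (n + 1)) (ρ : Equiv.Perm (Fin n)) :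
    ∃ σ : Equiv.Perm (Fin (n + 1)), σ 0 = q ∧ tailPerm σ = ρ := by
  let f : Fin (n + 1) → Fin (n + 1) := Fin.cases q (fun k => q.succAbove (ρ k))
  have hf : Function.Injective f := by
    intro i j
    induction i using Fin.cases <;> induction j using Fin.cases <;>
      simp [f, Fin.succAbove_ne, Fin.ne_succAbove]
  let σ : Equiv.Perm (Fin (n + 1)) := Equiv.ofBijective f (Finite.injective_iff_bijective.1 hf)
  have h0 : σ 0 = q := rfl
  refine ⟨σ, h0, Equiv.ext fun k => ?_⟩
  have h := succAbove_tailPerm σ k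
  rw [h0] at h
  exact Fin.succAbove_right_injective h

/-- The action of `σ ∈ Σ_n` on `X^{⊗ n}` by permuting the factors: the `k`-th factor is moved to
position `σ k`. -/
def permMap (X : C) : ∀ n : ℕ, Equiv.Perm (Fin n) → (tpow X n ⟶ tpow X n)
  | 0 => fun _ => 𝟙 (tpow X 0)
  | n + 1 => fun σ => X ◁ permMap X n (tailPerm σ) ≫ insertAt X n (σ 0)

section

variable {X Y : C} (f : X ⟶ Y)

lemma insert_naturality_aux {P Q : C} (g : P ⟶ Q) {P' Q' : C} {s : X ⊗ P ⟶ P'} {t : Y ⊗ Q ⟶ Q'}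
    {g' : P' ⟶ Q'} (h : s ≫ g' = (f ⊗ₘ g) ≫ t) :
    ((α_ X X P).inv ≫ (β_ X X).hom ▷ P ≫ (α_ X X P).hom ≫ X ◁ s) ≫ (f ⊗ₘ g') =
      (f ⊗ₘ (f ⊗ₘ g)) ≫ ((α_ Y Y Q).inv ≫ (β_ Y Y).hom ▷ Q ≫ (α_ Y Y Q).hom ≫ Y ◁ t) := by
  have h1 : X ◁ s ≫ (f ⊗ₘ g') = (f ⊗ₘ (f ⊗ₘ g)) ≫ Y ◁ t := by
    rw [← id_tensorHom, ← id_tensorHom, tensorHom_comp_tensorHom, tensorHom_comp_tensorHom, h]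
    simp
  have h2 : ((f ⊗ₘ f) ⊗ₘ g) ≫ (β_ Y Y).hom ▷ Q = (β_ X X).hom ▷ P ≫ ((f ⊗ₘ f) ⊗ₘ g) := by
    rw [← tensorHom_id, ← tensorHom_id, tensorHom_comp_tensorHom, tensorHom_comp_tensorHom,
      BraidedCategory.braiding_naturality]
    simp
  simp only [Category.assoc]
  rw [h1, ← associator_naturality_assoc, ← reassoc_of% h2, ← associator_inv_naturality_assoc]

lemma insertAt_naturality : ∀ (n : ℕ) (p : Fin (n + 1)),
    insertAt X n p ≫ tpowMap f (n + 1) = (f ⊗ₘ tpowMap f n) ≫ insertAt Y n p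
  | 0, _ => (Category.id_comp _).trans (Category.comp_id _).symm
  | n + 1, p => by
    induction p using Fin.cases with
    | zero => exact (Category.id_comp _).trans (Category.comp_id _).symm
    | succ q => exact insert_naturality_aux f _ (insertAt_naturality n q)

lemma permMap_naturality : ∀ (n : ℕ) (σ : Equiv.Perm (Fin n)),
    permMap X n σ ≫ tpowMap f n = tpowMap f n ≫ permMap Y n σ
  | 0, _ => (Category.id_comp _).trans (Category.comp_id _).symm
  | n + 1, σ => by
    have key : ∀ {P Q P' Q' : C} (s : P ⟶ P) (t : Q ⟶ Q) (g : P ⟶ Q) (u : X ⊗ P ⟶ P')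
        (v : Y ⊗ Q ⟶ Q') (g' : P' ⟶ Q'), s ≫ g = g ≫ t → u ≫ g' = (f ⊗ₘ g) ≫ v →
        (X ◁ s ≫ u) ≫ g' = (f ⊗ₘ g) ≫ Y ◁ t ≫ v := by
      intro P Q P' Q' s t g u v g' h1 h2
      rw [Category.assoc, h2, ← id_tensorHom, ← id_tensorHom, tensorHom_comp_tensorHom_assoc,
        tensorHom_comp_tensorHom_assoc, h1]
      simp
    exact key _ _ _ _ _ _ (permMap_naturality n (tailPerm σ)) (insertAt_naturality f n (σ 0))

end

section

variable (X : C)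

lemma insertAt_zero : ∀ n : ℕ, insertAt X n 0 = 𝟙 (X ⊗ tpow X n)
  | 0 => rfl
  | _ + 1 => rfl

lemma insertAt_succ (n : ℕ) (q : Fin (n + 1)) : insertAt X (n + 1) q.succ =
    (α_ X X (tpow X n)).inv ≫ (β_ X X).hom ▷ tpow X n ≫ (α_ X X (tpow X n)).hom ≫
        X ◁ insertAt X n q := rfl

lemma exists_insertAt_tpowAdd (b : ℕ) : ∀ (a : ℕ) (p : Fin (a + 1)), ∃ q : Fin (b + a + 1),
    insertAt X a p ▷ tpow X b ≫ (tpowAdd X (a + 1) b).hom =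
      (α_ X (tpow X a) (tpow X b)).hom ≫ X ◁ (tpowAdd X a b).hom ≫ insertAt X (b + a) q := by
  have key0 : ∀ (a : ℕ), ∃ q : Fin (b + a + 1),
    insertAt X a 0 ▷ tpow X b ≫ (tpowAdd X (a + 1) b).hom =
      (α_ X (tpow X a) (tpow X b)).hom ≫ X ◁ (tpowAdd X a b).hom ≫ insertAt X (b + a) q := by
    intro a
    refine ⟨0, ?_⟩
    rw [insertAt_zero, insertAt_zero]
    have : ∀ {A B T : C} (t : A ⊗ B ⟶ T), (𝟙 (X ⊗ A)) ▷ B ≫ (α_ X A B).hom ≫ X ◁ t =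
        (α_ X A B).hom ≫ X ◁ t ≫ 𝟙 (X ⊗ T) := by
      intros; simp
    exact this _
  intro a
  induction a with
  | zero =>
    intro p
    obtain rfl : p = 0 := Fin.ext (by omega)
    exact key0 0
  | succ a ih =>
    intro p
    induction p using Fin.cases with
    | zero => exact key0 (a + 1)
    | succ p =>
      obtain ⟨q, hq⟩ := ih p
      refine ⟨q.succ, ?_⟩
      have key : ∀ {A B T A' T' : C} (t : A ⊗ B ⟶ T) (u : X ⊗ A ⟶ A') (v : X ⊗ T ⟶ T')
          (t' : A' ⊗ B ⟶ T'), u ▷ B ≫ t' = (α_ X A B).hom ≫ X ◁ t ≫ v →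
          ((α_ X X A).inv ≫ (β_ X X).hom ▷ A ≫ (α_ X X A).hom ≫ X ◁ u) ▷ B ≫
            (α_ X A' B).hom ≫ X ◁ t' =
          (α_ X (X ⊗ A) B).hom ≫ X ◁ ((α_ X A B).hom ≫ X ◁ t) ≫
            ((α_ X X T).inv ≫ (β_ X X).hom ▷ T ≫ (α_ X X T).hom ≫ X ◁ v) := by
        intro A B T A' T' t u v t' h
        have h' : (X ◁ u) ▷ B ≫ (α_ X A' B).hom ≫ X ◁ t' =
            (α_ X (X ⊗ A) B).hom ≫ X ◁ ((α_ X A B).hom ≫ X ◁ t ≫ v) := by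
          rw [← h]; simp
        have h1 : X ◁ X ◁ t ≫ (α_ X X T).inv ≫ (β_ X X).hom ▷ T ≫ (α_ X X T).hom =
            (α_ X X (A ⊗ B)).inv ≫ (β_ X X).hom ▷ (A ⊗ B) ≫ (α_ X X (A ⊗ B)).hom ≫
              X ◁ X ◁ t := by
          rw [associator_inv_naturality_right_assoc, whisker_exchange_assoc,
            associator_naturality_right]
        simp only [comp_whiskerRight, Category.assoc, MonoidalCategory.whiskerLeft_comp] at h' ⊢
        rw [h', reassoc_of% h1]
        monoidal
      exact key _ _ _ _ hq

lemma permMap_one : ∀ n : ℕ, permMap X n 1 = 𝟙 (tpow X n)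
  | 0 => rfl
  | n + 1 => by
    have h : tailPerm (1 : Equiv.Perm (Fin (n + 1))) = 1 := Equiv.ext fun k => by
      have h := succAbove_tailPerm (1 : Equiv.Perm (Fin (n + 1))) k
      simpa using h
    change X ◁ permMap X n (tailPerm 1) ≫ insertAt X n ((1 : Equiv.Perm (Fin (n + 1))) 0) = _
    rw [h, permMap_one n, Equiv.Perm.one_apply, insertAt_zero]
    have key : ∀ B : C, X ◁ 𝟙 B ≫ 𝟙 (X ⊗ B) = 𝟙 (X ⊗ B) := by
      intro B; simp
    exact key _

/-- Permuting the first `a` factors of `X^{⊗ (b + a)}` is the action of a permutation in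
`Σ_{b + a}`. -/
lemma exists_permMap_left (b : ℕ) : ∀ (a : ℕ) (σ : Equiv.Perm (Fin a)),
    ∃ ρ : Equiv.Perm (Fin (b + a)), permMap X a σ ▷ tpow X b ≫ (tpowAdd X a b).hom =
      (tpowAdd X a b).hom ≫ permMap X (b + a) ρ
  | 0, σ => ⟨1, by
    rw [permMap_one]
    have key : ∀ B : C, 𝟙 (𝟙_ C) ▷ B ≫ (λ_ B).hom = (λ_ B).hom ≫ 𝟙 B := by
      intro B; simp
    exact key _⟩
  | a + 1, σ => by
    obtain ⟨ρ, hρ⟩ := exists_permMap_left b a (tailPerm σ)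
    obtain ⟨q, hq⟩ := exists_insertAt_tpowAdd X b a (σ 0)
    obtain ⟨τ, hτ, hτ'⟩ := exists_perm_cons q ρ
    refine ⟨τ, ?_⟩
    change (X ◁ permMap X a (tailPerm σ) ≫ insertAt X a (σ 0)) ▷ tpow X b ≫ _ =
      _ ≫ (X ◁ permMap X (b + a) (tailPerm τ) ≫ insertAt X (b + a) (τ 0))
    rw [hτ, hτ']
    have key : ∀ {A B T A' T' : C} (t : A ⊗ B ⟶ T) (s : A ⟶ A) (r : T ⟶ T) (u : X ⊗ A ⟶ A')
        (v : X ⊗ T ⟶ T') (t' : A' ⊗ B ⟶ T'), s ▷ B ≫ t = t ≫ r →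
        u ▷ B ≫ t' = (α_ X A B).hom ≫ X ◁ t ≫ v →
        (X ◁ s ≫ u) ▷ B ≫ t' = ((α_ X A B).hom ≫ X ◁ t) ≫ X ◁ r ≫ v := by
      intro A B T A' T' t s r u v t' h1 h2
      rw [comp_whiskerRight, Category.assoc, h2, Category.assoc,
        ← MonoidalCategory.whiskerLeft_comp_assoc, ← h1]
      simp
    exact key _ _ _ _ _ _ hρ hq

/-- Permuting the last `b` factors of `X^{⊗ (b + a)}` is the action of a permutation in
`Σ_{b + a}`. -/
lemma exists_permMap_right (b : ℕ) (σ : Equiv.Perm (Fin b)) : ∀ (a : ℕ),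
    ∃ ρ : Equiv.Perm (Fin (b + a)), tpow X a ◁ permMap X b σ ≫ (tpowAdd X a b).hom =
      (tpowAdd X a b).hom ≫ permMap X (b + a) ρ
  | 0 => ⟨σ, leftUnitor_naturality _⟩
  | a + 1 => by
    obtain ⟨ρ, hρ⟩ := exists_permMap_right b σ a
    obtain ⟨τ, hτ, hτ'⟩ := exists_perm_cons 0 ρ
    refine ⟨τ, ?_⟩
    change _ = _ ≫ (X ◁ permMap X (b + a) (tailPerm τ) ≫ insertAt X (b + a) (τ 0))
    rw [hτ, hτ', insertAt_zero]
    have key : ∀ {A B T : C} (t : A ⊗ B ⟶ T) (s : B ⟶ B) (r : T ⟶ T), A ◁ s ≫ t = t ≫ r →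
        (X ⊗ A) ◁ s ≫ ((α_ X A B).hom ≫ X ◁ t) =
          ((α_ X A B).hom ≫ X ◁ t) ≫ X ◁ r ≫ 𝟙 (X ⊗ T) := by
      intro A B T t s r h
      rw [Category.comp_id, Category.assoc, ← MonoidalCategory.whiskerLeft_comp, ← h]
      simp
    exact key _ _ _ hρ

end

end Permutations

section FixedPoints

variable {C : Type u} [Category.{v} C] [HasLimits C]

/-- The fixed points of a family of endomorphisms `φ_g : Y ⟶ Y`: the equalizer of
`(φ_g)_g` and `(𝟙)_g`, as morphisms from `Y` to `∏_g Y`. -/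
noncomputable def fixedPoints {G : Type} (Y : C) (φ : G → (Y ⟶ Y)) : C :=
  equalizer (Pi.lift fun g : G => φ g) (Pi.lift fun _ : G => 𝟙 Y)

namespace fixedPoints

variable {G : Type} {Y : C} (φ : G → (Y ⟶ Y))

/-- The inclusion of the fixed points. -/
noncomputable def ι : fixedPoints Y φ ⟶ Y :=
  equalizer.ι (Pi.lift fun g : G => φ g) (Pi.lift fun _ : G => 𝟙 Y)

lemma ι_comp (g : G) : ι φ ≫ φ g = ι φ := by
  have h := equalizer.condition (Pi.lift fun g : G => φ g) (Pi.lift fun _ : G => 𝟙 Y) =≫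
    Pi.π _ g
  simp only [Category.assoc, limit.lift_π, Fan.mk_π_app, Category.comp_id] at h
  exact h

variable {φ}

/-- A morphism which is invariant under all the `φ_g` factors through the fixed points. -/
noncomputable def lift {Z : C} (k : Z ⟶ Y) (hk : ∀ g, k ≫ φ g = k) : Z ⟶ fixedPoints Y φ :=
  equalizer.lift k (Pi.hom_ext _ _ (fun g => by simp [hk]))

lemma lift_ι {Z : C} (k : Z ⟶ Y) (hk : ∀ g, k ≫ φ g = k) : lift k hk ≫ ι φ = k :=
  equalizer.lift_ι _ _

lemma hom_ext {Z : C} {k l : Z ⟶ fixedPoints Y φ} (h : k ≫ ι φ = l ≫ ι φ) : k = l :=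
  equalizer.hom_ext h

end fixedPoints

end FixedPoints

section SymmetricCofree

section

variable {D : Type u} [Category.{v} D] [MonoidalCategory D] [SymmetricCategory D] [HasLimits D]

/-- The fixed points `(X^{⊗ n})^{Σ_n}`. -/
noncomputable abbrev symInv (X : D) (n : ℕ) : D := fixedPoints (tpow X n) (permMap X n)

/-- The action of `Σ_a × Σ_b` on `X^{⊗ a} ⊗ X^{⊗ b}`. -/
def youngMap (X : D) (a b : ℕ) (g : Equiv.Perm (Fin a) × Equiv.Perm (Fin b)) :
    tpow X a ⊗ tpow X b ⟶ tpow X a ⊗ tpow X b :=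
  permMap X a g.1 ⊗ₘ permMap X b g.2

/-- The fixed points `(X^{⊗ a} ⊗ X^{⊗ b})^{Σ_a × Σ_b}`. -/
noncomputable abbrev youngInv (X : D) (a b : ℕ) : D :=
  fixedPoints (tpow X a ⊗ tpow X b) (youngMap X a b)

/-- The canonical morphism
`(X^{⊗ a})^{Σ_a} ⊗ (X^{⊗ b})^{Σ_b} ⟶ (X^{⊗ a} ⊗ X^{⊗ b})^{Σ_a × Σ_b}`. -/
noncomputable def tensorInv (X : D) (a b : ℕ) : symInv X a ⊗ symInv X b ⟶ youngInv X a b :=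
  fixedPoints.lift (fixedPoints.ι (permMap X a) ⊗ₘ fixedPoints.ι (permMap X b)) (fun g => by
    rw [youngMap, tensorHom_comp_tensorHom, fixedPoints.ι_comp, fixedPoints.ι_comp])

lemma tpowAdd_inv_youngMap (X : D) (a b : ℕ)
    (g : Equiv.Perm (Fin a) × Equiv.Perm (Fin b)) {Z : D} (k : Z ⟶ tpow X (b + a))
    (hk : ∀ ρ, k ≫ permMap X (b + a) ρ = k) :
    (k ≫ (tpowAdd X a b).inv) ≫ youngMap X a b g = k ≫ (tpowAdd X a b).inv := by
  obtain ⟨ρ, hρ⟩ := exists_permMap_left X b a g.1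
  obtain ⟨τ, hτ⟩ := exists_permMap_right X b g.2 a
  rw [← cancel_mono (tpowAdd X a b).hom, youngMap, MonoidalCategory.tensorHom_def]
  simp only [Category.assoc]
  rw [hτ, reassoc_of% hρ]
  simp [reassoc_of% hk ρ, hk τ]

/-- The restriction `(X^{⊗ (a + b)})^{Σ_{a + b}} ⟶ (X^{⊗ a} ⊗ X^{⊗ b})^{Σ_a × Σ_b}`, i.e. the
morphism compatible with the inclusions of the fixed points and with the canonical isomorphism
`X^{⊗ a} ⊗ X^{⊗ b} ≅ X^{⊗ (a + b)}`. -/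
noncomputable def resMap (X : D) (a b : ℕ) : symInv X (b + a) ⟶ youngInv X a b :=
  fixedPoints.lift (fixedPoints.ι (permMap X (b + a)) ≫ (tpowAdd X a b).inv)
    (fun g => tpowAdd_inv_youngMap X a b g _ (fixedPoints.ι_comp _))

/-- The functoriality of `X ↦ (X^{⊗ n})^{Σ_n}`. -/
noncomputable def symInvMap {X Y : D} (f : X ⟶ Y) (n : ℕ) : symInv X n ⟶ symInv Y n :=
  fixedPoints.lift (fixedPoints.ι (permMap X n) ≫ tpowMap f n) (fun σ => by
    rw [Category.assoc, ← permMap_naturality, ← Category.assoc, fixedPoints.ι_comp])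

lemma tpowMap_id (X : D) : ∀ n : ℕ, tpowMap (𝟙 X) n = 𝟙 (tpow X n)
  | 0 => rfl
  | n + 1 => by
    change 𝟙 X ⊗ₘ tpowMap (𝟙 X) n = _
    rw [tpowMap_id X n, id_tensorHom_id]
    rfl

lemma tpowMap_comp {X Y Z : D} (f : X ⟶ Y) (g : Y ⟶ Z) :
    ∀ n : ℕ, tpowMap (f ≫ g) n = tpowMap f n ≫ tpowMap g n
  | 0 => (Category.comp_id _).symm
  | n + 1 => by
    change (f ≫ g) ⊗ₘ tpowMap (f ≫ g) n = _
    rw [tpowMap_comp f g n, ← tensorHom_comp_tensorHom]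
    rfl

lemma symInvMap_id (X : D) (n : ℕ) : symInvMap (𝟙 X) n = 𝟙 (symInv X n) :=
  fixedPoints.hom_ext (by
    rw [symInvMap, fixedPoints.lift_ι, tpowMap_id, Category.comp_id, Category.id_comp])

lemma symInvMap_comp {X Y Z : D} (f : X ⟶ Y) (g : Y ⟶ Z) (n : ℕ) :
    symInvMap (f ≫ g) n = symInvMap f n ≫ symInvMap g n :=
  fixedPoints.hom_ext (by
    rw [Category.assoc, symInvMap, symInvMap, symInvMap, fixedPoints.lift_ι, fixedPoints.lift_ι,
      ← Category.assoc, fixedPoints.lift_ι, tpowMap_comp, Category.assoc])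

/-- The underlying object of the cofree cocommutative conilpotent coalgebra:
`S^c(X) = ⨁_{n ≥ 0} (X^{⊗ n})^{Σ_n}`. -/
noncomputable abbrev symCofree [HasColimits D] (X : D) : D := ∐ fun n : ℕ => symInv X n

end

/-- The functor `S^c : D ⥤ D`. -/
noncomputable def symCofreeFunctor (D : Type u) [Category.{v} D] [MonoidalCategory D]
    [SymmetricCategory D] [HasLimits D] [HasColimits D] : D ⥤ D where
  obj X := symCofree X
  map f := Limits.Sigma.map fun n => symInvMap f n
  map_id X := Limits.Sigma.hom_ext _ _ fun n => by
    rw [Limits.Sigma.ι_map, symInvMap_id, Category.id_comp]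
    exact (Category.comp_id _).symm
  map_comp f g := Limits.Sigma.hom_ext _ _ fun n => by
    rw [Limits.Sigma.ι_map, symInvMap_comp, Limits.Sigma.ι_map_assoc, Limits.Sigma.ι_map,
      Category.assoc]

open Classical in
/-- The canonical morphism from the sum to the product of a family of objects, induced by the
identity of each object (and zero morphisms between distinct ones). -/
noncomputable def sumToProd {D : Type u} [Category.{v} D] [HasZeroMorphisms D] [HasLimits D]
    [HasColimits D] {J : Type} (f : J → D) : ∐ f ⟶ ∏ᶜ f :=
  Limits.Sigma.desc fun i => Pi.lift fun j =>
    if h : i = j then eqToHom (congrArg f h) else 0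

/-- Cofree-friendly symmetric monoidal categories: in addition to being complete, cocomplete and
having a zero object, tensoring with any object preserves colimits, and finite sums and finite
products agree. -/
class CofreeFriendly (D : Type u) [Category.{v} D] [MonoidalCategory D] [SymmetricCategory D]
    [HasZeroObject D] [HasZeroMorphisms D] [HasLimits D] [HasColimits D] : Prop where
  preservesColimits (X : D) : PreservesColimits (tensorLeft X)
  isIso_sumToProd {J : Type} [Finite J] (f : J → D) : IsIso (sumToProd f)

/-- Permutation-friendly symmetric monoidal categories: the canonical morphisms
`(X^{⊗ a})^{Σ_a} ⊗ (X^{⊗ b})^{Σ_b} ⟶ (X^{⊗ a} ⊗ X^{⊗ b})^{Σ_a × Σ_b}` are isomorphisms. -/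
class PermutationFriendly (D : Type u) [Category.{v} D] [MonoidalCategory D]
    [SymmetricCategory D] [HasLimits D] : Prop where
  isIso_tensorInv (X : D) (a b : ℕ) : IsIso (tensorInv X a b)

attribute [instance] CofreeFriendly.isIso_sumToProd PermutationFriendly.isIso_tensorInv

section

variable {D : Type u} [Category.{v} D] [MonoidalCategory D] [SymmetricCategory D]
  [HasZeroObject D] [HasZeroMorphisms D] [HasLimits D] [HasColimits D]

/-- The counit `S^c(X) ⟶ 1` of the cofree cocommutative coalgebra: the inclusion
`(X^{⊗ 0})^{Σ_0} ⟶ 1` on the summand of index `0`, and zero on the other summands. -/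
noncomputable def symCounit (X : D) : symCofree X ⟶ 𝟙_ D :=
  Limits.Sigma.desc fun n => match n with
    | 0 => fixedPoints.ι (permMap X 0)
    | _ + 1 => 0

/-- The component `(X^{⊗ n})^{Σ_n} ⟶ S^c(X) ⊗ S^c(X)` of the comultiplication which is indexed by
a decomposition `a + b = n`. -/
noncomputable def symComulComponent [PermutationFriendly D] (X : D) (n : ℕ)
    (p : Finset.HasAntidiagonal.antidiagonal n) : symInv X n ⟶ symCofree X ⊗ symCofree X :=
  eqToHom (congrArg (symInv X)
    (by rw [Nat.add_comm]; exact (Finset.HasAntidiagonal.mem_antidiagonal.1 p.2).symm)) ≫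
    resMap X p.1.1 p.1.2 ≫ inv (tensorInv X p.1.1 p.1.2) ≫
      (Limits.Sigma.ι (symInv X) p.1.1 ⊗ₘ Limits.Sigma.ι (symInv X) p.1.2)

/-- The comultiplication of the cofree cocommutative coalgebra: on `(X^{⊗ n})^{Σ_n}`, it is the
diagonal into the product over all decompositions `a + b = n`, identified with the corresponding
sum, followed by `res_{a, b}`, the inverse of
`(X^{⊗ a})^{Σ_a} ⊗ (X^{⊗ b})^{Σ_b} ≅ (X^{⊗ a} ⊗ X^{⊗ b})^{Σ_a × Σ_b}`, and the inclusion
of the summands on each component. -/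
noncomputable def symComul [CofreeFriendly D] [PermutationFriendly D] (X : D) :
    symCofree X ⟶ symCofree X ⊗ symCofree X :=
  Limits.Sigma.desc fun n =>
    Pi.lift (fun _ : Finset.HasAntidiagonal.antidiagonal n => 𝟙 (symInv X n)) ≫
      inv (sumToProd fun _ : Finset.HasAntidiagonal.antidiagonal n => symInv X n) ≫
        Limits.Sigma.desc (symComulComponent X n)

end

end SymmetricCofree

section HomotopyLimits

section Reedy

variable {J : Type} [SmallCategory J] {C : Type u} [Category.{v} C]
  [HasLimitsOfSize.{0, 0} C]

/-- The matching category at `j`: the epimorphisms `j ⟶ k` which are not isomorphisms. For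
`J = Δ` these are the surjections `[n] ⟶ [k]`, `k ≠ n`; for `J = Δᵒᵖ`, they correspond to the
injections `[k] ⟶ [n]`, `k ≠ n`. -/
abbrev MatchingCategory (j : J) : Type :=
  ObjectProperty.FullSubcategory (fun g : Under j => Epi g.hom ∧ ¬ IsIso g.hom)

/-- The diagram on the matching category whose limit is the matching object. -/
abbrev matchingDiagram (F : J ⥤ C) (j : J) : MatchingCategory j ⥤ C :=
  ObjectProperty.ι _ ⋙ Under.forget j ⋙ F

/-- The matching object `M_j F`. -/
noncomputable abbrev matchingObj (F : J ⥤ C) (j : J) : C := limit (matchingDiagram F j)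

/-- The cone on `matchingDiagram F j` with point `F j`. -/
def matchingCone (F : J ⥤ C) (j : J) : Cone (matchingDiagram F j) where
  pt := F.obj j
  π :=
    { app := fun g => F.map g.obj.hom
      naturality := fun g h f => by simp [← Functor.map_comp] }

/-- The matching map `F j ⟶ M_j F`. -/
noncomputable def toMatching (F : J ⥤ C) (j : J) : F.obj j ⟶ matchingObj F j :=
  limit.lift (matchingDiagram F j) (matchingCone F j)

lemma toMatching_π (F : J ⥤ C) (j : J) (g : MatchingCategory j) :
    toMatching F j ≫ limit.π (matchingDiagram F j) g = F.map g.obj.hom :=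
  limit.lift_π (matchingCone F j) g

/-- The functoriality of matching objects. -/
noncomputable def matchingMap {F G : J ⥤ C} (f : F ⟶ G) (j : J) :
    matchingObj F j ⟶ matchingObj G j :=
  limMap (F := matchingDiagram F j) (G := matchingDiagram G j)
    { app := fun g => f.app g.obj.right
      naturality := fun _ _ _ => f.naturality _ }

lemma matchingMap_π {F G : J ⥤ C} (f : F ⟶ G) (j : J) (g : MatchingCategory j) :
    matchingMap f j ≫ limit.π (matchingDiagram G j) g =
      limit.π (matchingDiagram F j) g ≫ f.app g.obj.right :=
  limMap_π _ _

lemma toMatching_naturality {F G : J ⥤ C} (f : F ⟶ G) (j : J) :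
    f.app j ≫ toMatching G j = toMatching F j ≫ matchingMap f j :=
  limit.hom_ext (fun g => by
    have h : F.map g.obj.hom ≫ f.app g.obj.right = f.app j ≫ G.map g.obj.hom := f.naturality _
    refine (Category.assoc _ _ _).trans ?_
    refine (congrArg (f.app j ≫ ·) (toMatching_π G j g)).trans ?_
    refine h.symm.trans ?_
    refine (congrArg (· ≫ f.app g.obj.right) (toMatching_π F j g)).symm.trans ?_
    refine (Category.assoc _ _ _).trans ?_
    refine (congrArg (toMatching F j ≫ ·) (matchingMap_π f j g)).symm.trans ?_
    exact (Category.assoc _ _ _).symm)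

/-- The relative matching map `F j ⟶ G j ×_{M_j G} M_j F` of `f : F ⟶ G`. -/
noncomputable def relMatching {F G : J ⥤ C} (f : F ⟶ G) (j : J) :
    F.obj j ⟶ pullback (toMatching G j) (matchingMap f j) :=
  pullback.lift (f.app j) (toMatching F j) (toMatching_naturality f j)

/-- The Reedy fibrations relative to a class `P` of fibrations in `C`: all the relative matching
maps are in `P`. -/
def reedyFibrations (J : Type) [SmallCategory J] {C : Type u} [Category.{v} C]
    [HasLimitsOfSize.{0, 0} C] (P : MorphismProperty C) : MorphismProperty (J ⥤ C) :=
  fun _ _ f => ∀ j, P (relMatching f j)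

/-- A diagram is Reedy fibrant (relative to a class `P` of fibrations in `C`) if all its matching
maps `F j ⟶ M_j F` are in `P`. -/
def IsReedyFibrant (P : MorphismProperty C) (F : J ⥤ C) : Prop :=
  ∀ j, P (toMatching F j)

end Reedy

section Totalization

variable {D : Type u} [Category.{v} D] [HasLimits D] [ModelCategory D]

/-- `κ : Y ⟶ Yhat` exhibits the simplicial object `Yhat` in `D^Δ` as a simplicial frame on `Y`, for
the Reedy model structure on `D^Δ`: it is a weak equivalence from the constant simplicial object
to `Yhat`, an isomorphism in simplicial degree `0`, and `Yhat` is Reedy fibrant if `Y` is. -/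
structure IsSimplicialFrame (Y : SimplexCategory ⥤ D)
    (Yhat : SimplexCategoryᵒᵖ ⥤ SimplexCategory ⥤ D)
    (κ : (Functor.const SimplexCategoryᵒᵖ).obj Y ⟶ Yhat) : Prop where
  weakEquivalence (m : SimplexCategoryᵒᵖ) (n : SimplexCategory) :
    WeakEquivalence ((κ.app m).app n)
  isIso_zero : IsIso (κ.app (op (SimplexCategory.mk 0)))
  isReedyFibrant : IsReedyFibrant (fibrations D) Y →
    IsReedyFibrant (reedyFibrations SimplexCategory (fibrations D)) Yhat

/-- The totalization `∫_n (Yhat_n)^n` of a cosimplicial object `Y` with simplicial frame `Yhat`. -/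
noncomputable def totalization (Yhat : SimplexCategoryᵒᵖ ⥤ SimplexCategory ⥤ D) : D := end_ Yhat

/-- The data needed to compute the homotopy limit of a cosimplicial object `X`: a Reedy fibrant
replacement `X ⟶ Y` and a simplicial frame on `Y`. -/
structure HolimModel (X : SimplexCategory ⥤ D) where
  /-- The Reedy fibrant replacement. -/
  Y : SimplexCategory ⥤ D
  i : X ⟶ Y
  weakEquivalence (n : SimplexCategory) : WeakEquivalence (i.app n)
  isReedyFibrant : IsReedyFibrant (fibrations D) Y
  /-- The simplicial frame on the Reedy fibrant replacement. -/
  frame : SimplexCategoryᵒᵖ ⥤ SimplexCategory ⥤ D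
  κ : (Functor.const SimplexCategoryᵒᵖ).obj Y ⟶ frame
  isSimplicialFrame : IsSimplicialFrame Y frame κ

/-- The homotopy limit computed by a Reedy fibrant replacement with a simplicial frame. -/
noncomputable def HolimModel.holim {X : SimplexCategory ⥤ D} (M : HolimModel X) : D :=
  totalization M.frame

/-- Two objects of a model category are weakly equivalent if they are related by a zigzag of weak
equivalences. -/
def WeaklyEquivalent (A B : D) : Prop :=
  Relation.EqvGen (fun A' B' : D => ∃ f : A' ⟶ B', WeakEquivalence f) A B

/-- `H` is a homotopy limit of `X`: it is weakly equivalent to the totalization of a Reedy fibrant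
replacement of `X`. -/
def IsHolim (X : SimplexCategory ⥤ D) (H : D) : Prop :=
  ∃ M : HolimModel X, WeaklyEquivalent H M.holim

/-- A homotopy limit functor on cosimplicial objects, given by a functorial Reedy fibrant
replacement and a functorial simplicial framing. -/
structure HolimFunctor (D : Type u) [Category.{v} D] [HasLimits D] [ModelCategory D] where
  /-- The functorial Reedy fibrant replacement. -/
  fibRep : (SimplexCategory ⥤ D) ⥤ SimplexCategory ⥤ D
  i : 𝟭 (SimplexCategory ⥤ D) ⟶ fibRep
  weakEquivalence (X : SimplexCategory ⥤ D) (n : SimplexCategory) :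
    WeakEquivalence ((i.app X).app n)
  isReedyFibrant (X : SimplexCategory ⥤ D) : IsReedyFibrant (fibrations D) (fibRep.obj X)
  /-- The functorial simplicial frame. -/
  frame : (SimplexCategory ⥤ D) ⥤ SimplexCategoryᵒᵖ ⥤ SimplexCategory ⥤ D
  κ : Functor.const SimplexCategoryᵒᵖ ⟶ frame
  isSimplicialFrame (Y : SimplexCategory ⥤ D) :
    IsSimplicialFrame Y (frame.obj Y) (κ.app Y)

/-- The value of a homotopy limit functor. -/
noncomputable def HolimFunctor.holim (R : HolimFunctor D) (X : SimplexCategory ⥤ D) : D :=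
  totalization (R.frame.obj (R.fibRep.obj X))

/-- `H` is the coHochschild homology of the counital coalgebra `A`, i.e. a homotopy limit of the
cosimplicial object `coTHH^•(A)`. -/
def IsCoTHH [MonoidalCategory D] [SymmetricCategory D] (A : Comon D) (H : D) : Prop :=
  IsHolim (coTHHObj A) H

/-- The coHochschild homology of the counital coalgebra `A`, computed by a homotopy limit
functor. -/
noncomputable def HolimFunctor.coTHH [MonoidalCategory D] [SymmetricCategory D]
    (R : HolimFunctor D) (A : Comon D) : D :=
  R.holim (coTHHObj A)

end Totalization

end HomotopyLimits

/-! The theorem holds because `S^c` is a strong symmetric monoidal functor from `(D, ×, *)` to `(D,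
⊗, 1)`. Such a functor sends coalgebras to coalgebras and commutes with the formation of `coTHH^•`
(`coTHHObjCompIso`). It sends `X` with its diagonal to `S^c(X)` with the prescribed comultiplication
and counit (`symComon_comul`, `symComon_counit`). So the coalgebra axioms come for free, and the two
cosimplicial objects are isomorphic. Of the model structure, only the facts that isomorphisms are
weak equivalences and that weak equivalences compose are then needed.

The heart is the isomorphism `S^c(X × Y) ≅ S^c(X) ⊗ S^c(Y)` (`isIso_symDelta`). Finite products are
finite sums and `⊗` preserves colimits, so `(X × Y)^{⊗ n}` is a biproduct of words in `X` and `Y`,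
which `Σ_n` permutes. The orbits of words are indexed by the pairs with `a + b = n`, with
stabilizers `Σ_a × Σ_b`. Hence a `Σ_n`-invariant element amounts to a family of `Σ_a ×
Σ_b`-invariant elements of `X^{⊗ a} ⊗ Y^{⊗ b}`. Words are never written out: uniqueness
(`IsPermInvariant.ext_of_tpowSplit`) and existence (`exists_isPermInvariant`) are proved by
induction on `n`, splitting off the first factor. Permutation-friendliness, extended from one object
to two by a retract argument (`exists_symInv_lift`), then turns these invariants into `(X^{⊗
a})^{Σ_a} ⊗ (Y^{⊗ b})^{Σ_b}`.

One difficulty is that `S^c(X)` is an infinite sum, so a morphism into a tensor product of such sums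
need not be determined by its components. Each summand of the source, however, lands in a finite
truncation, which is a finite biproduct. This is recorded by `Grading` and `Grading.IsFiltered`, and
`symCofree_hom_ext_of_isFiltered` reduces the coherence identities to identities between components.
-/

section OplaxTensorPowers

/-! ### Monoidal functors and the cosimplicial object `coTHH^•`. -/

open Functor.OplaxMonoidal

variable {C D : Type*} [Category* C] [MonoidalCategory C] [Category* D] [MonoidalCategory D]
  (F : C ⥤ D) [F.OplaxMonoidal]

/-- The comparison `F (X^{⊗ n}) ⟶ (F X)^{⊗ n}` of an oplax monoidal functor. -/
def tpowComparison (X : C) : ∀ n : ℕ, F.obj (tpow X n) ⟶ tpow (F.obj X) n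
  | 0 => η F
  | n + 1 => δ F X (tpow X n) ≫ F.obj X ◁ tpowComparison X n

instance isIso_tpowComparison [IsIso (η F)] [∀ X Y, IsIso (δ F X Y)] (X : C) :
    ∀ n, IsIso (tpowComparison F X n)
  | 0 => inferInstanceAs (IsIso (η F))
  | n + 1 => by
    have := isIso_tpowComparison X n
    exact inferInstanceAs (IsIso (δ F X (tpow X n) ≫ F.obj X ◁ tpowComparison F X n))

/-- The inductive step for cofaces and codegeneracies that do not touch the first factor; it is
naturality of `δ F` in the second variable. -/
lemma map_whiskerLeft_comparison {X P Q : C} {P' Q' : D} {f : P ⟶ Q} {f' : P' ⟶ Q'}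
    {s : F.obj P ⟶ P'} {t : F.obj Q ⟶ Q'} (h : F.map f ≫ t = s ≫ f') :
    F.map (X ◁ f) ≫ δ F X Q ≫ F.obj X ◁ t = (δ F X P ≫ F.obj X ◁ s) ≫ F.obj X ◁ f' := by
  rw [← δ_natural_right_assoc, Category.assoc, ← MonoidalCategory.whiskerLeft_comp,
    ← MonoidalCategory.whiskerLeft_comp, h]

/-- Induction on `n` with the unitality and associativity of `F`. No symmetry is involved yet; this
prepares the rotation. -/
lemma map_tpowSnoc_comparison (X : C) : ∀ n : ℕ,
    F.map (tpowSnoc X n).hom ≫ tpowComparison F X (n + 1) =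
      δ F (tpow X n) X ≫ tpowComparison F X n ▷ F.obj X ≫ (tpowSnoc (F.obj X) n).hom
  | 0 => by
    change F.map ((λ_ X).hom ≫ (ρ_ X).inv) ≫ δ F X (𝟙_ C) ≫ F.obj X ◁ η F =
      δ F (𝟙_ C) X ≫ η F ▷ F.obj X ≫ (λ_ (F.obj X)).hom ≫ (ρ_ (F.obj X)).inv
    rw [left_unitality_hom_assoc, F.map_comp, Category.assoc, ← right_unitality]
  | n + 1 => by
    -- A recurring device: tensor powers are replaced by arbitrary objects, so that rewriting does
    -- not meet `tpow X (n + 1)` in place of `X ⊗ tpow X n`; the two forms are matched by unfolding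
    -- when `key` is applied.
    have key : ∀ {P Q : C} {P' Q' : D} (u : P ⊗ X ≅ Q) (u' : P' ⊗ F.obj X ≅ Q')
        (s : F.obj P ⟶ P') (t : F.obj Q ⟶ Q'),
        F.map u.hom ≫ t = δ F P X ≫ s ▷ F.obj X ≫ u'.hom →
        F.map ((α_ X P X).hom ≫ X ◁ u.hom) ≫ δ F X Q ≫ F.obj X ◁ t =
          δ F (X ⊗ P) X ≫ (δ F X P ≫ F.obj X ◁ s) ▷ F.obj X ≫
            ((α_ (F.obj X) P' (F.obj X)).hom ≫ F.obj X ◁ u'.hom) := by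
      intro P Q P' Q' u u' s t h
      rw [F.map_comp, Category.assoc, ← δ_natural_right_assoc,
        ← MonoidalCategory.whiskerLeft_comp, h]
      simp only [MonoidalCategory.whiskerLeft_comp, comp_whiskerRight, Category.assoc]
      rw [associator_naturality_middle_assoc, ← associativity_assoc]
    exact key _ _ _ _ (map_tpowSnoc_comparison X n)

section

attribute [local instance] Functor.obj.instComonObj

variable (X : C) [ComonObj X]

/-- Only the first factor needs an argument: the comultiplication of `F.obj X` is the image of that
of `X` followed by `δ F`, and oplax associativity rebrackets. -/
lemma map_comulAt_comparison {n : ℕ} : ∀ i : Fin n,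
    F.map (comulAt X i) ≫ tpowComparison F X (n + 1) =
      tpowComparison F X n ≫ comulAt (F.obj X) i := by
  induction n with
  | zero => intro i; exact i.elim0
  | succ n ih =>
    intro i
    induction i using Fin.cases with
    | zero =>
      have key : ∀ {P : C} {P' : D} (s : F.obj P ⟶ P'),
          F.map (ComonObj.comul (X := X) ▷ P ≫ (α_ X X P).hom) ≫ δ F X (X ⊗ P) ≫
            F.obj X ◁ (δ F X P ≫ F.obj X ◁ s) =
          (δ F X P ≫ F.obj X ◁ s) ≫ (ComonObj.comul (X := F.obj X) ▷ P' ≫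
            (α_ (F.obj X) (F.obj X) P').hom) := by
        intro P P' s
        rw [Functor.obj.Δ_def]
        simp only [Functor.map_comp, MonoidalCategory.whiskerLeft_comp, Category.assoc]
        rw [← associativity_assoc, whisker_exchange_assoc]
        simp
      exact key _
    | succ i => exact map_whiskerLeft_comparison F (ih i)

lemma map_counitAt_comparison {n : ℕ} : ∀ i : Fin (n + 1),
    F.map (counitAt X i) ≫ tpowComparison F X n =
      tpowComparison F X (n + 1) ≫ counitAt (F.obj X) i := by
  have key : ∀ {P : C} {P' : D} (s : F.obj P ⟶ P'),
      F.map (ComonObj.counit (X := X) ▷ P ≫ (λ_ P).hom) ≫ s =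
      (δ F X P ≫ F.obj X ◁ s) ≫ (ComonObj.counit (X := F.obj X) ▷ P' ≫ (λ_ P').hom) := by
    intro P P' s
    rw [Functor.obj.ε_def, Category.assoc, whisker_exchange_assoc]
    simp
  induction n with
  | zero =>
    intro i
    obtain rfl : i = 0 := Fin.ext (by omega)
    exact key _
  | succ n ih =>
    intro i
    induction i using Fin.cases with
    | zero => exact key _
    | succ i => exact map_whiskerLeft_comparison F (ih i)

end

section

variable [SymmetricCategory C] [SymmetricCategory D]
  (hF : ∀ X Y : C, F.map (β_ X Y).hom ≫ δ F Y X = δ F X Y ≫ (β_ (F.obj X) (F.obj Y)).hom)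

include hF

/-- This is where compatibility with the symmetries is used; the rotation occurs in the last coface.
-/
lemma map_tpowRot_comparison (X : C) (n : ℕ) :
    F.map (tpowRot X n) ≫ tpowComparison F X (n + 1) =
      tpowComparison F X (n + 1) ≫ tpowRot (F.obj X) n := by
  have key : ∀ {P Q : C} {P' Q' : D} (u : P ⊗ X ≅ Q) (u' : P' ⊗ F.obj X ≅ Q')
      (s : F.obj P ⟶ P') (t : F.obj Q ⟶ Q'),
      F.map u.hom ≫ t = δ F P X ≫ s ▷ F.obj X ≫ u'.hom →
      F.map ((β_ X P).hom ≫ u.hom) ≫ t =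
        (δ F X P ≫ F.obj X ◁ s) ≫ (β_ (F.obj X) P').hom ≫ u'.hom := by
    intro P Q P' Q' u u' s t h
    rw [F.map_comp, Category.assoc, h, reassoc_of% hF, Category.assoc,
      BraidedCategory.braiding_naturality_right_assoc]
  exact key _ _ _ _ (map_tpowSnoc_comparison F X n)

variable [IsIso (η F)] [∀ X Y, IsIso (δ F X Y)]

/-- Strong symmetric monoidal functors commute with the formation of `coTHH^•`. -/
noncomputable def coTHHObjCompIso (A : Comon C) :
    coTHHObj A ⋙ F ≅ coTHHObj (F.mapComon.obj A) :=
  letI := Functor.obj.instComonObj A.X F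
  NatIso.ofComponents
    (fun n => @asIso _ _ _ _ (tpowComparison F A.X (n.len + 1)) (isIso_tpowComparison F A.X _)) (by
    -- Naturality is a multiplicative condition on morphisms of `Δ`, so it suffices to check it on
    -- cofaces and codegeneracies.
    let W : MorphismProperty SimplexCategory := fun a b f =>
      F.map ((coTHHObj A).map f) ≫ tpowComparison F A.X (b.len + 1) =
        tpowComparison F A.X (a.len + 1) ≫ (coTHHObj (F.mapComon.obj A)).map f
    have : W.IsMultiplicative :=
      { id_mem := fun a => by
          simp only [W, CategoryTheory.Functor.map_id]
          exact (Category.id_comp _).trans (Category.comp_id _).symm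
        comp_mem := by
          intro a b c f g hf hg
          have key : ∀ {P Q R : C} {P' Q' R' : D} {f : P ⟶ Q} {g : Q ⟶ R} {f' : P' ⟶ Q'}
              {g' : Q' ⟶ R'} {r : F.obj P ⟶ P'} {s : F.obj Q ⟶ Q'} {t : F.obj R ⟶ R'},
              F.map f ≫ s = r ≫ f' → F.map g ≫ t = s ≫ g' →
              F.map (f ≫ g) ≫ t = r ≫ f' ≫ g' := by
            intro P Q R P' Q' R' f g f' g' r s t h h'
            rw [F.map_comp, Category.assoc, h', reassoc_of% h]
          simp only [W, Functor.map_comp]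
          exact (congrArg (· ≫ _) (F.map_comp _ _).symm).trans (key hf hg) }
    have hW : W = ⊤ := SimplexCategory.morphismProperty_eq_top W
      (fun {n} i => by
        change F.map ((coTHHData A).toFunctor.map _) ≫ tpowComparison F A.X (n + 2) =
          tpowComparison F A.X (n + 1) ≫ (coTHHData (F.mapComon.obj A)).toFunctor.map _
        rw [CosimplicialData.toFunctor_map_δ, CosimplicialData.toFunctor_map_δ]
        change F.map (coTHHδ A.X i) ≫ _ = _ ≫ coTHHδ (F.obj A.X) i
        induction i using Fin.lastCases with
        | last =>
          rw [coTHHδ_last, coTHHδ_last, F.map_comp, Category.assoc, map_tpowRot_comparison F hF,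
            reassoc_of% map_comulAt_comparison F A.X]
        | cast i =>
          rw [coTHHδ_castSucc, coTHHδ_castSucc, map_comulAt_comparison])
      (fun {n} i => by
        change F.map ((coTHHData A).toFunctor.map _) ≫ tpowComparison F A.X (n + 1) =
          tpowComparison F A.X (n + 2) ≫ (coTHHData (F.mapComon.obj A)).toFunctor.map _
        rw [CosimplicialData.toFunctor_map_σ, CosimplicialData.toFunctor_map_σ]
        exact map_counitAt_comparison F A.X i.succ)
    intro a b f
    have hf : W f := by rw [hW]; trivial
    exact hf)

end

end OplaxTensorPowers

/-! ### Invariance of homotopy limits under isomorphism. -/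

section HomotopyLimitIso

variable {D : Type u} [Category.{v} D] [HasLimits D] [ModelCategory D]

/-- The replacement and its frame are kept; only the map into the replacement is precomposed with
`e.inv`, which leaves it a degreewise weak equivalence. -/
lemma IsHolim.of_iso {X X' : SimplexCategory ⥤ D} (e : X ≅ X') {H : D} (h : IsHolim X H) :
    IsHolim X' H := by
  obtain ⟨M, hM⟩ := h
  refine ⟨{ M with
    i := e.inv ≫ M.i
    weakEquivalence := fun n => ?_ }, hM⟩
  have := M.weakEquivalence n
  rw [NatTrans.comp_app]
  infer_instance

omit [HasLimits D] in
lemma WeaklyEquivalent.of_iso {A B : D} (e : A ≅ B) : WeaklyEquivalent A B :=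
  Relation.EqvGen.rel _ _ ⟨e.hom, inferInstance⟩

omit [ModelCategory D] in
/-- Isomorphic bifunctors have isomorphic ends. -/
noncomputable def endIsoOfIso {F G : SimplexCategoryᵒᵖ ⥤ SimplexCategory ⥤ D} (t : F ≅ G) :
    end_ F ≅ end_ G where
  hom := end_.map t.hom
  inv := end_.map t.inv
  hom_inv_id := by rw [end_.map_comp, t.hom_inv_id, end_.map_id]
  inv_hom_id := by rw [end_.map_comp, t.inv_hom_id, end_.map_id]

/-- A homotopy limit functor sends isomorphic cosimplicial objects to isomorphic objects. -/
noncomputable def HolimFunctor.mapIso (R : HolimFunctor D) {X X' : SimplexCategory ⥤ D}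
    (e : X ≅ X') : R.holim X ≅ R.holim X' :=
  endIsoOfIso (R.frame.mapIso (R.fibRep.mapIso e))

end HomotopyLimitIso

/-! ### Biproducts in a cofree-friendly category. -/

section Biproducts

variable {D : Type u} [Category.{v} D] [MonoidalCategory D] [SymmetricCategory D]
  [HasZeroObject D] [HasZeroMorphisms D] [HasLimits D] [HasColimits D] [CofreeFriendly D]

instance preservesColimits_tensorLeft (X : D) : PreservesColimits (tensorLeft X) :=
  CofreeFriendly.preservesColimits X

instance preservesColimits_tensorRight (X : D) : PreservesColimits (tensorRight X) :=
  preservesColimits_of_natIso (BraidedCategory.tensorLeftIsoTensorRight X)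

section Zero

open scoped ZeroObject in
omit [SymmetricCategory D] [MonoidalCategory D] [HasLimits D] [HasColimits D] [CofreeFriendly D] in
-- A zero morphism factors through the zero object, which `F` sends to an initial object. No
-- additivity of `F` is required.
lemma map_zero_of_preservesInitial {D' : Type u} [Category.{v} D'] [HasZeroMorphisms D']
    (F : D ⥤ D') [PreservesColimit (Functor.empty.{0} D) F] (A B : D) :
    F.map (0 : A ⟶ B) = 0 := by
  let h : IsInitial (F.obj (0 : D)) := IsInitial.isInitialObj F _ HasZeroObject.zeroIsInitial
  have h1 : (0 : A ⟶ B) = (0 : A ⟶ 0) ≫ (0 : (0 : D) ⟶ B) := by simp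
  rw [h1, F.map_comp, h.hom_ext (F.map (0 : (0 : D) ⟶ B)) 0, comp_zero]

@[simp]
lemma tensor_whiskerLeft_zero (X A B : D) : X ◁ (0 : A ⟶ B) = 0 :=
  map_zero_of_preservesInitial (tensorLeft X) A B

@[simp]
lemma tensor_zero_whiskerRight (X A B : D) : (0 : A ⟶ B) ▷ X = 0 :=
  map_zero_of_preservesInitial (tensorRight X) A B

@[simp]
lemma tensor_zero_tensorHom {A B X Y : D} (f : X ⟶ Y) : (0 : A ⟶ B) ⊗ₘ f = 0 := by
  simp [MonoidalCategory.tensorHom_def]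

@[simp]
lemma tensor_tensorHom_zero {A B X Y : D} (f : X ⟶ Y) : f ⊗ₘ (0 : A ⟶ B) = 0 := by
  simp [MonoidalCategory.tensorHom_def]

end Zero

/-- `Q` is the sum of the `A j`, and the `p j` are the projections. -/
structure IsBiprod {J : Type} {A : J → D} {Q : D} (i : ∀ j, A j ⟶ Q) (p : ∀ j, Q ⟶ A j) :
    Prop where
  ι_π_self (j : J) : i j ≫ p j = 𝟙 (A j)
  ι_π_ne {j k : J} (h : j ≠ k) : i j ≫ p k = 0
  isColimit : Nonempty (IsColimit (Cofan.mk Q i))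

namespace IsBiprod

variable {J : Type} {A : J → D} {Q : D} {i : ∀ j, A j ⟶ Q} {p : ∀ j, Q ⟶ A j}

omit [MonoidalCategory D] [SymmetricCategory D] [HasLimits D] [HasColimits D]
  [CofreeFriendly D] in
-- The definition mentions only a colimit and equations with zero morphisms, so it survives
-- colimit-preserving functors such as tensoring; the product property for finite `J` is recovered
-- afterwards from `isIso_lift`.
lemma map (h : IsBiprod i p) (F : D ⥤ D) [PreservesColimits F] :
    IsBiprod (fun j => F.map (i j)) (fun j => F.map (p j)) where
  ι_π_self j := by rw [← F.map_comp, h.ι_π_self, F.map_id]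
  ι_π_ne hjk := by
    rw [← F.map_comp, h.ι_π_ne hjk]
    exact map_zero_of_preservesInitial F _ _
  isColimit := by
    have := preservesSmallestColimits_of_preservesColimits F
    exact ⟨isColimitCofanMkObjOfIsColimit F _ _ h.isColimit.some⟩

lemma whiskerLeft (h : IsBiprod i p) (X : D) :
    IsBiprod (fun j => X ◁ i j) (fun j => X ◁ p j) :=
  h.map (tensorLeft X)

lemma whiskerRight (h : IsBiprod i p) (X : D) :
    IsBiprod (fun j => i j ▷ X) (fun j => p j ▷ X) :=
  h.map (tensorRight X)

omit [MonoidalCategory D] [SymmetricCategory D] [HasZeroObject D] [HasLimits D] [HasColimits D]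
  [CofreeFriendly D] in
lemma hom_ext' (h : IsBiprod i p) {W : D} {f g : Q ⟶ W} (hfg : ∀ j, i j ≫ f = i j ≫ g) : f = g :=
  Cofan.IsColimit.hom_ext h.isColimit.some _ _ hfg

/-- Identifying `Q` with the coproduct turns this morphism into `sumToProd A`, which is invertible
by cofree-friendliness. -/
lemma isIso_lift [Finite J] (h : IsBiprod i p) : IsIso (Pi.lift p) := by
  let e : ∐ A ≅ Q := (coproductIsCoproduct A).coconePointUniqueUpToIso h.isColimit.some
  have he : ∀ j, Sigma.ι A j ≫ e.hom = i j := fun j =>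
    (coproductIsCoproduct A).comp_coconePointUniqueUpToIso_hom h.isColimit.some ⟨j⟩
  have h1 : e.hom ≫ Pi.lift p = sumToProd A := by
    refine Sigma.hom_ext _ _ fun j => Pi.hom_ext _ _ fun k => ?_
    rw [reassoc_of% he, sumToProd, Sigma.ι_desc]
    simp only [Category.assoc, Pi.lift_π]
    split_ifs with hjk
    · subst hjk; simpa using h.ι_π_self j
    · exact h.ι_π_ne hjk
  rw [← Iso.eq_inv_comp] at h1
  rw [h1]
  infer_instance

lemma hom_ext [Finite J] (h : IsBiprod i p) {W : D} {f g : W ⟶ Q}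
    (hfg : ∀ j, f ≫ p j = g ≫ p j) : f = g := by
  have := h.isIso_lift
  rw [← cancel_mono (Pi.lift p)]
  exact Pi.hom_ext _ _ fun j => by simpa using hfg j

lemma exists_lift [Finite J] (h : IsBiprod i p) {W : D} (f : ∀ j, W ⟶ A j) :
    ∃ g : W ⟶ Q, ∀ j, g ≫ p j = f j := by
  have := h.isIso_lift
  refine ⟨Pi.lift f ≫ inv (Pi.lift p), fun j => ?_⟩
  have h1 : inv (Pi.lift p) ≫ p j = Pi.π A j := by
    rw [IsIso.inv_comp_eq, Pi.lift_π]
  rw [Category.assoc, h1, Pi.lift_π]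

/-- Conversely, the projections of a finite product, together with the coordinate inclusions, form
a biproduct. -/
lemma of_isIso_lift [Finite J] (h1 : ∀ j, i j ≫ p j = 𝟙 (A j))
    (h2 : ∀ {j k}, j ≠ k → i j ≫ p k = 0) (h3 : IsIso (Pi.lift p)) : IsBiprod i p where
  ι_π_self := h1
  ι_π_ne := h2
  isColimit := by
    have h4 : Sigma.desc i ≫ Pi.lift p = sumToProd A := by
      refine Sigma.hom_ext _ _ fun j => Pi.hom_ext _ _ fun k => ?_
      rw [sumToProd, Sigma.ι_desc_assoc, Sigma.ι_desc]
      simp only [Category.assoc, Pi.lift_π]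
      split_ifs with hjk
      · subst hjk; simpa using h1 j
      · exact h2 hjk
    have h5 : IsIso (Sigma.desc i) := by
      rw [← IsIso.eq_comp_inv] at h4
      rw [h4]
      infer_instance
    exact ⟨IsColimit.ofIsoColimit (coproductIsCoproduct A)
      (Cocone.ext (@asIso _ _ _ _ (Sigma.desc i) h5) fun j => Sigma.ι_desc i j.as)⟩

end IsBiprod

/-- A product diagram `X ⟵ Z ⟶ Y`. -/
structure IsBinProd {X Y Z : D} (p : Z ⟶ X) (q : Z ⟶ Y) : Prop where
  hom_ext {W : D} {f g : W ⟶ Z} : f ≫ p = g ≫ p → f ≫ q = g ≫ q → f = g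
  exists_lift {W : D} (f : W ⟶ X) (g : W ⟶ Y) : ∃ h : W ⟶ Z, h ≫ p = f ∧ h ≫ q = g

namespace IsBinProd

variable {X Y Z : D} {p : Z ⟶ X} {q : Z ⟶ Y}

/-- The inclusions are `(𝟙, 0)` and `(0, 𝟙)`. -/
lemma exists_isBiprod (h : IsBinProd p q) :
    ∃ i : ∀ b : Bool, (bif b then X else Y) ⟶ Z,
      IsBiprod i (fun b => match b with | true => p | false => q) := by
  obtain ⟨i, hi, hi'⟩ := h.exists_lift (𝟙 X) 0
  obtain ⟨j, hj, hj'⟩ := h.exists_lift 0 (𝟙 Y)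
  refine ⟨fun b => match b with | true => i | false => j, IsBiprod.of_isIso_lift ?_ ?_ ?_⟩
  · rintro (_ | _)
    · exact hj'
    · exact hi
  · rintro (_ | _) (_ | _) hab
    · exact absurd rfl hab
    · exact hj
    · exact hi'
    · exact absurd rfl hab
  · let A : Bool → D := fun b => bif b then X else Y
    obtain ⟨u, hu, hu'⟩ := h.exists_lift (Pi.π A true) (Pi.π A false)
    refine ⟨u, h.hom_ext ?_ ?_, Pi.hom_ext _ _ ?_⟩
    · rw [Category.assoc, hu, Category.id_comp]; exact Pi.lift_π _ true
    · rw [Category.assoc, hu', Category.id_comp]; exact Pi.lift_π _ false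
    · rintro (_ | _)
      · rw [Category.assoc, Pi.lift_π]; exact hu'.trans (Category.id_comp _).symm
      · rw [Category.assoc, Pi.lift_π]; exact hu.trans (Category.id_comp _).symm

lemma of_isBiprod {A : Bool → D} {i : ∀ b : Bool, A b ⟶ Z} {p : ∀ b : Bool, Z ⟶ A b}
    (h : IsBiprod i p) : IsBinProd (p true) (p false) where
  hom_ext h1 h2 := h.hom_ext (by rintro (_ | _); exacts [h2, h1])
  exists_lift {W} f g := by
    obtain ⟨k, hk⟩ := h.exists_lift (W := W) (fun b => match b with | true => f | false => g)
    exact ⟨k, hk true, hk false⟩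

/-- Tensoring is only assumed to preserve colimits; reading a binary product as a biproduct makes
tensoring preserve it too. -/
lemma whiskerLeft (h : IsBinProd p q) (U : D) : IsBinProd (U ◁ p) (U ◁ q) := by
  obtain ⟨i, hi⟩ := h.exists_isBiprod
  exact of_isBiprod (hi.whiskerLeft U)

lemma whiskerRight (h : IsBinProd p q) (U : D) : IsBinProd (p ▷ U) (q ▷ U) := by
  obtain ⟨i, hi⟩ := h.exists_isBiprod
  exact of_isBiprod (hi.whiskerRight U)

end IsBinProd

end Biproducts

/-! ### Exchanging factors, and splitting tensor powers into two blocks. -/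

section Shuffles

variable {C : Type u} [Category.{v} C] [MonoidalCategory C] [SymmetricCategory C]

/-- The symmetry exchanging the first two factors of `A ⊗ (B ⊗ P)`. -/
def exchange (A B P : C) : A ⊗ (B ⊗ P) ⟶ B ⊗ (A ⊗ P) :=
  (α_ A B P).inv ≫ (β_ A B).hom ▷ P ≫ (α_ B A P).hom

lemma exchange_exchange (A B P : C) : exchange A B P ≫ exchange B A P = 𝟙 _ := by
  simp [exchange, ← comp_whiskerRight_assoc]

lemma exchange_naturality {A B P A' B' P' : C} (f : A ⟶ A') (g : B ⟶ B') (h : P ⟶ P') :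
    (f ⊗ₘ (g ⊗ₘ h)) ≫ exchange A' B' P' = exchange A B P ≫ (g ⊗ₘ (f ⊗ₘ h)) := by
  have h2 : ((f ⊗ₘ g) ⊗ₘ h) ≫ (β_ A' B').hom ▷ P' = (β_ A B).hom ▷ P ≫ ((g ⊗ₘ f) ⊗ₘ h) := by
    rw [← tensorHom_id, ← tensorHom_id, tensorHom_comp_tensorHom, tensorHom_comp_tensorHom,
      BraidedCategory.braiding_naturality]
    simp
  simp only [exchange, Category.assoc]
  rw [← associator_naturality, ← reassoc_of% h2, associator_inv_naturality_assoc]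

lemma exchange_unit (Y Q : C) : exchange Y (𝟙_ C) Q = Y ◁ (λ_ Q).hom ≫ (λ_ (Y ⊗ Q)).inv := by
  simp [exchange]

lemma exchange_tensor_right (Y X A Q : C) :
    exchange Y (X ⊗ A) Q =
      Y ◁ (α_ X A Q).hom ≫ exchange Y X (A ⊗ Q) ≫ X ◁ exchange Y A Q ≫ (α_ X A (Y ⊗ Q)).inv := by
  simp only [exchange, BraidedCategory.braiding_tensor_right_hom]
  monoidal

lemma exchange_tensor_left (Y X A Q : C) :
    exchange (X ⊗ A) Y Q =
      (α_ X A (Y ⊗ Q)).hom ≫ X ◁ exchange A Y Q ≫ exchange X Y (A ⊗ Q) ≫ Y ◁ (α_ X A Q).inv := by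
  simp only [exchange, BraidedCategory.braiding_tensor_left_hom]
  monoidal

/-- The Yang–Baxter relation. -/
lemma exchange_yangBaxter (A Y Q : C) :
    exchange A Y (Y ⊗ Q) ≫ Y ◁ exchange A Y Q ≫ exchange Y Y (A ⊗ Q) =
      A ◁ exchange Y Y Q ≫ exchange A Y (Y ⊗ Q) ≫ Y ◁ exchange A Y Q := by
  have h := BraidedCategory.yang_baxter A Y Y
  -- The braid relation for `A`, `Y`, `Y`, tensored with the spectator `Q` and rebracketed.
  have h' := congrArg (fun f => A ◁ (α_ Y Y Q).inv ≫ (α_ A (Y ⊗ Y) Q).inv ≫ f ▷ Q ≫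
    (α_ Y (Y ⊗ A) Q).hom ≫ Y ◁ (α_ Y A Q).hom) h
  simp only [comp_whiskerRight] at h'
  simp only [exchange]
  refine Eq.trans ?_ (h'.trans ?_)
  · simp only [MonoidalCategory.whiskerLeft_comp]
    monoidal
  · simp only [MonoidalCategory.whiskerLeft_comp]
    monoidal

lemma insertAt_succ' (X : C) (n : ℕ) (q : Fin (n + 1)) : insertAt X (n + 1) q.succ =
    exchange X X (tpow X n) ≫ X ◁ insertAt X n q := by
  rw [insertAt_succ, exchange]
  exact (by simp : ∀ {P Q R S T : C} (f : P ⟶ Q) (g : Q ⟶ R) (h : R ⟶ S) (k : S ⟶ T),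
    f ≫ g ≫ h ≫ k = (f ≫ g ≫ h) ≫ k) _ _ _ _

/-- The permutation extends `ρ` by fixing the first position. The next two lemmas similarly use the
cycle moving `0` to `q` and the transposition of the first two positions. That `permMap` respects
composition is not needed: it is enough that certain morphisms are among the `permMap X n σ`. -/
lemma exists_permMap_whiskerLeft (X : C) {n : ℕ} (ρ : Equiv.Perm (Fin n)) :
    ∃ σ, permMap X (n + 1) σ = X ◁ permMap X n ρ := by
  obtain ⟨σ, h, h'⟩ := exists_perm_cons 0 ρ
  refine ⟨σ, ?_⟩
  change X ◁ permMap X n (tailPerm σ) ≫ insertAt X n (σ 0) = _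
  rw [h, h', insertAt_zero]
  exact Category.comp_id _

lemma exists_permMap_eq_insertAt (X : C) {n : ℕ} (q : Fin (n + 1)) :
    ∃ σ, permMap X (n + 1) σ = insertAt X n q := by
  obtain ⟨σ, h, h'⟩ := exists_perm_cons q (1 : Equiv.Perm (Fin n))
  refine ⟨σ, ?_⟩
  change X ◁ permMap X n (tailPerm σ) ≫ insertAt X n (σ 0) = _
  rw [h, h', permMap_one]
  exact (by simp : ∀ {P Q : C} (f : X ⊗ P ⟶ Q), X ◁ 𝟙 P ≫ f = f) _

lemma exists_permMap_eq_exchange (X : C) (n : ℕ) :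
    ∃ σ, permMap X (n + 2) σ = exchange X X (tpow X n) := by
  obtain ⟨σ, h⟩ := exists_permMap_eq_insertAt X (0 : Fin (n + 1)).succ
  refine ⟨σ, ?_⟩
  rw [h, insertAt_succ', insertAt_zero]
  exact (by simp : ∀ {P Q : C} (f : P ⟶ X ⊗ Q), f ≫ X ◁ 𝟙 Q = f) _

/-- Invariance under `Σ_n` of a generalized element of `F (X^{⊗ n})`. -/
def IsPermInvariant (F : C ⥤ C) (X : C) (n : ℕ) {W : C} (k : W ⟶ F.obj (tpow X n)) : Prop :=
  ∀ σ, k ≫ F.map (permMap X n σ) = k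

namespace IsPermInvariant

variable {F : C ⥤ C} {Z : C} {n : ℕ} {W : C}

/-- The functor `F` is a parameter for the sake of this step: once the first factor is mapped to
`X`, it is absorbed into `F`, and an element of length `n` remains on which induction applies. -/
lemma tail {k : W ⟶ F.obj (Z ⊗ tpow Z n)} (hk : IsPermInvariant F Z (n + 1) k) {X : C}
    (f : Z ⟶ X) : IsPermInvariant (tensorLeft X ⋙ F) Z n (k ≫ F.map (f ▷ tpow Z n)) := by
  intro ρ
  obtain ⟨σ, hσ⟩ := exists_permMap_whiskerLeft Z ρ
  change (k ≫ F.map (f ▷ tpow Z n)) ≫ F.map (X ◁ permMap Z n ρ) = _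
  rw [Category.assoc, ← F.map_comp, ← whisker_exchange, F.map_comp, ← Category.assoc]
  congr 1
  have := hk σ
  rwa [hσ] at this

lemma insertAt {k : W ⟶ F.obj (Z ⊗ tpow Z n)} (hk : IsPermInvariant F Z (n + 1) k)
    (q : Fin (n + 1)) : k ≫ F.map (insertAt Z n q) = k := by
  obtain ⟨σ, hσ⟩ := exists_permMap_eq_insertAt Z q
  rw [← hσ]
  exact hk σ

lemma comp_map {G : C ⥤ C} {k : W ⟶ F.obj (tpow Z n)} (hk : IsPermInvariant F Z n k)
    (t : F ⟶ G) : IsPermInvariant G Z n (k ≫ t.app _) := by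
  intro σ
  rw [Category.assoc, ← t.naturality, ← Category.assoc, hk σ]

lemma of_zero (k : W ⟶ F.obj (tpow Z 0)) : IsPermInvariant F Z 0 k := fun σ => by
  have : permMap Z 0 σ = 𝟙 _ := rfl
  rw [this, F.map_id, Category.comp_id]

lemma of_one (k : W ⟶ F.obj (tpow Z 1)) : IsPermInvariant F Z 1 k := fun σ => by
  obtain rfl : σ = 1 := Subsingleton.elim _ _
  rw [permMap_one, F.map_id, Category.comp_id]

/-- Invariance under `Σ_{n + 2}` can be checked on `Σ_{n + 1}`, acting on the last factors, and on
the exchange of the first two factors. -/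
lemma of_tail_of_exchange {k : W ⟶ F.obj (Z ⊗ (Z ⊗ tpow Z n))}
    (h : ∀ ρ, k ≫ F.map (Z ◁ permMap Z (n + 1) ρ) = k)
    (h' : k ≫ F.map (_root_.exchange Z Z (tpow Z n)) = k) : IsPermInvariant F Z (n + 2) k := by
  have key : ∀ {P Q R : C} {k : W ⟶ F.obj P} {l : W ⟶ F.obj Q} {m : W ⟶ F.obj R} {f : P ⟶ Q}
      {g : Q ⟶ R}, k ≫ F.map f = l → l ≫ F.map g = m → k ≫ F.map (f ≫ g) = m := by
    intro P Q R k l m f g h h'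
    rw [F.map_comp, reassoc_of% h, h']
  -- Inserting at a positive position is the exchange of the first two factors followed by an
  -- insertion inside the tail, and the latter is a permutation of the tail.
  have h0 : ∀ q, k ≫ F.map (_root_.insertAt Z (n + 1) q) = k := by
    intro q
    induction q using Fin.cases with
    | zero => exact (congrArg (k ≫ ·) (F.map_id _)).trans (Category.comp_id _)
    | succ q =>
      obtain ⟨σ, hσ⟩ := exists_permMap_eq_insertAt Z q
      rw [insertAt_succ', ← hσ]
      exact key h' (h σ)
  exact fun σ => key (h _) (h0 _)

end IsPermInvariant

section

variable {X Y Z : C} (p : Z ⟶ X) (q : Z ⟶ Y)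

/-- The morphism `Z^{⊗ n} ⟶ X^{⊗ a} ⊗ Y^{⊗ b}`, for `a + b = n`, induced by `p : Z ⟶ X` on the
first `a` factors and by `q : Z ⟶ Y` on the last `b` factors. -/
def tpowSplit : ∀ (a b n : ℕ), b + a = n → (tpow Z n ⟶ tpow X a ⊗ tpow Y b)
  -- The length `n` is kept as a variable, so that all splittings with `a + b = n` have the same
  -- source; a transport is needed only here.
  | 0, b, _, h => eqToHom (congrArg (tpow Z) h.symm) ≫ tpowMap q b ≫ (λ_ (tpow Y b)).inv
  | _ + 1, _, 0, h => absurd h (by omega)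
  | a + 1, b, n + 1, h => (p ⊗ₘ tpowSplit a b n (by omega)) ≫ (α_ X (tpow X a) (tpow Y b)).inv

omit [SymmetricCategory C] in
lemma tpowSplit_zero (b : ℕ) : tpowSplit p q 0 b b rfl = tpowMap q b ≫ (λ_ (tpow Y b)).inv :=
  Category.id_comp _

omit [SymmetricCategory C] in
lemma tpowSplit_succ (a b n : ℕ) (h : b + a = n) (h' : b + (a + 1) = n + 1) :
    tpowSplit p q (a + 1) b (n + 1) h' =
      (p ⊗ₘ tpowSplit p q a b n h) ≫ (α_ X (tpow X a) (tpow Y b)).inv := rfl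

omit [SymmetricCategory C] in
-- Through this formula, invariance of a split element under `Σ_a × Σ_b` becomes naturality of the
-- permutation actions.
lemma tpowAdd_hom_tpowSplit (b : ℕ) : ∀ a : ℕ,
    (tpowAdd Z a b).hom ≫ tpowSplit p q a b (b + a) rfl = tpowMap p a ⊗ₘ tpowMap q b
  | 0 => by
    have key : ∀ {P Q : C} (f : P ⟶ Q) (s : P ⟶ 𝟙_ C ⊗ Q), s = f ≫ (λ_ Q).inv →
        (λ_ P).hom ≫ s = 𝟙 (𝟙_ C) ⊗ₘ f := by
      rintro P Q f s rfl
      simp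
    exact key _ _ (tpowSplit_zero p q b)
  | a + 1 => by
    have key : ∀ {A B T A' B' : C} (t : A ⊗ B ≅ T) (s : T ⟶ A' ⊗ B') (f : A ⟶ A') (g : B ⟶ B'),
        t.hom ≫ s = f ⊗ₘ g →
        ((α_ Z A B).hom ≫ Z ◁ t.hom) ≫ (p ⊗ₘ s) ≫ (α_ X A' B').inv = (p ⊗ₘ f) ⊗ₘ g := by
      intro A B T A' B' t s f g h
      rw [Category.assoc, ← id_tensorHom, tensorHom_comp_tensorHom_assoc, h, Category.id_comp,
        ← associator_naturality_assoc]
      simp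
    exact key _ _ _ _ (tpowAdd_hom_tpowSplit b a)

/-- Moving the first factor to position `a` before splitting. -/
lemma insertAt_tpowSplit (b : ℕ) : ∀ (a n : ℕ) (h : b + a = n) (h' : b + 1 + a = n + 1),
    insertAt Z n ⟨a, by omega⟩ ≫ tpowSplit p q a (b + 1) (n + 1) h' =
      (q ⊗ₘ tpowSplit p q a b n h) ≫ exchange Y (tpow X a) (tpow Y b)
  | 0, n, h, h' => by
    obtain rfl : b = n := h
    have key : ∀ {P Q : C} (f : P ⟶ Q) (i : Z ⊗ P ⟶ Z ⊗ P) (s : Z ⊗ P ⟶ 𝟙_ C ⊗ (Y ⊗ Q))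
        (t : P ⟶ 𝟙_ C ⊗ Q), i = 𝟙 _ → s = (q ⊗ₘ f) ≫ (λ_ (Y ⊗ Q)).inv → t = f ≫ (λ_ Q).inv →
        i ≫ s = (q ⊗ₘ t) ≫ exchange Y (𝟙_ C) Q := by
      rintro P Q f i s t rfl rfl rfl
      rw [exchange_unit, ← id_tensorHom, tensorHom_comp_tensorHom_assoc]
      simp
    exact key _ _ _ _ (insertAt_zero Z b) (tpowSplit_zero p q (b + 1)) (tpowSplit_zero p q b)
  | a + 1, 0, h, _ => absurd h (by omega)
  | a + 1, n + 1, h, h' => by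
    have ih := insertAt_tpowSplit b a n (by omega) (by omega)
    have h0 : insertAt Z (n + 1) ⟨a + 1, by omega⟩ =
        exchange Z Z (tpow Z n) ≫ Z ◁ insertAt Z n ⟨a, by omega⟩ :=
      insertAt_succ' Z n ⟨a, by omega⟩
    rw [h0, tpowSplit_succ p q a (b + 1) (n + 1) (by omega),
      tpowSplit_succ p q a b n (by omega)]
    -- The factor that becomes `Y` first passes `X` and then the remaining block `A`, as in
    -- `exchange_tensor_right`.
    have key : ∀ {P P' A B : C} (i : Z ⊗ P ⟶ P') (s : P' ⟶ A ⊗ (Y ⊗ B)) (t : P ⟶ A ⊗ B),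
        i ≫ s = (q ⊗ₘ t) ≫ exchange Y A B →
        (exchange Z Z P ≫ Z ◁ i) ≫ (p ⊗ₘ s) ≫ (α_ X A (Y ⊗ B)).inv =
          (q ⊗ₘ ((p ⊗ₘ t) ≫ (α_ X A B).inv)) ≫ exchange Y (X ⊗ A) B := by
      intro P P' A B i s t h
      rw [Category.assoc, ← id_tensorHom, tensorHom_comp_tensorHom_assoc, h, Category.id_comp,
        exchange_tensor_right]
      have e1 : p ⊗ₘ ((q ⊗ₘ t) ≫ exchange Y A B) = (p ⊗ₘ (q ⊗ₘ t)) ≫ X ◁ exchange Y A B := by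
        rw [← id_tensorHom, tensorHom_comp_tensorHom, Category.comp_id]
      have e2 : (q ⊗ₘ ((p ⊗ₘ t) ≫ (α_ X A B).inv)) ≫ Y ◁ (α_ X A B).hom = q ⊗ₘ (p ⊗ₘ t) := by
        rw [← id_tensorHom, tensorHom_comp_tensorHom]
        simp
      rw [e1, reassoc_of% e2, reassoc_of% exchange_naturality q p t]
      simp
    exact key _ _ _ ih

end

end Shuffles

/-! ### Invariants in tensor powers of a product. -/

section InvariantsOfProducts

variable {D : Type u} [Category.{v} D] [MonoidalCategory D] [SymmetricCategory D]

/-- The action of `Σ_a × Σ_b` fixes a generalized element of `F (X^{⊗ a} ⊗ Y^{⊗ b})`. -/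
def IsYoungInvariant (F : D ⥤ D) (X Y : D) (a b : ℕ) {W : D}
    (k : W ⟶ F.obj (tpow X a ⊗ tpow Y b)) : Prop :=
  ∀ (σ : Equiv.Perm (Fin a)) (τ : Equiv.Perm (Fin b)),
    k ≫ F.map (permMap X a σ ⊗ₘ permMap Y b τ) = k

section

variable (F : D ⥤ D) {X Y Z W : D} (p : Z ⟶ X) (q : Z ⟶ Y)

omit [SymmetricCategory D] in
-- The recursion for components whose first factor is in `X`. The splitting already puts the
-- `X`-factors first, so no invariance is needed.
lemma tail_comp_tpowSplit_left {a b n : ℕ} (h : b + a = n) (h' : b + (a + 1) = n + 1)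
    (k : W ⟶ F.obj (Z ⊗ tpow Z n)) :
    (k ≫ F.map (p ▷ tpow Z n)) ≫ F.map (X ◁ tpowSplit p q a b n h) =
      (k ≫ F.map (tpowSplit p q (a + 1) b (n + 1) h')) ≫
        F.map (α_ X (tpow X a) (tpow Y b)).hom := by
  have key : ∀ {P A B : D} (k : W ⟶ F.obj (Z ⊗ P)) (s : P ⟶ A ⊗ B),
      (k ≫ F.map (p ▷ P)) ≫ F.map (X ◁ s) =
        (k ≫ F.map ((p ⊗ₘ s) ≫ (α_ X A B).inv)) ≫ F.map (α_ X A B).hom := by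
    intro P A B k s
    simp only [Category.assoc, ← F.map_comp]
    simp [MonoidalCategory.tensorHom_def]
  exact key k _

/-- Here invariance is essential: a first factor that is to be read in `Y` must be moved behind the
`a` factors read in `X`, and `k` is unchanged by that insertion. -/
lemma tail_comp_tpowSplit_right {a b n : ℕ} (h : b + a = n) (h' : b + 1 + a = n + 1)
    (k : W ⟶ F.obj (Z ⊗ tpow Z n)) (hk : IsPermInvariant F Z (n + 1) k) :
    (k ≫ F.map (q ▷ tpow Z n)) ≫ F.map (Y ◁ tpowSplit p q a b n h) =
      (k ≫ F.map (tpowSplit p q a (b + 1) (n + 1) h')) ≫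
        F.map (exchange (tpow X a) Y (tpow Y b)) := by
  have key : ∀ {P P' A B : D} (k : W ⟶ F.obj (Z ⊗ P)) (k' : W ⟶ F.obj P') (i : Z ⊗ P ⟶ P')
      (s : P ⟶ A ⊗ B) (t : P' ⟶ A ⊗ (Y ⊗ B)), k ≫ F.map i = k' →
      i ≫ t = (q ⊗ₘ s) ≫ exchange Y A B →
      (k ≫ F.map (q ▷ P)) ≫ F.map (Y ◁ s) = (k' ≫ F.map t) ≫ F.map (exchange A Y B) := by
    rintro P P' A B k _ i s t rfl h
    simp only [Category.assoc, ← F.map_comp]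
    rw [reassoc_of% h, exchange_exchange, Category.comp_id, MonoidalCategory.tensorHom_def]
  exact key k k _ _ _ (hk.insertAt _) (insertAt_tpowSplit p q b a n h h')

end

variable [HasZeroObject D] [HasZeroMorphisms D] [HasLimits D] [HasColimits D] [CofreeFriendly D]

/-- The functor `F` preserves binary products. -/
def PreservesBinProds (F : D ⥤ D) : Prop :=
  ∀ ⦃X Y Z : D⦄ ⦃p : Z ⟶ X⦄ ⦃q : Z ⟶ Y⦄, IsBinProd p q → IsBinProd (F.map p) (F.map q)

omit [MonoidalCategory D] [SymmetricCategory D] [HasZeroObject D] [HasZeroMorphisms D]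
  [HasLimits D] [HasColimits D] [CofreeFriendly D] in
lemma preservesBinProds_id : PreservesBinProds (𝟭 D) := fun _ _ _ _ _ h => h

lemma PreservesBinProds.tensorLeft_comp {F : D ⥤ D} (hF : PreservesBinProds F) (U : D) :
    PreservesBinProds (tensorLeft U ⋙ F) := fun _ _ _ _ _ h => hF (h.whiskerLeft U)

variable {X Y Z : D} {p : Z ⟶ X} {q : Z ⟶ Y}

/-- A `Σ_n`-invariant element of `(X × Y)^{⊗ n}` is determined by its components in
`X^{⊗ a} ⊗ Y^{⊗ b}`, for `a + b = n`. -/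
lemma IsPermInvariant.ext_of_tpowSplit (hpq : IsBinProd p q) {W : D} : ∀ (n : ℕ) {F : D ⥤ D}
    (_ : PreservesBinProds F) {k l : W ⟶ F.obj (tpow Z n)} (_ : IsPermInvariant F Z n k)
    (_ : IsPermInvariant F Z n l) (_ : ∀ a b (h : b + a = n),
      k ≫ F.map (tpowSplit p q a b n h) = l ≫ F.map (tpowSplit p q a b n h)), k = l
  | 0, F, _, k, l, _, _, h => by
    have h0 := h 0 0 rfl
    have : IsIso (tpowSplit p q 0 0 0 rfl) := by
      rw [tpowSplit_zero]
      exact inferInstanceAs (IsIso (𝟙 (𝟙_ D) ≫ (λ_ (𝟙_ D)).inv))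
    exact (cancel_mono _).1 h0
  | n + 1, F, hF, k, l, hk, hl, h => by
    -- `Z ⊗ Z^{⊗ n}` is the product of `X ⊗ Z^{⊗ n}` and `Y ⊗ Z^{⊗ n}`, and both coordinates are
    -- invariant elements of length `n` for an enlarged functor.
    refine (hF (hpq.whiskerRight (tpow Z n))).hom_ext ?_ ?_
    · refine ext_of_tpowSplit hpq n (hF.tensorLeft_comp X) (hk.tail p) (hl.tail p)
        fun a b hab => ?_
      refine (tail_comp_tpowSplit_left F p q hab (by omega) k).trans
        (Eq.trans ?_ (tail_comp_tpowSplit_left F p q hab (by omega) l).symm)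
      exact congrArg (· ≫ _) (h _ _ _)
    · refine ext_of_tpowSplit hpq n (hF.tensorLeft_comp Y) (hk.tail q) (hl.tail q)
        fun a b hab => ?_
      refine (tail_comp_tpowSplit_right F p q hab (by omega) k hk).trans
        (Eq.trans ?_ (tail_comp_tpowSplit_right F p q hab (by omega) l hl).symm)
      exact congrArg (· ≫ _) (h _ _ _)

namespace IsYoungInvariant

variable {F : D ⥤ D} {a b : ℕ} {W : D}

omit [HasZeroObject D] [HasZeroMorphisms D] [HasLimits D] [HasColimits D] [CofreeFriendly D]

lemma left {k : W ⟶ F.obj ((X ⊗ tpow X a) ⊗ tpow Y b)} (hk : IsYoungInvariant F X Y (a + 1) b k) :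
    IsYoungInvariant (tensorLeft X ⋙ F) X Y a b (k ≫ F.map (α_ X (tpow X a) (tpow Y b)).hom) := by
  intro σ τ
  obtain ⟨ρ, hρ⟩ := exists_permMap_whiskerLeft X σ
  have key : ∀ {A B : D} (k : W ⟶ F.obj ((X ⊗ A) ⊗ B)) (s : A ⟶ A) (r : X ⊗ A ⟶ X ⊗ A) (t : B ⟶ B),
      r = X ◁ s → k ≫ F.map (r ⊗ₘ t) = k →
      (k ≫ F.map (α_ X A B).hom) ≫ F.map (X ◁ (s ⊗ₘ t)) = k ≫ F.map (α_ X A B).hom := by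
    rintro A B k s _ t rfl h
    conv_rhs => rw [← h]
    simp only [Category.assoc, ← F.map_comp]
    simp [MonoidalCategory.tensorHom_def]
  exact key k _ _ _ hρ (hk ρ τ)

lemma right {k : W ⟶ F.obj (tpow X a ⊗ (Y ⊗ tpow Y b))} (hk : IsYoungInvariant F X Y a (b + 1) k) :
    IsYoungInvariant (tensorLeft Y ⋙ F) X Y a b
      (k ≫ F.map (exchange (tpow X a) Y (tpow Y b))) := by
  intro σ τ
  obtain ⟨ρ, hρ⟩ := exists_permMap_whiskerLeft Y τ
  have key : ∀ {A B : D} (k : W ⟶ F.obj (A ⊗ (Y ⊗ B))) (s : A ⟶ A) (r : Y ⊗ B ⟶ Y ⊗ B) (t : B ⟶ B),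
      r = Y ◁ t → k ≫ F.map (s ⊗ₘ r) = k →
      (k ≫ F.map (exchange A Y B)) ≫ F.map (Y ◁ (s ⊗ₘ t)) = k ≫ F.map (exchange A Y B) := by
    rintro A B k s _ t rfl h
    conv_rhs => rw [← h]
    simp only [Category.assoc, ← F.map_comp]
    have := exchange_naturality s (𝟙 Y) t
    simp only [id_tensorHom] at this
    rw [this]
  exact key k _ _ _ hρ (hk σ ρ)

lemma exchange_left {k : W ⟶ F.obj ((X ⊗ (X ⊗ tpow X a)) ⊗ tpow Y b)}
    (hk : IsYoungInvariant F X Y (a + 2) b k) :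
    k ≫ F.map (exchange X X (tpow X a) ▷ tpow Y b) = k := by
  obtain ⟨σ, hσ⟩ := exists_permMap_eq_exchange X a
  have key : ∀ {A B : D} (k : W ⟶ F.obj (A ⊗ B)) (s r : A ⟶ A) (t : B ⟶ B),
      r = s → t = 𝟙 B → k ≫ F.map (r ⊗ₘ t) = k → k ≫ F.map (s ▷ B) = k := by
    rintro A B k s _ _ rfl rfl h
    simpa using h
  exact key k _ _ _ hσ (permMap_one Y b) (hk σ 1)

lemma exchange_right {k : W ⟶ F.obj (tpow X a ⊗ (Y ⊗ (Y ⊗ tpow Y b)))}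
    (hk : IsYoungInvariant F X Y a (b + 2) k) :
    k ≫ F.map (tpow X a ◁ exchange Y Y (tpow Y b)) = k := by
  obtain ⟨τ, hτ⟩ := exists_permMap_eq_exchange Y b
  have key : ∀ {A B : D} (k : W ⟶ F.obj (A ⊗ B)) (t : A ⟶ A) (s r : B ⟶ B),
      r = s → t = 𝟙 A → k ≫ F.map (t ⊗ₘ r) = k → k ≫ F.map (A ◁ s) = k := by
    rintro A B k _ s _ rfl rfl h
    simpa using h
  exact key k _ _ _ hτ (permMap_one X a) (hk 1 τ)

end IsYoungInvariant

omit [HasZeroObject D] [HasZeroMorphisms D] [HasLimits D] [HasColimits D] [CofreeFriendly D] in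
-- Exchanging two factors and reading them through `f`, `g` is the same as reading them through `g`,
-- `f` and then exchanging. Invariance under the exchange is thereby reduced to comparing
-- coordinates.
lemma exchange_double_tail (F : D ⥤ D) {Z A B P W : D} (k : W ⟶ F.obj (Z ⊗ (Z ⊗ P))) (f : Z ⟶ A)
    (g : Z ⟶ B) :
    (((k ≫ F.map (exchange Z Z P)) ≫ F.map (f ▷ (Z ⊗ P))) ≫ F.map (A ◁ (g ▷ P))) =
      ((k ≫ F.map (g ▷ (Z ⊗ P))) ≫ F.map (B ◁ (f ▷ P))) ≫ F.map (exchange B A P) := by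
  have := exchange_naturality g f (𝟙 P)
  simp only [tensorHom_id] at this
  simp only [Category.assoc, ← F.map_comp]
  congr 2
  have h1 : f ▷ (Z ⊗ P) ≫ A ◁ (g ▷ P) = f ⊗ₘ (g ▷ P) := (MonoidalCategory.tensorHom_def _ _).symm
  have h2 : g ▷ (Z ⊗ P) ≫ B ◁ (f ▷ P) = g ⊗ₘ (f ▷ P) := (MonoidalCategory.tensorHom_def _ _).symm
  rw [h1, reassoc_of% h2, this]

instance (A B P : D) : IsIso (exchange A B P) :=
  ⟨exchange B A P, exchange_exchange _ _ _, exchange_exchange _ _ _⟩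

omit [MonoidalCategory D] [SymmetricCategory D] [HasZeroObject D] [HasZeroMorphisms D]
  [HasLimits D] [HasColimits D] [CofreeFriendly D] in
lemma eq_of_comp_map {F : D ⥤ D} {P Q W : D} (e : P ⟶ Q) [IsIso e] {k l : W ⟶ F.obj P}
    (h : k ≫ F.map e = l ≫ F.map e) : k = l :=
  (cancel_mono _).1 h

/-- The exchange of the first two factors, as a natural transformation. -/
def exchangeNatTrans (F : D ⥤ D) (A B : D) :
    tensorLeft B ⋙ tensorLeft A ⋙ F ⟶ tensorLeft A ⋙ tensorLeft B ⋙ F where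
  app P := F.map (exchange A B P)
  naturality P Q f := by
    have := exchange_naturality (𝟙 A) (𝟙 B) f
    simp only [id_tensorHom] at this
    change F.map (A ◁ B ◁ f) ≫ F.map _ = F.map _ ≫ F.map (B ◁ A ◁ f)
    rw [← F.map_comp, this, F.map_comp]

/-- The elements of `(X × Y)^{⊗ n + 2}` with the given components are invariant under the exchange
of the first two factors. -/
lemma comp_exchange_eq_self (hpq : IsBinProd p q) {W : D} {n : ℕ} {F : D ⥤ D}
    (hF : PreservesBinProds F) (κ : ∀ a b, b + a = n + 2 → (W ⟶ F.obj (tpow X a ⊗ tpow Y b)))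
    (hκ : ∀ a b h, IsYoungInvariant F X Y a b (κ a b h))
    (k : W ⟶ F.obj (Z ⊗ (Z ⊗ tpow Z n)))
    (hX : IsPermInvariant (tensorLeft X ⋙ F) Z (n + 1) (k ≫ F.map (p ▷ (Z ⊗ tpow Z n))))
    (hX' : ∀ a b (h : b + a = n + 1),
      (k ≫ F.map (p ▷ (Z ⊗ tpow Z n))) ≫ F.map (X ◁ tpowSplit p q a b (n + 1) h) =
        κ (a + 1) b (by omega) ≫ F.map (α_ X (tpow X a) (tpow Y b)).hom)
    (hY : IsPermInvariant (tensorLeft Y ⋙ F) Z (n + 1) (k ≫ F.map (q ▷ (Z ⊗ tpow Z n))))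
    (hY' : ∀ a b (h : b + a = n + 1),
      (k ≫ F.map (q ▷ (Z ⊗ tpow Z n))) ≫ F.map (Y ◁ tpowSplit p q a b (n + 1) h) =
        κ a (b + 1) (by omega) ≫ F.map (exchange (tpow X a) Y (tpow Y b))) :
    k ≫ F.map (exchange Z Z (tpow Z n)) = k := by
  -- The four families of coordinates, according to whether each of the first two factors is read in
  -- `X` or in `Y`, expressed through `κ`.
  have hXX : ∀ a b (h : b + a = n),
      ((k ≫ F.map (p ▷ (Z ⊗ tpow Z n))) ≫ F.map (X ◁ (p ▷ tpow Z n))) ≫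
        F.map (X ◁ X ◁ tpowSplit p q a b n h) =
      (κ (a + 2) b (by omega) ≫ F.map (α_ X (X ⊗ tpow X a) (tpow Y b)).hom) ≫
        F.map (X ◁ (α_ X (tpow X a) (tpow Y b)).hom) := fun a b h =>
    (tail_comp_tpowSplit_left (tensorLeft X ⋙ F) p q h (by omega) _).trans
      (congrArg (· ≫ _) (hX' (a + 1) b (by omega)))
  have hXY : ∀ a b (h : b + a = n),
      ((k ≫ F.map (p ▷ (Z ⊗ tpow Z n))) ≫ F.map (X ◁ (q ▷ tpow Z n))) ≫
        F.map (X ◁ Y ◁ tpowSplit p q a b n h) =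
      (κ (a + 1) (b + 1) (by omega) ≫ F.map (α_ X (tpow X a) (Y ⊗ tpow Y b)).hom) ≫
        F.map (X ◁ exchange (tpow X a) Y (tpow Y b)) := fun a b h =>
    (tail_comp_tpowSplit_right (tensorLeft X ⋙ F) p q h (by omega) _ hX).trans
      (congrArg (· ≫ _) (hX' a (b + 1) (by omega)))
  have hYX : ∀ a b (h : b + a = n),
      ((k ≫ F.map (q ▷ (Z ⊗ tpow Z n))) ≫ F.map (Y ◁ (p ▷ tpow Z n))) ≫
        F.map (Y ◁ X ◁ tpowSplit p q a b n h) =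
      (κ (a + 1) (b + 1) (by omega) ≫ F.map (exchange (X ⊗ tpow X a) Y (tpow Y b))) ≫
        F.map (Y ◁ (α_ X (tpow X a) (tpow Y b)).hom) := fun a b h =>
    (tail_comp_tpowSplit_left (tensorLeft Y ⋙ F) p q h (by omega) _).trans
      (congrArg (· ≫ _) (hY' (a + 1) b (by omega)))
  have hYY : ∀ a b (h : b + a = n),
      ((k ≫ F.map (q ▷ (Z ⊗ tpow Z n))) ≫ F.map (Y ◁ (q ▷ tpow Z n))) ≫
        F.map (Y ◁ Y ◁ tpowSplit p q a b n h) =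
      (κ a (b + 2) (by omega) ≫ F.map (exchange (tpow X a) Y (Y ⊗ tpow Y b))) ≫
        F.map (Y ◁ exchange (tpow X a) Y (tpow Y b)) := fun a b h =>
    (tail_comp_tpowSplit_right (tensorLeft Y ⋙ F) p q h (by omega) _ hY).trans
      (congrArg (· ≫ _) (hY' a (b + 1) (by omega)))
  -- Comparison of two components which differ by the exchange of the first two factors.
  have key : ∀ {A B : D} (l : W ⟶ F.obj (B ⊗ (A ⊗ tpow Z n))) (m : W ⟶ F.obj (A ⊗ (B ⊗ tpow Z n)))
      (_ : IsPermInvariant (tensorLeft A ⋙ tensorLeft B ⋙ F) Z n l)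
      (_ : IsPermInvariant (tensorLeft B ⋙ tensorLeft A ⋙ F) Z n m)
      (l' : ∀ a b, b + a = n → (W ⟶ F.obj (B ⊗ (A ⊗ (tpow X a ⊗ tpow Y b)))))
      (m' : ∀ a b, b + a = n → (W ⟶ F.obj (A ⊗ (B ⊗ (tpow X a ⊗ tpow Y b)))))
      (_ : ∀ a b h, l ≫ F.map (B ◁ A ◁ tpowSplit p q a b n h) = l' a b h)
      (_ : ∀ a b h, m ≫ F.map (A ◁ B ◁ tpowSplit p q a b n h) = m' a b h)
      (_ : ∀ a b h, l' a b h ≫ F.map (exchange B A (tpow X a ⊗ tpow Y b)) = m' a b h),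
      l ≫ F.map (exchange B A (tpow Z n)) = m := by
    intro A B l m hl hm l' m' hl' hm' h
    refine IsPermInvariant.ext_of_tpowSplit hpq n ((hF.tensorLeft_comp A).tensorLeft_comp B)
      (hl.comp_map (exchangeNatTrans F B A)) hm fun a b hab => ?_
    refine Eq.trans ?_ (hm' a b hab).symm
    rw [← h, ← hl', Category.assoc, Category.assoc]
    exact congrArg (l ≫ ·) ((exchangeNatTrans F B A).naturality (tpowSplit p q a b n hab)).symm
  have hP := hpq.whiskerRight (tpow Z n)
  refine (hF (hpq.whiskerRight (Z ⊗ tpow Z n))).hom_ext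
    ((hF (hP.whiskerLeft X)).hom_ext ?_ ?_) ((hF (hP.whiskerLeft Y)).hom_ext ?_ ?_)
  -- Both factors in `X`: the exchange is a transposition in `Σ_{a + 2}`, which fixes `κ`.
  · rw [exchange_double_tail]
    refine key _ _ (hX.tail p) (hX.tail p) _ _ hXX hXX fun a b h => ?_
    have hc : ∀ A Q : D, exchange X X A ▷ Q ≫ (α_ X (X ⊗ A) Q).hom ≫ X ◁ (α_ X A Q).hom =
        (α_ X (X ⊗ A) Q).hom ≫ X ◁ (α_ X A Q).hom ≫ exchange X X (A ⊗ Q) := by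
      intro A Q
      simp only [exchange]
      monoidal
    have hc' : ∀ {A Q : D} (l : W ⟶ F.obj ((X ⊗ (X ⊗ A)) ⊗ Q)),
        l ≫ F.map (exchange X X A ▷ Q) = l →
        ((l ≫ F.map (α_ X (X ⊗ A) Q).hom) ≫ F.map (X ◁ (α_ X A Q).hom)) ≫
          F.map (exchange X X (A ⊗ Q)) =
        (l ≫ F.map (α_ X (X ⊗ A) Q).hom) ≫ F.map (X ◁ (α_ X A Q).hom) := by
      intro A Q l hl
      simp only [Category.assoc, ← F.map_comp]
      rw [← hc, F.map_comp, reassoc_of% hl]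
    exact hc' _ (hκ (a + 2) b (by omega)).exchange_left
  -- Mixed factors: both coordinates come from the same `κ (a + 1) (b + 1)` and differ exactly by
  -- the exchange, so invariance of `κ` plays no role.
  · rw [exchange_double_tail]
    refine key _ _ (hY.tail p) (hX.tail q) _ _ hYX hXY fun a b h => ?_
    have hc : ∀ {A Q : D} (l : W ⟶ F.obj ((X ⊗ A) ⊗ (Y ⊗ Q))),
        ((l ≫ F.map (exchange (X ⊗ A) Y Q)) ≫ F.map (Y ◁ (α_ X A Q).hom)) ≫
          F.map (exchange Y X (A ⊗ Q)) =
        (l ≫ F.map (α_ X A (Y ⊗ Q)).hom) ≫ F.map (X ◁ exchange A Y Q) := by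
      intro A Q l
      simp only [Category.assoc, ← F.map_comp]
      rw [exchange_tensor_left]
      simp [exchange_exchange, ← MonoidalCategory.whiskerLeft_comp_assoc]
    exact hc _
  · rw [exchange_double_tail]
    refine key _ _ (hX.tail q) (hY.tail p) _ _ hXY hYX fun a b h => ?_
    have hc : ∀ {A Q : D} (l : W ⟶ F.obj ((X ⊗ A) ⊗ (Y ⊗ Q))),
        ((l ≫ F.map (α_ X A (Y ⊗ Q)).hom) ≫ F.map (X ◁ exchange A Y Q)) ≫
          F.map (exchange X Y (A ⊗ Q)) =
        (l ≫ F.map (exchange (X ⊗ A) Y Q)) ≫ F.map (Y ◁ (α_ X A Q).hom) := by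
      intro A Q l
      simp only [Category.assoc, ← F.map_comp]
      rw [exchange_tensor_left]
      simp [← MonoidalCategory.whiskerLeft_comp]
    exact hc _
  -- Both factors in `Y`: the Yang–Baxter relation carries the exchange past the `X`-block, where it
  -- is a transposition in `Σ_{b + 2}`.
  · rw [exchange_double_tail]
    refine key _ _ (hY.tail q) (hY.tail q) _ _ hYY hYY fun a b h => ?_
    have hc : ∀ {A Q : D} (l : W ⟶ F.obj (A ⊗ (Y ⊗ (Y ⊗ Q)))),
        l ≫ F.map (A ◁ exchange Y Y Q) = l →
        ((l ≫ F.map (exchange A Y (Y ⊗ Q))) ≫ F.map (Y ◁ exchange A Y Q)) ≫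
          F.map (exchange Y Y (A ⊗ Q)) =
        (l ≫ F.map (exchange A Y (Y ⊗ Q))) ≫ F.map (Y ◁ exchange A Y Q) := by
      intro A Q l hl
      simp only [Category.assoc, ← F.map_comp]
      rw [exchange_yangBaxter, F.map_comp, reassoc_of% hl]
    exact hc _ (hκ a (b + 2) (by omega)).exchange_right

/-- Every family of `Σ_a × Σ_b`-invariant elements of `X^{⊗ a} ⊗ Y^{⊗ b}`, for `a + b = n`, comes
from a `Σ_n`-invariant element of `(X × Y)^{⊗ n}`. -/
lemma exists_isPermInvariant (hpq : IsBinProd p q) {W : D} : ∀ (n : ℕ) {F : D ⥤ D}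
    (_ : PreservesBinProds F) (κ : ∀ a b, b + a = n → (W ⟶ F.obj (tpow X a ⊗ tpow Y b)))
    (_ : ∀ a b h, IsYoungInvariant F X Y a b (κ a b h)),
    ∃ k : W ⟶ F.obj (tpow Z n), IsPermInvariant F Z n k ∧
      ∀ a b (h : b + a = n), k ≫ F.map (tpowSplit p q a b n h) = κ a b h
  | 0, F, _, κ, _ => by
    have key : ∀ {P : D} (k : W ⟶ F.obj (𝟙_ D ⊗ P)) (s : P ⟶ 𝟙_ D ⊗ P), s = (λ_ P).inv →
        (k ≫ F.map (λ_ P).hom) ≫ F.map s = k := by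
      rintro P k _ rfl
      simp [← F.map_comp]
    refine ⟨κ 0 0 rfl ≫ F.map (λ_ (𝟙_ D)).hom, .of_zero _, fun a b h => ?_⟩
    obtain rfl : a = 0 := by omega
    obtain rfl : b = 0 := by omega
    exact key _ _ ((tpowSplit_zero p q 0).trans (Category.id_comp _))
  | n + 1, F, hF, κ, hκ => by
    -- The coordinate with first factor in `X` must have the components `κ (a + 1) b`, and the one
    -- with first factor in `Y` the components `κ a (b + 1)`, with a `Y` brought to the front.
    obtain ⟨kX, hX, hX'⟩ := exists_isPermInvariant hpq n (hF.tensorLeft_comp X)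
      (fun a b h => κ (a + 1) b (by omega) ≫ F.map (α_ X (tpow X a) (tpow Y b)).hom)
      (fun a b h => (hκ (a + 1) b (by omega)).left)
    obtain ⟨kY, hY, hY'⟩ := exists_isPermInvariant hpq n (hF.tensorLeft_comp Y)
      (fun a b h => κ a (b + 1) (by omega) ≫ F.map (exchange (tpow X a) Y (tpow Y b)))
      (fun a b h => (hκ a (b + 1) (by omega)).right)
    obtain ⟨k, hkX, hkY⟩ := (hF (hpq.whiskerRight (tpow Z n))).exists_lift kX kY
    have htail : ∀ ρ, k ≫ F.map (Z ◁ permMap Z n ρ) = k := by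
      intro ρ
      refine (hF (hpq.whiskerRight (tpow Z n))).hom_ext ?_ ?_
      · rw [Category.assoc, ← F.map_comp, whisker_exchange, F.map_comp, reassoc_of% hkX, hkX]
        exact hX ρ
      · rw [Category.assoc, ← F.map_comp, whisker_exchange, F.map_comp, reassoc_of% hkY, hkY]
        exact hY ρ
    -- The induction hypothesis gives only invariance of the tail; from length two on, the exchange
    -- of the first two factors has to be treated separately.
    have hk : IsPermInvariant F Z (n + 1) k := by
      cases n with
      | zero => exact .of_one k
      | succ n =>
        refine IsPermInvariant.of_tail_of_exchange htail ?_
        subst hkX hkY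
        exact comp_exchange_eq_self hpq hF κ hκ k hX hX' hY hY'
    refine ⟨k, hk, fun a b h => ?_⟩
    -- For positive `a` the component is read off from `kX`; only `a = 0` needs `kY`.
    cases a with
    | zero =>
      obtain rfl : b = n + 1 := h
      exact eq_of_comp_map (exchange (tpow X 0) Y (tpow Y n))
        ((tail_comp_tpowSplit_right F p q (a := 0) rfl rfl k hk).symm.trans
          ((congrArg (· ≫ _) hkY).trans (hY' 0 n rfl)))
    | succ a =>
      exact eq_of_comp_map (α_ X (tpow X a) (tpow Y b)).hom
        ((tail_comp_tpowSplit_left F p q (by omega) h k).symm.trans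
          ((congrArg (· ≫ _) hkX).trans (hX' a b (by omega))))

end InvariantsOfProducts

/-! ### Naturality, associativity and symmetry of the splittings. -/

section SplitIdentities

variable {C : Type u} [Category.{v} C] [MonoidalCategory C]

lemma tpowMap_identity (X : C) : ∀ n, tpowMap (𝟙 X) n = 𝟙 (tpow X n)
  | 0 => rfl
  | n + 1 => (congrArg (𝟙 X ⊗ₘ ·) (tpowMap_identity X n)).trans (id_tensorHom_id _ _)

lemma tpowMap_composition {X Y Z : C} (f : X ⟶ Y) (g : Y ⟶ Z) :
    ∀ n, tpowMap f n ≫ tpowMap g n = tpowMap (f ≫ g) n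
  | 0 => Category.comp_id _
  | n + 1 => (tensorHom_comp_tensorHom _ _ _ _).trans
      (congrArg ((f ≫ g) ⊗ₘ ·) (tpowMap_composition f g n))

lemma tpowMap_comp_tpowSplit {X Y Z Z' : C} (h : Z' ⟶ Z) (p : Z ⟶ X) (q : Z ⟶ Y) :
    ∀ (a b n : ℕ) (hab : b + a = n),
      tpowMap h n ≫ tpowSplit p q a b n hab = tpowSplit (h ≫ p) (h ≫ q) a b n hab
  | 0, b, n, hab => by
    obtain rfl : b = n := hab
    have key : ∀ {P Q R : C} (f : P ⟶ Q) (g : Q ⟶ R) (g' : Q ⟶ 𝟙_ C ⊗ R) (k : P ⟶ 𝟙_ C ⊗ R),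
        g' = g ≫ (λ_ R).inv → k = (f ≫ g) ≫ (λ_ R).inv → f ≫ g' = k := by
      rintro P Q R f g _ _ rfl rfl
      simp
    refine key _ _ _ _ (tpowSplit_zero p q b) ?_
    rw [tpowMap_composition]
    exact tpowSplit_zero _ _ b
  | _ + 1, _, 0, hab => absurd hab (by omega)
  | a + 1, b, n + 1, hab => by
    have key : ∀ {P Q A B : C} (f : P ⟶ Q) (s : Q ⟶ A ⊗ B) (t : P ⟶ A ⊗ B), f ≫ s = t →
        (h ⊗ₘ f) ≫ (p ⊗ₘ s) ≫ (α_ X A B).inv = ((h ≫ p) ⊗ₘ t) ≫ (α_ X A B).inv := by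
      rintro P Q A B f s _ rfl
      rw [tensorHom_comp_tensorHom_assoc]
    exact key _ _ _ (tpowMap_comp_tpowSplit h p q a b n (by omega))

lemma tpowSplit_comp_tpowMap {X Y Z X' Y' : C} (p : Z ⟶ X) (q : Z ⟶ Y) (f : X ⟶ X')
    (g : Y ⟶ Y') : ∀ (a b n : ℕ) (hab : b + a = n),
      tpowSplit p q a b n hab ≫ (tpowMap f a ⊗ₘ tpowMap g b) =
        tpowSplit (p ≫ f) (q ≫ g) a b n hab
  | 0, b, n, hab => by
    obtain rfl : b = n := hab
    rw [tpowSplit_zero, tpowSplit_zero, ← tpowMap_composition]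
    change (_ ≫ (λ_ _).inv) ≫ (𝟙 (𝟙_ C) ⊗ₘ _) = _
    simp
  | _ + 1, _, 0, hab => absurd hab (by omega)
  | a + 1, b, n + 1, hab => by
    have key : ∀ {P A B A' B' : C} (s : P ⟶ A ⊗ B) (u : A ⟶ A') (w : B ⟶ B') (t : P ⟶ A' ⊗ B'),
        s ≫ (u ⊗ₘ w) = t → ((p ⊗ₘ s) ≫ (α_ X A B).inv) ≫ ((f ⊗ₘ u) ⊗ₘ w) =
          ((p ≫ f) ⊗ₘ t) ≫ (α_ X' A' B').inv := by
      rintro P A B A' B' s u w _ rfl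
      rw [Category.assoc, ← associator_inv_naturality, tensorHom_comp_tensorHom_assoc]
    exact key _ _ _ _ (tpowSplit_comp_tpowMap p q f g a b n (by omega))

lemma tpowSplit_right_zero {X Y Z : C} (p : Z ⟶ X) (q : Z ⟶ Y) : ∀ n : ℕ,
    tpowSplit p q n 0 n (Nat.zero_add n) = tpowMap p n ≫ (ρ_ (tpow X n)).inv
  | 0 => by
    refine (tpowSplit_zero p q 0).trans ?_
    change 𝟙 (𝟙_ C) ≫ (λ_ (𝟙_ C)).inv = 𝟙 (𝟙_ C) ≫ (ρ_ (𝟙_ C)).inv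
    rw [unitors_inv_equal]
  | n + 1 => by
    have key : ∀ {P A : C} (f : P ⟶ A) (s : P ⟶ A ⊗ 𝟙_ C), s = f ≫ (ρ_ A).inv →
        (p ⊗ₘ s) ≫ (α_ X A (𝟙_ C)).inv = (p ⊗ₘ f) ≫ (ρ_ (X ⊗ A)).inv := by
      rintro P A f _ rfl
      simp [MonoidalCategory.tensorHom_def]
    exact key _ _ (tpowSplit_right_zero p q n)

lemma tpowSplit_id (X : C) (a b : ℕ) :
    tpowSplit (𝟙 X) (𝟙 X) a b (b + a) rfl = (tpowAdd X a b).inv := by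
  have h := tpowAdd_hom_tpowSplit (𝟙 X) (𝟙 X) b a
  rw [tpowMap_identity, tpowMap_identity, id_tensorHom_id] at h
  rw [← cancel_epi (tpowAdd X a b).hom, h, Iso.hom_inv_id]

/-- Splitting into three blocks does not depend on the order of the splittings. -/
lemma tpowSplit_assoc {T X Y Z XY YZ : C} (P : T ⟶ XY) (Q : T ⟶ Z) (p : XY ⟶ X) (q : XY ⟶ Y)
    (A : T ⟶ X) (B : T ⟶ YZ) (r : YZ ⟶ Y) (s : YZ ⟶ Z) (hA : A = P ≫ p) (hB : B ≫ r = P ≫ q)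
    (hB' : B ≫ s = Q) (b c : ℕ) : ∀ (a n : ℕ) (h : c + (b + a) = n) (h' : c + b + a = n),
    tpowSplit P Q (b + a) c n h ≫ tpowSplit p q a b (b + a) rfl ▷ tpow Z c ≫
      (α_ (tpow X a) (tpow Y b) (tpow Z c)).hom =
    tpowSplit A B a (c + b) n h' ≫ tpow X a ◁ tpowSplit r s b c (c + b) rfl
  | 0, n, h, h' => by
    obtain rfl : c + b = n := h'
    have key : ∀ {U V S R R' : C} (t : U ⟶ V ⊗ S) (m : V ⟶ R) (w : U ⟶ R')
        (g : R' ⟶ R ⊗ S) (m' : V ⟶ 𝟙_ C ⊗ R) (w' : U ⟶ 𝟙_ C ⊗ R'),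
        m' = m ≫ (λ_ R).inv → w' = w ≫ (λ_ R').inv → t ≫ m ▷ S = w ≫ g →
        t ≫ m' ▷ S ≫ (α_ (𝟙_ C) R S).hom = w' ≫ 𝟙_ C ◁ g := by
      rintro U V S R R' t m w g _ _ rfl rfl h
      have h1 : w ≫ (λ_ R').inv ≫ 𝟙_ C ◁ g = (w ≫ g) ≫ (λ_ _).inv := by simp
      rw [Category.assoc, h1, ← h]
      simp
    refine key _ (tpowMap q b) (tpowMap B (c + b)) _ _ _ (tpowSplit_zero p q b)
      (tpowSplit_zero A B (c + b)) ?_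
    -- Without `X`-factors, both sides become the splitting along `P ≫ q` and `Q`.
    have h2 := tpowSplit_comp_tpowMap P Q q (𝟙 Z) b c (c + b) rfl
    rw [tpowMap_identity, tensorHom_id, Category.comp_id] at h2
    rw [tpowMap_comp_tpowSplit, hB, hB']
    exact h2
  | _ + 1, 0, h, _ => absurd h (by omega)
  | a + 1, n + 1, h, h' => by
    subst hA
    have key : ∀ {U V S G E R : C} (t : U ⟶ V ⊗ S) (m : V ⟶ G ⊗ E) (w : U ⟶ G ⊗ R)
        (g : R ⟶ E ⊗ S), t ≫ m ▷ S ≫ (α_ G E S).hom = w ≫ G ◁ g →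
        ((P ⊗ₘ t) ≫ (α_ XY V S).inv) ≫ ((p ⊗ₘ m) ≫ (α_ X G E).inv) ▷ S ≫
          (α_ (X ⊗ G) E S).hom = (((P ≫ p) ⊗ₘ w) ≫ (α_ X G R).inv) ≫ (X ⊗ G) ◁ g := by
      intro U V S G E R t m w g h
      have h1 : (((P ≫ p) ⊗ₘ w) ≫ (α_ X G R).inv) ≫ (X ⊗ G) ◁ g =
          ((P ≫ p) ⊗ₘ (w ≫ G ◁ g)) ≫ (α_ X G (E ⊗ S)).inv := by
        simp [MonoidalCategory.tensorHom_def]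
      have h2 : (P ≫ p) ⊗ₘ (t ≫ m ▷ S ≫ (α_ G E S).hom) =
          (P ⊗ₘ t) ≫ (p ⊗ₘ (m ⊗ₘ 𝟙 S)) ≫ X ◁ (α_ G E S).hom := by
        rw [← id_tensorHom, tensorHom_comp_tensorHom, tensorHom_comp_tensorHom]
        simp
      have h3 : ((p ⊗ₘ m) ≫ (α_ X G E).inv) ▷ S = ((p ⊗ₘ m) ⊗ₘ 𝟙 S) ≫ (α_ X G E).inv ▷ S := by
        simp
      rw [h1, ← h, h2, h3]
      simp only [Category.assoc]
      rw [← associator_inv_naturality_assoc]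
      simp
    exact key _ _ _ _ (tpowSplit_assoc P Q p q (P ≫ p) B r s rfl hB hB' b c a n (by omega)
      (by omega))

variable [SymmetricCategory C]

/-- On invariant elements, splitting off the second type of factors first amounts to the
symmetry. -/
lemma comp_tpowSplit_swap {X Y Z W : C} (p : Z ⟶ X) (q : Z ⟶ Y) (b : ℕ) :
    ∀ (a n : ℕ) {F : C ⥤ C} (h : b + a = n) (h' : a + b = n) {k : W ⟶ F.obj (tpow Z n)}
      (_ : IsPermInvariant F Z n k), k ≫ F.map (tpowSplit q p a b n h) =
        k ≫ F.map (tpowSplit p q b a n h' ≫ (β_ (tpow X b) (tpow Y a)).hom)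
  | 0, n, F, h, h', k, _ => by
    obtain rfl : b = n := h
    have h1 : tpowSplit p q b 0 b h' ≫ (β_ (tpow X b) (𝟙_ C)).hom =
        tpowMap p b ≫ (λ_ (tpow X b)).inv := by
      have := tpowSplit_right_zero p q b
      refine (congrArg (· ≫ (β_ (tpow X b) (𝟙_ C)).hom) this).trans ?_
      simp
    refine congrArg (fun f => k ≫ F.map f) ?_
    exact (tpowSplit_zero q p b).trans h1.symm
  | _ + 1, 0, _, h, _, _, _ => absurd h (by omega)
  | a + 1, n + 1, F, h, h', k, hk => by
    have ih := comp_tpowSplit_swap p q b a n (by omega) (by omega) (hk.tail q)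
    have h1 := tail_comp_tpowSplit_right F p q (a := b) (b := a) (by omega) (by omega) k hk
    have key : ∀ {P P' A B : C} (k : W ⟶ F.obj (Z ⊗ P)) (k' : W ⟶ F.obj P') (s : P ⟶ A ⊗ B)
        (t : P ⟶ B ⊗ A) (g : P' ⟶ B ⊗ (Y ⊗ A)),
        (k ≫ F.map (q ▷ P)) ≫ F.map (Y ◁ s) =
          (k ≫ F.map (q ▷ P)) ≫ F.map (Y ◁ (t ≫ (β_ B A).hom)) →
        (k ≫ F.map (q ▷ P)) ≫ F.map (Y ◁ t) = (k' ≫ F.map g) ≫ F.map (exchange B Y A) →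
        k ≫ F.map ((q ⊗ₘ s) ≫ (α_ Y A B).inv) = k' ≫ F.map (g ≫ (β_ B (Y ⊗ A)).hom) := by
      intro P P' A B k k' s t g h h'
      have e1 : k ≫ F.map ((q ⊗ₘ s) ≫ (α_ Y A B).inv) =
          ((k ≫ F.map (q ▷ P)) ≫ F.map (Y ◁ s)) ≫ F.map (α_ Y A B).inv := by
        simp [MonoidalCategory.tensorHom_def]
      -- The hexagon identity: braiding past `Y ⊗ A` is the exchange with `Y`, already controlled by
      -- `h'`, followed by the braiding past `A`, controlled by induction.
      have e2 : (β_ B (Y ⊗ A)).hom = exchange B Y A ≫ Y ◁ (β_ B A).hom ≫ (α_ Y A B).inv := by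
        simp [exchange]
      rw [e1, h, MonoidalCategory.whiskerLeft_comp, F.map_comp, ← Category.assoc (k ≫ _), h', e2]
      simp
    exact key k k _ _ _ ih h1

end SplitIdentities

/-! ### The objects of invariants `(X^{⊗ n})^{Σ_n}` and their splittings. -/

section SymmetricInvariants

variable {D : Type u} [Category.{v} D] [MonoidalCategory D] [SymmetricCategory D] [HasLimits D]

/-- The inclusion `(X^{⊗ n})^{Σ_n} ⟶ X^{⊗ n}`. -/
noncomputable abbrev symIncl (X : D) (n : ℕ) : symInv X n ⟶ tpow X n :=
  fixedPoints.ι (permMap X n)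

lemma symInvMap_symIncl {X Y : D} (f : X ⟶ Y) (n : ℕ) :
    symInvMap f n ≫ symIncl Y n = symIncl X n ≫ tpowMap f n :=
  fixedPoints.lift_ι _ _

lemma isPermInvariant_comp_symIncl {X W : D} {n : ℕ} (k : W ⟶ symInv X n) :
    IsPermInvariant (𝟭 D) X n (k ≫ symIncl X n) := fun σ => by
  change (k ≫ symIncl X n) ≫ permMap X n σ = _
  rw [Category.assoc, fixedPoints.ι_comp]

omit [HasLimits D] in
lemma IsYoungInvariant.comp_tensorHom_tpowMap {X Y X' Y' W : D} {a b : ℕ}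
    {k : W ⟶ tpow X a ⊗ tpow Y b} (hk : IsYoungInvariant (𝟭 D) X Y a b k) (f : X ⟶ X')
    (g : Y ⟶ Y') :
    IsYoungInvariant (𝟭 D) X' Y' a b (k ≫ (tpowMap f a ⊗ₘ tpowMap g b)) := by
  intro σ τ
  have h : k ≫ (permMap X a σ ⊗ₘ permMap Y b τ) = k := hk σ τ
  change (k ≫ (tpowMap f a ⊗ₘ tpowMap g b)) ≫ (permMap X' a σ ⊗ₘ permMap Y' b τ) = _
  rw [Category.assoc, tensorHom_comp_tensorHom, ← permMap_naturality, ← permMap_naturality,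
    ← tensorHom_comp_tensorHom, reassoc_of% h]

/-- The splitting is the inverse of concatenation followed by powers of `p` and `q`; under
concatenation `Σ_a × Σ_b` acts through permutations in `Σ_n`, and the powers are equivariant. -/
lemma isYoungInvariant_tpowSplit {X Y Z W : D} (p : Z ⟶ X) (q : Z ⟶ Y) {a b n : ℕ}
    (h : b + a = n) (k : W ⟶ symInv Z n) :
    IsYoungInvariant (𝟭 D) X Y a b ((k ≫ symIncl Z n) ≫ tpowSplit p q a b n h) := by
  subst h
  have h1 : tpowSplit p q a b (b + a) rfl =
      (tpowAdd Z a b).inv ≫ (tpowMap p a ⊗ₘ tpowMap q b) := by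
    rw [← tpowAdd_hom_tpowSplit, Iso.inv_hom_id_assoc]
  rw [h1, ← Category.assoc]
  refine IsYoungInvariant.comp_tensorHom_tpowMap (fun σ τ => ?_) p q
  exact tpowAdd_inv_youngMap Z a b (σ, τ) _ (isPermInvariant_comp_symIncl k)

variable [HasZeroObject D] [HasZeroMorphisms D] [HasColimits D]
  [CofreeFriendly D] [PermutationFriendly D]

instance mono_symIncl (X : D) (n : ℕ) : Mono (symIncl X n) :=
  ⟨fun _ _ h => fixedPoints.hom_ext h⟩

omit [MonoidalCategory D] [SymmetricCategory D] [HasZeroObject D] [HasZeroMorphisms D]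
  [HasColimits D] [CofreeFriendly D] [PermutationFriendly D] in
lemma isBinProd_prod (X Y : D) :
    IsBinProd (Limits.prod.fst : X ⨯ Y ⟶ X) (Limits.prod.snd : X ⨯ Y ⟶ Y) where
  hom_ext h h' := Limits.prod.hom_ext h h'
  exists_lift f g := ⟨Limits.prod.lift f g, Limits.prod.lift_fst _ _, Limits.prod.lift_snd _ _⟩

omit [HasZeroObject D] [HasZeroMorphisms D] [HasColimits D] [CofreeFriendly D]
  [PermutationFriendly D] in
lemma tensorInv_ι (X : D) (a b : ℕ) : tensorInv X a b ≫ fixedPoints.ι (youngMap X a b) =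
    symIncl X a ⊗ₘ symIncl X b :=
  fixedPoints.lift_ι _ _

omit [MonoidalCategory D] [SymmetricCategory D] [HasZeroObject D] [HasColimits D]
  [CofreeFriendly D] [PermutationFriendly D] in
-- Permutation-friendliness concerns the powers of a single object. As `X` and `Y` are both retracts
-- of `X ⨯ Y`, it can be transferred to mixed tensor products.
lemma exists_retract (X Y : D) : ∃ (Z : D) (i : X ⟶ Z) (p : Z ⟶ X) (j : Y ⟶ Z) (q : Z ⟶ Y),
    i ≫ p = 𝟙 X ∧ j ≫ q = 𝟙 Y :=
  ⟨X ⨯ Y, Limits.prod.lift (𝟙 X) 0, Limits.prod.fst, Limits.prod.lift 0 (𝟙 Y), Limits.prod.snd,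
    Limits.prod.lift_fst _ _, Limits.prod.lift_snd _ _⟩

omit [HasZeroObject D] [HasZeroMorphisms D] [HasColimits D] [CofreeFriendly D]
  [PermutationFriendly D] in
lemma symInvMap_retract {X Z : D} {i : X ⟶ Z} {p : Z ⟶ X} (h : i ≫ p = 𝟙 X) (n : ℕ) :
    symInvMap i n ≫ symInvMap p n = 𝟙 _ := by
  rw [← symInvMap_comp, h, symInvMap_id]

/-- For `Z` alone this morphism is an isomorphism followed by an inclusion of fixed points; the
split monomorphisms induced by `i` and `j` transport the property. -/
instance mono_symIncl_tensorHom (X Y : D) (a b : ℕ) : Mono (symIncl X a ⊗ₘ symIncl Y b) := by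
  obtain ⟨Z, i, p, j, q, hip, hjq⟩ := exists_retract X Y
  refine ⟨fun {W} f g h => ?_⟩
  have hm : Mono (symIncl Z a ⊗ₘ symIncl Z b) := by
    rw [← tensorInv_ι]
    have : Mono (fixedPoints.ι (youngMap Z a b)) := ⟨fun _ _ h => fixedPoints.hom_ext h⟩
    infer_instance
  have h1 : (symInvMap i a ⊗ₘ symInvMap j b) ≫ (symIncl Z a ⊗ₘ symIncl Z b) =
      (symIncl X a ⊗ₘ symIncl Y b) ≫ (tpowMap i a ⊗ₘ tpowMap j b) := by
    rw [tensorHom_comp_tensorHom, tensorHom_comp_tensorHom, symInvMap_symIncl, symInvMap_symIncl]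
  have h2 : f ≫ (symInvMap i a ⊗ₘ symInvMap j b) = g ≫ (symInvMap i a ⊗ₘ symInvMap j b) := by
    rw [← cancel_mono (symIncl Z a ⊗ₘ symIncl Z b), Category.assoc, Category.assoc, h1,
      reassoc_of% h]
  have h3 := congrArg (· ≫ (symInvMap p a ⊗ₘ symInvMap q b)) h2
  simpa only [Category.assoc, tensorHom_comp_tensorHom, symInvMap_retract hip,
    symInvMap_retract hjq, id_tensorHom_id, Category.comp_id] using h3

omit [HasZeroObject D] [HasColimits D] [CofreeFriendly D] in
-- The element is pushed into the powers of `Z`, lifted there by the inverse of `tensorInv`, and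
-- brought back by the retractions.
lemma exists_symInv_lift {X Y W : D} {a b : ℕ} (k : W ⟶ tpow X a ⊗ tpow Y b)
    (hk : IsYoungInvariant (𝟭 D) X Y a b k) :
    ∃ l : W ⟶ symInv X a ⊗ symInv Y b, l ≫ (symIncl X a ⊗ₘ symIncl Y b) = k := by
  obtain ⟨Z, i, p, j, q, hip, hjq⟩ := exists_retract X Y
  obtain ⟨l, hl⟩ : ∃ l : W ⟶ youngInv Z a b, l ≫ fixedPoints.ι (youngMap Z a b) =
      k ≫ (tpowMap i a ⊗ₘ tpowMap j b) :=
    ⟨fixedPoints.lift (φ := youngMap Z a b) (k ≫ (tpowMap i a ⊗ₘ tpowMap j b))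
      (fun g => hk.comp_tensorHom_tpowMap i j g.1 g.2), fixedPoints.lift_ι _ _⟩
  refine ⟨l ≫ inv (tensorInv Z a b) ≫ (symInvMap p a ⊗ₘ symInvMap q b), ?_⟩
  have h1 : (symInvMap p a ⊗ₘ symInvMap q b) ≫ (symIncl X a ⊗ₘ symIncl Y b) =
      (symIncl Z a ⊗ₘ symIncl Z b) ≫ (tpowMap p a ⊗ₘ tpowMap q b) := by
    rw [tensorHom_comp_tensorHom, tensorHom_comp_tensorHom, symInvMap_symIncl, symInvMap_symIncl]
  rw [Category.assoc, Category.assoc, h1, ← tensorInv_ι, Category.assoc, IsIso.inv_hom_id_assoc,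
    ← Category.assoc, hl, Category.assoc, tensorHom_comp_tensorHom,
    tpowMap_composition, tpowMap_composition, hip, hjq, tpowMap_identity, tpowMap_identity,
    id_tensorHom_id, Category.comp_id]

/-- The morphism `(Z^{⊗ n})^{Σ_n} ⟶ (X^{⊗ a})^{Σ_a} ⊗ (Y^{⊗ b})^{Σ_b}`, for `a + b = n`, induced by
`p : Z ⟶ X` and `q : Z ⟶ Y`. -/
noncomputable def symSplit {X Y Z : D} (p : Z ⟶ X) (q : Z ⟶ Y) (a b n : ℕ) (h : b + a = n) :
    symInv Z n ⟶ symInv X a ⊗ symInv Y b :=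
  -- The choice is harmless, since `mono_symIncl_tensorHom` makes the lift unique.
  (exists_symInv_lift _ (isYoungInvariant_tpowSplit p q h (𝟙 (symInv Z n)))).choose

lemma symSplit_symIncl {X Y Z : D} (p : Z ⟶ X) (q : Z ⟶ Y) (a b n : ℕ) (h : b + a = n) :
    symSplit p q a b n h ≫ (symIncl X a ⊗ₘ symIncl Y b) =
      symIncl Z n ≫ tpowSplit p q a b n h := by
  have := (exists_symInv_lift _ (isYoungInvariant_tpowSplit p q h (𝟙 (symInv Z n)))).choose_spec
  exact this.trans (congrArg (· ≫ tpowSplit p q a b n h) (Category.id_comp _))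

lemma symInvMap_symSplit {X Y Z Z' : D} (f : Z' ⟶ Z) (p : Z ⟶ X) (q : Z ⟶ Y) (a b n : ℕ)
    (h : b + a = n) :
    symInvMap f n ≫ symSplit p q a b n h = symSplit (f ≫ p) (f ≫ q) a b n h := by
  rw [← cancel_mono (symIncl X a ⊗ₘ symIncl Y b), Category.assoc, symSplit_symIncl,
    symSplit_symIncl, ← Category.assoc, symInvMap_symIncl, Category.assoc, tpowMap_comp_tpowSplit]

lemma symSplit_symInvMap {X Y Z X' Y' : D} (p : Z ⟶ X) (q : Z ⟶ Y) (f : X ⟶ X') (g : Y ⟶ Y')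
    (a b n : ℕ) (h : b + a = n) :
    symSplit p q a b n h ≫ (symInvMap f a ⊗ₘ symInvMap g b) =
      symSplit (p ≫ f) (q ≫ g) a b n h := by
  rw [← cancel_mono (symIncl X' a ⊗ₘ symIncl Y' b), Category.assoc, tensorHom_comp_tensorHom,
    symInvMap_symIncl, symInvMap_symIncl, ← tensorHom_comp_tensorHom, symSplit_symIncl,
    ← Category.assoc, symSplit_symIncl, Category.assoc, tpowSplit_comp_tpowMap]

lemma symSplit_braiding {X Y Z : D} (p : Z ⟶ X) (q : Z ⟶ Y) (a b n : ℕ) (h : b + a = n)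
    (h' : a + b = n) :
    symSplit p q b a n h' ≫ (β_ (symInv X b) (symInv Y a)).hom = symSplit q p a b n h := by
  rw [← cancel_mono (symIncl Y a ⊗ₘ symIncl X b), Category.assoc,
    ← BraidedCategory.braiding_naturality, ← Category.assoc, symSplit_symIncl, symSplit_symIncl,
    Category.assoc]
  have := isPermInvariant_comp_symIncl (𝟙 (symInv Z n))
  rw [Category.id_comp] at this
  exact (comp_tpowSplit_swap p q b a n h h' this).symm

lemma symSplit_left_zero {X Y Z : D} (p : Z ⟶ X) (q : Z ⟶ Y) (n : ℕ) :
    symSplit p q 0 n n rfl ≫ symIncl X 0 ▷ symInv Y n ≫ (λ_ (symInv Y n)).hom =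
      symInvMap q n := by
  have key : ∀ {P A B A' : D} (s : P ⟶ A ⊗ B) (i : A ⟶ 𝟙_ D) (j : B ⟶ A') (t : P ⟶ A'),
      s ≫ (i ⊗ₘ j) = t ≫ (λ_ A').inv → (s ≫ i ▷ B ≫ (λ_ B).hom) ≫ j = t := by
    intro P A B A' s i j t h
    rw [← cancel_mono (λ_ A').inv, ← h]
    simp [MonoidalCategory.tensorHom_def]
  rw [← cancel_mono (symIncl Y n), symInvMap_symIncl]
  refine key _ _ _ _ ((symSplit_symIncl p q 0 n n rfl).trans ?_)
  refine (congrArg (symIncl Z n ≫ ·) (tpowSplit_zero p q n)).trans ?_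
  exact (Category.assoc _ _ _).symm

section Product

variable {X Y Z : D} {p : Z ⟶ X} {q : Z ⟶ Y} (hpq : IsBinProd p q)

include hpq

/-- Together with `exists_symInv_hom`, this exhibits `symInv Z n` as the product of the `symInv X a
⊗ symInv Y b` over `a + b = n`. -/
lemma symInv_hom_ext_of_symSplit {W : D} {n : ℕ} {f g : W ⟶ symInv Z n}
    (h : ∀ a b (hab : b + a = n), f ≫ symSplit p q a b n hab = g ≫ symSplit p q a b n hab) :
    f = g := by
  rw [← cancel_mono (symIncl Z n)]
  refine IsPermInvariant.ext_of_tpowSplit hpq n preservesBinProds_id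
    (isPermInvariant_comp_symIncl f) (isPermInvariant_comp_symIncl g) fun a b hab => ?_
  change (f ≫ symIncl Z n) ≫ tpowSplit p q a b n hab = (g ≫ symIncl Z n) ≫ tpowSplit p q a b n hab
  rw [Category.assoc, Category.assoc, ← symSplit_symIncl, reassoc_of% h a b hab]

lemma exists_symInv_hom {W : D} {n : ℕ}
    (κ : ∀ a b, b + a = n → (W ⟶ symInv X a ⊗ symInv Y b)) :
    ∃ f : W ⟶ symInv Z n, ∀ a b (h : b + a = n), f ≫ symSplit p q a b n h = κ a b h := by
  obtain ⟨k, hk, hk'⟩ := exists_isPermInvariant hpq n preservesBinProds_id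
    (fun a b h => κ a b h ≫ (symIncl X a ⊗ₘ symIncl Y b)) (by
      intro a b h σ τ
      change (κ a b h ≫ (symIncl X a ⊗ₘ symIncl Y b)) ≫ (permMap X a σ ⊗ₘ permMap Y b τ) = _
      rw [Category.assoc, tensorHom_comp_tensorHom, fixedPoints.ι_comp, fixedPoints.ι_comp])
  have hk'' : ∀ a b (h : b + a = n), k ≫ tpowSplit p q a b n h =
    κ a b h ≫ (symIncl X a ⊗ₘ symIncl Y b) := hk'
  obtain ⟨f, hf⟩ : ∃ f : W ⟶ symInv Z n, f ≫ symIncl Z n = k :=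
    ⟨fixedPoints.lift k hk, fixedPoints.lift_ι _ _⟩
  refine ⟨f, fun a b h => ?_⟩
  rw [← cancel_mono (symIncl X a ⊗ₘ symIncl Y b), Category.assoc, symSplit_symIncl, ← hk'', ← hf,
    Category.assoc]

/-- The inclusion of `(X^{⊗ a})^{Σ_a} ⊗ (Y^{⊗ b})^{Σ_b}` as a direct summand of
`((X × Y)^{⊗ n})^{Σ_n}`, for `a + b = n`. -/
lemma exists_symShuffle (a b n : ℕ) (hab : b + a = n) :
    ∃ e : symInv X a ⊗ symInv Y b ⟶ symInv Z n, e ≫ symSplit p q a b n hab = 𝟙 _ ∧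
      ∀ a' b' (h : b' + a' = n), a' ≠ a → e ≫ symSplit p q a' b' n h = 0 := by
  classical
  obtain ⟨e, he⟩ := exists_symInv_hom hpq (W := symInv X a ⊗ symInv Y b) (n := n)
    (fun a' b' h => if h' : a' = a then eqToHom (by
      obtain rfl : b' = b := by omega
      rw [h']) else 0)
  refine ⟨e, by rw [he]; simp, fun a' b' h h' => by rw [he, dif_neg h']⟩

end Product

/-- Tensoring is not assumed to preserve monomorphisms, so this does not follow formally from the
case of two factors. Instead `symInv Y b ⊗ symInv Z c` is a direct summand of the invariants of `Y ⨯
Z`, which reduces three factors to two. -/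
instance mono_symIncl_tensorHom_tensorHom (X Y Z : D) (a b c : ℕ) :
    Mono (symIncl X a ⊗ₘ (symIncl Y b ⊗ₘ symIncl Z c)) := by
  have hpq := isBinProd_prod Y Z
  obtain ⟨e, he, he'⟩ := exists_symShuffle hpq b c (c + b) rfl
  let p : Y ⨯ Z ⟶ Y := Limits.prod.fst
  let q : Y ⨯ Z ⟶ Z := Limits.prod.snd
  -- All components of the summand inclusion factor through `symIncl Y b ⊗ₘ symIncl Z c`: the
  -- component `(b, c)` with the identity, the others with zero.
  have h0 : ∀ b' c' (h : c' + b' = c + b), ∃ m : tpow Y b ⊗ tpow Z c ⟶ tpow Y b' ⊗ tpow Z c',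
      (e ≫ symIncl (Y ⨯ Z) (c + b)) ≫ tpowSplit p q b' c' (c + b) h =
        (symIncl Y b ⊗ₘ symIncl Z c) ≫ m := by
    intro b' c' h
    rw [Category.assoc, ← symSplit_symIncl, ← Category.assoc]
    by_cases hb : b' = b
    · subst hb
      obtain rfl : c' = c := by omega
      exact ⟨𝟙 _, by rw [he]; simp⟩
    · exact ⟨0, by rw [he' _ _ _ hb]; simp⟩
  refine ⟨fun {W} f g h => ?_⟩
  have h1 : f ≫ (𝟙 _ ⊗ₘ e) = g ≫ (𝟙 _ ⊗ₘ e) := by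
    rw [← cancel_mono (symIncl X a ⊗ₘ symIncl (Y ⨯ Z) (c + b))]
    have hinv : ∀ l : W ⟶ symInv X a ⊗ (symInv Y b ⊗ symInv Z c),
        IsPermInvariant (tensorLeft (tpow X a)) (Y ⨯ Z) (c + b)
          ((l ≫ (𝟙 _ ⊗ₘ e)) ≫ (symIncl X a ⊗ₘ symIncl (Y ⨯ Z) (c + b))) := by
      intro l σ
      change _ ≫ tpow X a ◁ permMap (Y ⨯ Z) (c + b) σ = _
      rw [Category.assoc _ (symIncl X a ⊗ₘ _), ← id_tensorHom, tensorHom_comp_tensorHom,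
        fixedPoints.ι_comp, Category.comp_id]
    refine IsPermInvariant.ext_of_tpowSplit hpq (c + b)
      (preservesBinProds_id.tensorLeft_comp (tpow X a)) (hinv f) (hinv g) fun b' c' h' => ?_
    obtain ⟨m, hm⟩ := h0 b' c' h'
    have h2 : ∀ l : W ⟶ symInv X a ⊗ (symInv Y b ⊗ symInv Z c),
        ((l ≫ (𝟙 _ ⊗ₘ e)) ≫ (symIncl X a ⊗ₘ symIncl (Y ⨯ Z) (c + b))) ≫
          tpow X a ◁ tpowSplit p q b' c' (c + b) h' =
        (l ≫ (symIncl X a ⊗ₘ (symIncl Y b ⊗ₘ symIncl Z c))) ≫ tpow X a ◁ m := by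
      intro l
      simp only [← id_tensorHom, Category.assoc, tensorHom_comp_tensorHom]
      rw [← hm]
      simp
    exact (h2 f).trans ((congrArg (· ≫ _) h).trans (h2 g).symm)
  have h3 := congrArg (· ≫ (𝟙 _ ⊗ₘ symSplit p q b c (c + b) rfl)) h1
  simpa only [Category.assoc, tensorHom_comp_tensorHom, p, q, he, Category.comp_id,
    id_tensorHom_id] using h3

/-- Coassociativity of the splittings. -/
lemma symSplit_assoc {T X Y Z XY YZ : D} (P : T ⟶ XY) (Q : T ⟶ Z) (p : XY ⟶ X) (q : XY ⟶ Y)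
    (A : T ⟶ X) (B : T ⟶ YZ) (r : YZ ⟶ Y) (s : YZ ⟶ Z) (hA : A = P ≫ p) (hB : B ≫ r = P ≫ q)
    (hB' : B ≫ s = Q) (a b c n : ℕ) (h : c + (b + a) = n) (h' : c + b + a = n) :
    symSplit P Q (b + a) c n h ≫ symSplit p q a b (b + a) rfl ▷ symInv Z c ≫
      (α_ (symInv X a) (symInv Y b) (symInv Z c)).hom =
    symSplit A B a (c + b) n h' ≫ symInv X a ◁ symSplit r s b c (c + b) rfl := by
  rw [← cancel_mono (symIncl X a ⊗ₘ (symIncl Y b ⊗ₘ symIncl Z c))]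
  have h1 := symSplit_symIncl p q a b (b + a) rfl
  have h2 := symSplit_symIncl r s b c (c + b) rfl
  have h3 : symSplit p q a b (b + a) rfl ▷ symInv Z c ≫
      ((symIncl X a ⊗ₘ symIncl Y b) ⊗ₘ symIncl Z c) =
      (symIncl XY (b + a) ⊗ₘ symIncl Z c) ≫ tpowSplit p q a b (b + a) rfl ▷ tpow Z c := by
    rw [← tensorHom_id, ← tensorHom_id, tensorHom_comp_tensorHom, tensorHom_comp_tensorHom, h1]
    simp
  have h4 : symInv X a ◁ symSplit r s b c (c + b) rfl ≫
      (symIncl X a ⊗ₘ (symIncl Y b ⊗ₘ symIncl Z c)) =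
      (symIncl X a ⊗ₘ symIncl YZ (c + b)) ≫ tpow X a ◁ tpowSplit r s b c (c + b) rfl := by
    rw [← id_tensorHom, ← id_tensorHom, tensorHom_comp_tensorHom, tensorHom_comp_tensorHom, h2]
    simp
  simp only [Category.assoc]
  rw [← associator_naturality, reassoc_of% h3, h4, ← Category.assoc, symSplit_symIncl,
    ← Category.assoc (symSplit A B _ _ _ _), symSplit_symIncl, Category.assoc, Category.assoc,
    tpowSplit_assoc P Q p q A B r s hA hB hB' b c a n h h']

end SymmetricInvariants

/-! ### Finite sums of morphisms, obtained from biproducts. -/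

section FiniteSums

variable {D : Type u} [Category.{v} D] [MonoidalCategory D] [SymmetricCategory D]
  [HasZeroObject D] [HasZeroMorphisms D] [HasLimits D] [HasColimits D] [CofreeFriendly D]

/-- The sum of a finite family of morphisms. -/
noncomputable def sumHom {J : Type} [Finite J] {W V : D} (g : J → (W ⟶ V)) : W ⟶ V :=
  Pi.lift (fun _ : J => 𝟙 W) ≫ inv (sumToProd fun _ : J => W) ≫ Limits.Sigma.desc g

variable {J : Type} [Finite J] {W V : D}

lemma sumHom_comp (g : J → (W ⟶ V)) {V' : D} (f : V ⟶ V') :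
    sumHom g ≫ f = sumHom fun j => g j ≫ f := by
  have : Limits.Sigma.desc g ≫ f = Limits.Sigma.desc fun j => g j ≫ f :=
    Limits.Sigma.hom_ext _ _ fun j => by simp
  simp only [sumHom, Category.assoc, this]

lemma sumHom_eq_single (g : J → (W ⟶ V)) (j : J) (h : ∀ i, i ≠ j → g i = 0) :
    sumHom g = g j := by
  -- Since the other `g i` vanish, the morphism out of the sum is the `j`-th projection of the
  -- product followed by `g j`.
  have h1 : Limits.Sigma.desc g = sumToProd (fun _ : J => W) ≫ Pi.π _ j ≫ g j := by
    refine Limits.Sigma.hom_ext _ _ fun i => ?_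
    rw [sumToProd, Limits.Sigma.ι_desc, Limits.Sigma.ι_desc_assoc, Pi.lift_π_assoc]
    split_ifs with hij
    · subst hij; simp
    · rw [h i hij, zero_comp]
  rw [sumHom, h1, IsIso.inv_hom_id_assoc, Pi.lift_π_assoc, Category.id_comp]

lemma sumHom_eq_zero (g : J → (W ⟶ V)) (h : ∀ i, g i = 0) : sumHom g = 0 := by
  have h1 : Limits.Sigma.desc g = 0 := Limits.Sigma.hom_ext _ _ fun i => by
    rw [Limits.Sigma.ι_desc, h, comp_zero]
  rw [sumHom, h1, comp_zero, comp_zero]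

end FiniteSums

/-! ### Detecting morphisms on truncations. -/

section Gradings

variable {D : Type u} [Category.{v} D] [MonoidalCategory D] [SymmetricCategory D]

/-- A family of morphisms `π k : T ⟶ comp k`, and truncations `e N : T ⟶ T` on whose images the
`π k` are jointly monic, even after tensoring with an object. -/
structure Grading (T : D) where
  Index : Type
  comp : Index → D
  π : ∀ k, T ⟶ comp k
  e : ℕ → (T ⟶ T)
  e_comp_e (N : ℕ) : e N ≫ e N = e N
  -- The spectator `U` is what makes the condition stable under tensor products.
  detect (N : ℕ) {U W : D} {f g : W ⟶ T ⊗ U} (h : ∀ k, f ≫ π k ▷ U = g ≫ π k ▷ U) :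
    f ≫ e N ▷ U = g ≫ e N ▷ U

namespace Grading

/-- The trivial grading. -/
def trivial (T : D) : Grading T where
  Index := Unit
  comp _ := T
  π _ := 𝟙 T
  e _ := 𝟙 T
  e_comp_e _ := Category.comp_id _
  detect _ _ _ _ _ h := h ()

variable {T T' T'' : D}

/-- The grading of a tensor product. -/
def tensor (G : Grading T) (G' : Grading T') : Grading (T ⊗ T') where
  Index := G.Index × G'.Index
  comp k := G.comp k.1 ⊗ G'.comp k.2
  π k := G.π k.1 ⊗ₘ G'.π k.2
  e N := G.e N ⊗ₘ G'.e N
  e_comp_e N := by rw [tensorHom_comp_tensorHom, e_comp_e, e_comp_e]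
  detect N {U W} f g h := by
    -- Detection in `T` comes first, for each fixed component in `T'`; then `T'` is moved to the
    -- front and detection in `T'` follows, with `T ⊗ U` as spectator.
    have h1 : ∀ l, (f ≫ (α_ T T' U).hom) ≫ G.e N ▷ (T' ⊗ U) ≫ T ◁ (G'.π l ▷ U) =
        (g ≫ (α_ T T' U).hom) ≫ G.e N ▷ (T' ⊗ U) ≫ T ◁ (G'.π l ▷ U) := by
      intro l
      have h2 := G.detect N (f := (f ≫ (α_ T T' U).hom) ≫ T ◁ (G'.π l ▷ U))
        (g := (g ≫ (α_ T T' U).hom) ≫ T ◁ (G'.π l ▷ U)) (by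
          intro k
          have h3 : ∀ f : W ⟶ (T ⊗ T') ⊗ U, ((f ≫ (α_ T T' U).hom) ≫ T ◁ (G'.π l ▷ U)) ≫
              G.π k ▷ (G'.comp l ⊗ U) =
              (f ≫ (G.π k ⊗ₘ G'.π l) ▷ U) ≫ (α_ (G.comp k) (G'.comp l) U).hom := by
            intro f
            simp [MonoidalCategory.tensorHom_def']
          rw [h3, h3, h (k, l)])
      simpa only [Category.assoc, whisker_exchange] using h2
    have h4 := G'.detect N
      (f := ((f ≫ (α_ T T' U).hom) ≫ G.e N ▷ (T' ⊗ U)) ≫ exchange T T' U)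
      (g := ((g ≫ (α_ T T' U).hom) ≫ G.e N ▷ (T' ⊗ U)) ≫ exchange T T' U) (by
        intro l
        have h5 := exchange_naturality (𝟙 T) (G'.π l) (𝟙 U)
        simp only [id_tensorHom, tensorHom_id] at h5
        have h5' : exchange T T' U ≫ G'.π l ▷ (T ⊗ U) =
            T ◁ (G'.π l ▷ U) ≫ exchange T (G'.comp l) U := by
          rw [h5]; simp
        have h6 := congrArg (· ≫ exchange T (G'.comp l) U) (h1 l)
        simp only [Category.assoc] at h6 ⊢
        rw [h5', h6])
    have h7 := exchange_naturality (𝟙 T) (G'.e N) (𝟙 U)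
    simp only [id_tensorHom, tensorHom_id] at h7
    have h7' : exchange T T' U ≫ G'.e N ▷ (T ⊗ U) = T ◁ (G'.e N ▷ U) ≫ exchange T T' U := by
      rw [h7]; simp
    have h8 : ∀ f : W ⟶ (T ⊗ T') ⊗ U, f ≫ (G.e N ⊗ₘ G'.e N) ▷ U =
        ((((f ≫ (α_ T T' U).hom) ≫ G.e N ▷ (T' ⊗ U)) ≫ exchange T T' U) ≫
          G'.e N ▷ (T ⊗ U)) ≫ exchange T' T U ≫ (α_ T T' U).inv := by
      intro f
      simp only [Category.assoc]
      rw [reassoc_of% h7', ← Category.assoc (exchange T T' U), exchange_exchange]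
      simp [MonoidalCategory.tensorHom_def]
    rw [h8, h8, h4]

omit [SymmetricCategory D] in
lemma hom_ext (G : Grading T) {W : D} {f g : W ⟶ T} (N : ℕ) (hf : f ≫ G.e N = f)
    (hg : g ≫ G.e N = g) (h : ∀ k, f ≫ G.π k = g ≫ G.π k) : f = g := by
  have h1 := G.detect N (f := f ≫ (ρ_ T).inv) (g := g ≫ (ρ_ T).inv) (by
    intro k
    simp only [Category.assoc, ← rightUnitor_inv_naturality]
    rw [reassoc_of% h k])
  simp only [Category.assoc, ← rightUnitor_inv_naturality] at h1
  rw [reassoc_of% hf, reassoc_of% hg] at h1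
  exact (cancel_mono _).1 h1

/-- Morphisms which are compatible with the truncations. -/
def IsFiltered (G : Grading T) (G' : Grading T') (f : T ⟶ T') : Prop :=
  ∀ N, G.e N ≫ f ≫ G'.e N = G.e N ≫ f

namespace IsFiltered

variable {G : Grading T} {G' : Grading T'} {G'' : Grading T''}

omit [SymmetricCategory D] in
lemma of_comm {f : T ⟶ T'} (h : ∀ N, G.e N ≫ f = f ≫ G'.e N) : IsFiltered G G' f := fun N => by
  rw [reassoc_of% h, h, G'.e_comp_e]

omit [SymmetricCategory D] in
lemma id : IsFiltered G G (𝟙 T) := of_comm fun N => by simp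

omit [SymmetricCategory D] in
lemma comp {f : T ⟶ T'} {g : T' ⟶ T''} (hf : IsFiltered G G' f) (hg : IsFiltered G' G'' g) :
    IsFiltered G G'' (f ≫ g) := fun N => by
  have h1 : G.e N ≫ f ≫ g = G.e N ≫ f ≫ G'.e N ≫ g := by
    rw [← reassoc_of% hf N]
  calc G.e N ≫ (f ≫ g) ≫ G''.e N = (G.e N ≫ f ≫ g) ≫ G''.e N := by simp
    _ = G.e N ≫ f ≫ G'.e N ≫ g ≫ G''.e N := by rw [h1]; simp
    _ = _ := by rw [hg N, ← h1]

lemma tensorHom {T₁ T₁' : D} {G₁ : Grading T₁} {G₁' : Grading T₁'} {f : T ⟶ T'} {g : T₁ ⟶ T₁'}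
    (hf : IsFiltered G G' f) (hg : IsFiltered G₁ G₁' g) :
    IsFiltered (G.tensor G₁) (G'.tensor G₁') (f ⊗ₘ g) := fun N => by
  change (G.e N ⊗ₘ G₁.e N) ≫ (f ⊗ₘ g) ≫ (G'.e N ⊗ₘ G₁'.e N) = (G.e N ⊗ₘ G₁.e N) ≫ (f ⊗ₘ g)
  simp only [tensorHom_comp_tensorHom]
  rw [hf N, hg N]

lemma whiskerRight {T₁ : D} {f : T ⟶ T'} (hf : IsFiltered G G' f) (G₁ : Grading T₁) :
    IsFiltered (G.tensor G₁) (G'.tensor G₁) (f ▷ T₁) := by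
  rw [← tensorHom_id]
  exact hf.tensorHom id

lemma whiskerLeft {T₁ : D} {f : T ⟶ T'} (hf : IsFiltered G G' f) (G₁ : Grading T₁) :
    IsFiltered (G₁.tensor G) (G₁.tensor G') (T₁ ◁ f) := by
  rw [← id_tensorHom]
  exact id.tensorHom hf

lemma associator : IsFiltered ((G.tensor G').tensor G'') (G.tensor (G'.tensor G''))
    (α_ T T' T'').hom :=
  of_comm fun N => associator_naturality (G.e N) (G'.e N) (G''.e N)

lemma braiding : IsFiltered (G.tensor G') (G'.tensor G) (β_ T T').hom :=
  of_comm fun N => BraidedCategory.braiding_naturality (G.e N) (G'.e N)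

end IsFiltered

end Grading

end Gradings

/-! ### The grading of `S^c(X)`. -/

section SymmetricGrading

variable {D : Type u} [Category.{v} D] [MonoidalCategory D] [SymmetricCategory D]
  [HasZeroObject D] [HasZeroMorphisms D] [HasLimits D] [HasColimits D]

/-- The inclusion of a summand of `S^c(X)`. -/
noncomputable abbrev symι (X : D) (n : ℕ) : symInv X n ⟶ symCofree X :=
  Limits.Sigma.ι (symInv X) n

/-- The projection to a summand of `S^c(X)`. -/
noncomputable def symProj (X : D) (n : ℕ) : symCofree X ⟶ symInv X n :=
  Limits.Sigma.desc fun m => if h : m = n then eqToHom (congrArg (symInv X) h) else 0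

/-- The projection of `S^c(X)` to the sum of the summands of index `< N`. -/
noncomputable def symTrunc (X : D) (N : ℕ) : symCofree X ⟶ symCofree X :=
  Limits.Sigma.desc fun m => if m < N then symι X m else 0

/-- The functoriality of `S^c(X)`. -/
noncomputable abbrev symCofreeMap {X Y : D} (f : X ⟶ Y) : symCofree X ⟶ symCofree Y :=
  Limits.Sigma.map fun n => symInvMap f n

variable {X : D}

omit [HasZeroObject D] in
lemma symι_symProj (n : ℕ) : symι X n ≫ symProj X n = 𝟙 _ := by
  rw [symProj, Limits.Sigma.ι_desc, dif_pos rfl, eqToHom_refl]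

omit [HasZeroObject D] in
lemma symι_symProj_of_ne {m n : ℕ} (h : m ≠ n) : symι X m ≫ symProj X n = 0 := by
  rw [symProj, Limits.Sigma.ι_desc, dif_neg h]

omit [HasZeroObject D] in
lemma symι_symTrunc {n N : ℕ} (h : n < N) : symι X n ≫ symTrunc X N = symι X n := by
  rw [symTrunc, Limits.Sigma.ι_desc, if_pos h]

omit [HasZeroObject D] in
lemma symι_symTrunc_of_le {n N : ℕ} (h : N ≤ n) : symι X n ≫ symTrunc X N = 0 := by
  rw [symTrunc, Limits.Sigma.ι_desc, if_neg (by omega)]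

omit [HasZeroObject D] [HasZeroMorphisms D] in
lemma symCofree_hom_ext {V : D} {f g : symCofree X ⟶ V} (h : ∀ n, symι X n ≫ f = symι X n ≫ g) :
    f = g :=
  Limits.Sigma.hom_ext _ _ h

omit [HasZeroObject D] [HasZeroMorphisms D] in
lemma symι_symCofreeMap {Y : D} (f : X ⟶ Y) (n : ℕ) :
    symι X n ≫ symCofreeMap f = symInvMap f n ≫ symι Y n :=
  Limits.Sigma.ι_map _ _

omit [HasZeroObject D] in
lemma symCofreeMap_symProj {Y : D} (f : X ⟶ Y) (n : ℕ) :
    symCofreeMap f ≫ symProj Y n = symProj X n ≫ symInvMap f n := by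
  refine symCofree_hom_ext fun m => ?_
  rw [← Category.assoc, symι_symCofreeMap, ← Category.assoc (symι X m), Category.assoc]
  by_cases h : m = n
  · subst h
    rw [symι_symProj, symι_symProj, Category.comp_id, Category.id_comp]
  · rw [symι_symProj_of_ne h, symι_symProj_of_ne h, comp_zero, zero_comp]

omit [HasZeroObject D] in
lemma symCofreeMap_symTrunc {Y : D} (f : X ⟶ Y) (N : ℕ) :
    symTrunc X N ≫ symCofreeMap f = symCofreeMap f ≫ symTrunc Y N := by
  refine symCofree_hom_ext fun m => ?_
  rw [← Category.assoc, ← Category.assoc (symι X m) (symCofreeMap f), symι_symCofreeMap,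
    Category.assoc (symInvMap f m)]
  by_cases h : m < N
  · rw [symι_symTrunc h, symι_symTrunc h, symι_symCofreeMap]
  · rw [symι_symTrunc_of_le (by omega), symι_symTrunc_of_le (by omega), comp_zero, zero_comp]

variable [CofreeFriendly D]

variable (X) in
/-- The grading of `S^c(X)`. -/
noncomputable def symGrading : Grading (symCofree X) where
  Index := ℕ
  comp := symInv X
  π := symProj X
  e := symTrunc X
  e_comp_e N := by
    refine symCofree_hom_ext fun n => ?_
    by_cases h : n < N
    · rw [← Category.assoc, symι_symTrunc h, symι_symTrunc h]
    · rw [← Category.assoc, symι_symTrunc_of_le (by omega), zero_comp]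
  detect N {U W} f g h := by
    -- The truncation factors through the finite sum of the summands of index `< N`. This is a
    -- biproduct, hence remains one after tensoring with `U`, and is then detected by its
    -- projections.
    let A : Fin N → D := fun j => symInv X j
    let r : symCofree X ⟶ ∐ A := Limits.Sigma.desc fun n =>
      if h : n < N then Limits.Sigma.ι A ⟨n, h⟩ else 0
    let s : ∐ A ⟶ symCofree X := Limits.Sigma.desc fun j => symι X j
    have hs : ∀ j, Limits.Sigma.ι A j ≫ s = symι X j := fun j => Limits.Sigma.ι_desc _ _
    have hr : ∀ {n} (h : n < N), symι X n ≫ r = Limits.Sigma.ι A ⟨n, h⟩ := fun {n} h => by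
      simp only [r]; rw [Limits.Sigma.ι_desc, dif_pos h]
    have hr' : ∀ {n} (h : N ≤ n), symι X n ≫ r = 0 := fun {n} h => by
      simp only [r]; rw [Limits.Sigma.ι_desc, dif_neg (by omega)]
    have hrs : r ≫ s = symTrunc X N := symCofree_hom_ext fun n => by
      by_cases h : n < N
      · rw [← Category.assoc, hr h, hs, symι_symTrunc h]
      · rw [← Category.assoc, hr' (by omega), symι_symTrunc_of_le (by omega), zero_comp]
    have hrp : ∀ j : Fin N, r ≫ s ≫ symProj X j = symProj X j := fun j =>
      symCofree_hom_ext fun n => by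
        by_cases h : n < N
        · rw [← Category.assoc, hr h, ← Category.assoc, hs]
        · rw [← Category.assoc, hr' (by omega), zero_comp, symι_symProj_of_ne (by omega)]
    have hB : IsBiprod (fun j => Limits.Sigma.ι A j) (fun j => s ≫ symProj X j) :=
      { ι_π_self := fun j => by rw [← Category.assoc, hs]; exact symι_symProj _
        ι_π_ne := fun {j k} hjk => by
          rw [← Category.assoc, hs]
          exact symι_symProj_of_ne (fun h => hjk (Fin.ext h))
        isColimit := ⟨coproductIsCoproduct A⟩ }
    have h1 : f ≫ r ▷ U = g ≫ r ▷ U := (hB.whiskerRight U).hom_ext fun j => by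
      rw [Category.assoc, Category.assoc, ← comp_whiskerRight, hrp]
      exact h j
    rw [← hrs, comp_whiskerRight, reassoc_of% h1]

/-- Filtered morphisms out of `S^c(X)` are determined by their components. -/
lemma symCofree_hom_ext_of_isFiltered {T : D} {G : Grading T} {f g : symCofree X ⟶ T}
    (hf : (symGrading X).IsFiltered G f) (hg : (symGrading X).IsFiltered G g)
    (h : ∀ k, f ≫ G.π k = g ≫ G.π k) : f = g := by
  -- Truncation at `N` keeps the indices strictly below `N`, so the summand of index `n` is fixed by
  -- truncation at `n + 1`.
  refine symCofree_hom_ext fun n => G.hom_ext (n + 1) ?_ ?_ fun k => ?_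
  · have := congrArg (symι X n ≫ ·) (hf (n + 1))
    simp only [symGrading] at this
    rwa [← Category.assoc, ← Category.assoc (symι X n) (symTrunc X (n + 1)),
      symι_symTrunc (Nat.lt_succ_self n), ← Category.assoc] at this
  · have := congrArg (symι X n ≫ ·) (hg (n + 1))
    simp only [symGrading] at this
    rwa [← Category.assoc, ← Category.assoc (symι X n) (symTrunc X (n + 1)),
      symι_symTrunc (Nat.lt_succ_self n), ← Category.assoc] at this
  · rw [Category.assoc, Category.assoc, h]

lemma isFiltered_symCofreeMap {Y : D} (f : X ⟶ Y) :
    (symGrading X).IsFiltered (symGrading Y) (symCofreeMap f) :=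
  Grading.IsFiltered.of_comm fun N => symCofreeMap_symTrunc f N

end SymmetricGrading

/-! ### The comparison `S^c(X × Y) ⟶ S^c(X) ⊗ S^c(Y)` and its inverse. -/

section CofreeComparison

variable {D : Type u} [Category.{v} D] [MonoidalCategory D] [SymmetricCategory D]
  [HasZeroObject D] [HasZeroMorphisms D] [HasLimits D] [HasColimits D] [CofreeFriendly D]

lemma comp_sumHom {J : Type} [Finite J] {U W V : D} (f : U ⟶ W) (g : J → (W ⟶ V)) :
    f ≫ sumHom g = sumHom fun j => f ≫ g j := by
  have h1 : sumToProd (fun _ : J => U) ≫ Limits.Pi.map (fun _ => f) =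
      Limits.Sigma.map (fun _ => f) ≫ sumToProd (fun _ : J => W) := by
    refine Limits.Sigma.hom_ext _ _ fun i => Limits.Pi.hom_ext _ _ fun j => ?_
    simp only [Category.assoc, Limits.Pi.map_π, sumToProd, Limits.Sigma.ι_desc_assoc,
      Limits.Sigma.ι_map_assoc, Limits.Sigma.ι_desc, Pi.lift_π_assoc, Pi.lift_π]
    split_ifs with hij
    · subst hij; simp
    · simp
  have h2 : f ≫ Pi.lift (fun _ : J => 𝟙 W) =
      Pi.lift (fun _ : J => 𝟙 U) ≫ Limits.Pi.map (fun _ => f) :=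
    Limits.Pi.hom_ext _ _ fun j => by simp
  have h3 : Limits.Pi.map (fun _ => f) ≫ inv (sumToProd fun _ : J => W) =
      inv (sumToProd fun _ : J => U) ≫ Limits.Sigma.map (fun _ => f) := by
    rw [IsIso.comp_inv_eq, Category.assoc, ← h1, IsIso.inv_hom_id_assoc]
  have h4 : Limits.Sigma.map (fun _ => f) ≫ Limits.Sigma.desc g =
      Limits.Sigma.desc fun j => f ≫ g j :=
    Limits.Sigma.hom_ext _ _ fun j => by simp
  rw [sumHom, sumHom, reassoc_of% h2, reassoc_of% h3, h4]

omit [HasZeroObject D] [CofreeFriendly D] in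
lemma isBiprod_sym (X : D) : IsBiprod (symι X) (symProj X) where
  ι_π_self n := symι_symProj n
  ι_π_ne h := symι_symProj_of_ne h
  isColimit := ⟨coproductIsCoproduct _⟩

lemma symCofree_tensor_hom_ext {X Y V : D} {f g : symCofree X ⊗ symCofree Y ⟶ V}
    (h : ∀ a b, (symι X a ⊗ₘ symι Y b) ≫ f = (symι X a ⊗ₘ symι Y b) ≫ g) : f = g :=
  ((isBiprod_sym X).whiskerRight _).hom_ext' fun a =>
    ((isBiprod_sym Y).whiskerLeft _).hom_ext' fun b => by
      simpa only [MonoidalCategory.tensorHom_def', Category.assoc] using h a b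

lemma exists_symCofree_tensor_desc {X Y V : D} (k : ∀ a b, symInv X a ⊗ symInv Y b ⟶ V) :
    ∃ m : symCofree X ⊗ symCofree Y ⟶ V, ∀ a b, (symι X a ⊗ₘ symι Y b) ≫ m = k a b := by
  let m' : ∀ a, symInv X a ⊗ symCofree Y ⟶ V := fun a =>
    Cofan.IsColimit.desc ((isBiprod_sym Y).whiskerLeft (symInv X a)).isColimit.some (k a)
  refine ⟨Cofan.IsColimit.desc ((isBiprod_sym X).whiskerRight (symCofree Y)).isColimit.some m',
    fun a b => ?_⟩
  rw [MonoidalCategory.tensorHom_def', Category.assoc]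
  refine (congrArg (_ ◁ _ ≫ ·) (Cofan.IsColimit.fac
    ((isBiprod_sym X).whiskerRight (symCofree Y)).isColimit.some m' a)).trans ?_
  exact Cofan.IsColimit.fac ((isBiprod_sym Y).whiskerLeft (symInv X a)).isColimit.some (k a) b

variable [PermutationFriendly D]

/-- The comparison `S^c(Z) ⟶ S^c(X) ⊗ S^c(Y)` induced by `p : Z ⟶ X` and `q : Z ⟶ Y`. -/
noncomputable def symDelta {X Y Z : D} (p : Z ⟶ X) (q : Z ⟶ Y) :
    symCofree Z ⟶ symCofree X ⊗ symCofree Y :=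
  Limits.Sigma.desc fun n => sumHom fun x : Finset.HasAntidiagonal.antidiagonal n =>
    symSplit p q x.1.1 x.1.2 n
      ((Nat.add_comm _ _).trans (Finset.HasAntidiagonal.mem_antidiagonal.1 x.2)) ≫
        (symι X x.1.1 ⊗ₘ symι Y x.1.2)

variable {X Y Z : D} (p : Z ⟶ X) (q : Z ⟶ Y)

lemma symι_symDelta (n : ℕ) : symι Z n ≫ symDelta p q =
    sumHom fun x : Finset.HasAntidiagonal.antidiagonal n =>
      symSplit p q x.1.1 x.1.2 n
        ((Nat.add_comm _ _).trans (Finset.HasAntidiagonal.mem_antidiagonal.1 x.2)) ≫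
          (symι X x.1.1 ⊗ₘ symι Y x.1.2) :=
  Limits.Sigma.ι_desc _ _

/-- As the comparison is filtered, it is characterised by these components; its naturality,
symmetry, coassociativity and counit laws are all checked on them. -/
lemma symDelta_symProj {a b n : ℕ} (h : b + a = n) :
    symDelta p q ≫ (symProj X a ⊗ₘ symProj Y b) = symProj Z n ≫ symSplit p q a b n h := by
  have h0 : ∀ {a' b' : ℕ}, (a', b') ≠ (a, b) →
      (symι X a' ⊗ₘ symι Y b') ≫ (symProj X a ⊗ₘ symProj Y b) = 0 := by
    intro a' b' hne
    rw [tensorHom_comp_tensorHom]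
    by_cases ha : a' = a
    · rw [symι_symProj_of_ne (m := b') (fun hb => hne (by rw [ha, hb])), tensor_tensorHom_zero]
    · rw [symι_symProj_of_ne ha, tensor_zero_tensorHom]
  refine symCofree_hom_ext fun m => ?_
  rw [← Category.assoc, ← Category.assoc, symι_symDelta, sumHom_comp]
  by_cases hm : m = n
  · subst hm
    rw [symι_symProj, Category.id_comp, sumHom_eq_single _
      ⟨(a, b), Finset.HasAntidiagonal.mem_antidiagonal.2 ((Nat.add_comm _ _).trans h)⟩]
    · rw [Category.assoc, tensorHom_comp_tensorHom, symι_symProj, symι_symProj, id_tensorHom_id,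
        Category.comp_id]
    · intro x hx
      rw [Category.assoc, h0 (fun h' => hx (Subtype.ext h')), comp_zero]
  · rw [symι_symProj_of_ne hm, zero_comp]
    refine sumHom_eq_zero _ fun x => ?_
    have hx := Finset.HasAntidiagonal.mem_antidiagonal.1 x.2
    rw [Category.assoc, h0 (fun h' => ?_), comp_zero]
    rw [Prod.mk.injEq] at h'
    omega

/-- If `a + b = n < N`, then `a` and `b` are both less than `N`. -/
lemma isFiltered_symDelta :
    (symGrading Z).IsFiltered ((symGrading X).tensor (symGrading Y)) (symDelta p q) := by
  intro N
  change symTrunc Z N ≫ symDelta p q ≫ (symTrunc X N ⊗ₘ symTrunc Y N) =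
    symTrunc Z N ≫ symDelta p q
  refine symCofree_hom_ext fun n => ?_
  rw [← Category.assoc, ← Category.assoc (symι Z n)]
  by_cases h : n < N
  · rw [symι_symTrunc h, ← Category.assoc, symι_symDelta, sumHom_comp]
    refine congrArg sumHom (funext fun x => ?_)
    have hx := Finset.HasAntidiagonal.mem_antidiagonal.1 x.2
    rw [Category.assoc, tensorHom_comp_tensorHom, symι_symTrunc (by omega),
      symι_symTrunc (by omega)]
  · rw [symι_symTrunc_of_le (by omega), zero_comp, zero_comp]

lemma symDelta_naturality {X' Y' Z' : D} {p' : Z' ⟶ X'} {q' : Z' ⟶ Y'} {h : Z ⟶ Z'} {f : X ⟶ X'}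
    {g : Y ⟶ Y'} (hf : h ≫ p' = p ≫ f) (hg : h ≫ q' = q ≫ g) :
    symCofreeMap h ≫ symDelta p' q' = symDelta p q ≫ (symCofreeMap f ⊗ₘ symCofreeMap g) := by
  refine symCofree_hom_ext_of_isFiltered (G := (symGrading X').tensor (symGrading Y'))
    ((isFiltered_symCofreeMap h).comp (isFiltered_symDelta p' q'))
    ((isFiltered_symDelta p q).comp
      ((isFiltered_symCofreeMap f).tensorHom (isFiltered_symCofreeMap g))) ?_
  rintro ⟨(a : ℕ), (b : ℕ)⟩
  change (symCofreeMap h ≫ symDelta p' q') ≫ (symProj X' a ⊗ₘ symProj Y' b) =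
    (symDelta p q ≫ (symCofreeMap f ⊗ₘ symCofreeMap g)) ≫ (symProj X' a ⊗ₘ symProj Y' b)
  rw [Category.assoc, Category.assoc, symDelta_symProj p' q' rfl, tensorHom_comp_tensorHom,
    symCofreeMap_symProj, symCofreeMap_symProj, ← tensorHom_comp_tensorHom, ← Category.assoc,
    symCofreeMap_symProj, ← Category.assoc (symDelta p q), symDelta_symProj p q rfl,
    Category.assoc, Category.assoc, symInvMap_symSplit, symSplit_symInvMap, hf, hg]

lemma symDelta_braiding :
    symDelta p q ≫ (β_ (symCofree X) (symCofree Y)).hom = symDelta q p := by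
  refine symCofree_hom_ext_of_isFiltered (G := (symGrading Y).tensor (symGrading X))
    ((isFiltered_symDelta p q).comp Grading.IsFiltered.braiding) (isFiltered_symDelta q p) ?_
  rintro ⟨(a : ℕ), (b : ℕ)⟩
  change (symDelta p q ≫ (β_ (symCofree X) (symCofree Y)).hom) ≫ (symProj Y a ⊗ₘ symProj X b) =
    symDelta q p ≫ (symProj Y a ⊗ₘ symProj X b)
  rw [Category.assoc, ← BraidedCategory.braiding_naturality, ← Category.assoc,
    symDelta_symProj p q (Nat.add_comm a b), symDelta_symProj q p rfl, Category.assoc,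
    symSplit_braiding]

/-- Coassociativity of the comparison. -/
lemma symDelta_assoc {T XY YZ : D} (P : T ⟶ XY) (Q : T ⟶ Z) (p : XY ⟶ X) (q : XY ⟶ Y)
    (A : T ⟶ X) (B : T ⟶ YZ) (r : YZ ⟶ Y) (s : YZ ⟶ Z) (hA : A = P ≫ p) (hB : B ≫ r = P ≫ q)
    (hB' : B ≫ s = Q) :
    symDelta P Q ≫ symDelta p q ▷ symCofree Z ≫
      (α_ (symCofree X) (symCofree Y) (symCofree Z)).hom =
    symDelta A B ≫ symCofree X ◁ symDelta r s := by
  refine symCofree_hom_ext_of_isFiltered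
    (G := (symGrading X).tensor ((symGrading Y).tensor (symGrading Z)))
    ((isFiltered_symDelta P Q).comp
      (((isFiltered_symDelta p q).whiskerRight (symGrading Z)).comp Grading.IsFiltered.associator))
    ((isFiltered_symDelta A B).comp
      ((isFiltered_symDelta r s).whiskerLeft (symGrading X))) ?_
  rintro ⟨(a : ℕ), (b : ℕ), (c : ℕ)⟩
  change (symDelta P Q ≫ symDelta p q ▷ symCofree Z ≫
      (α_ (symCofree X) (symCofree Y) (symCofree Z)).hom) ≫
        (symProj X a ⊗ₘ (symProj Y b ⊗ₘ symProj Z c)) =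
    (symDelta A B ≫ symCofree X ◁ symDelta r s) ≫ (symProj X a ⊗ₘ (symProj Y b ⊗ₘ symProj Z c))
  have h1 : symDelta p q ▷ symCofree Z ≫ ((symProj X a ⊗ₘ symProj Y b) ⊗ₘ symProj Z c) =
      (symProj XY (b + a) ⊗ₘ symProj Z c) ≫ symSplit p q a b (b + a) rfl ▷ symInv Z c := by
    rw [← tensorHom_id, ← tensorHom_id, tensorHom_comp_tensorHom, tensorHom_comp_tensorHom,
      symDelta_symProj p q rfl, Category.id_comp, Category.comp_id]
  have h2 : symCofree X ◁ symDelta r s ≫ (symProj X a ⊗ₘ (symProj Y b ⊗ₘ symProj Z c)) =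
      (symProj X a ⊗ₘ symProj YZ (c + b)) ≫ symInv X a ◁ symSplit r s b c (c + b) rfl := by
    rw [← id_tensorHom, ← id_tensorHom, tensorHom_comp_tensorHom, tensorHom_comp_tensorHom,
      symDelta_symProj r s rfl, Category.id_comp, Category.comp_id]
  rw [Category.assoc, Category.assoc, Category.assoc, ← associator_naturality, reassoc_of% h1, h2,
    ← Category.assoc, symDelta_symProj P Q rfl, ← Category.assoc (symDelta A B),
    symDelta_symProj A B (Nat.add_assoc c b a), Category.assoc, Category.assoc,
    symSplit_assoc P Q p q A B r s hA hB hB']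

omit [PermutationFriendly D] in
variable (Z) in
/-- The projection of `S^c(Z)` to the unit. -/
noncomputable def symEta : symCofree Z ⟶ 𝟙_ D := symProj Z 0 ≫ symIncl Z 0

lemma symDelta_symEta_left :
    symDelta p q ≫ symEta X ▷ symCofree Y ≫ (λ_ (symCofree Y)).hom = symCofreeMap q := by
  have hl : ((Grading.trivial (𝟙_ D)).tensor (symGrading Y)).IsFiltered (symGrading Y)
      (λ_ (symCofree Y)).hom := Grading.IsFiltered.of_comm fun N => by
    change (𝟙 (𝟙_ D) ⊗ₘ symTrunc Y N) ≫ (λ_ (symCofree Y)).hom =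
      (λ_ (symCofree Y)).hom ≫ symTrunc Y N
    simp
  have he : (symGrading X).IsFiltered (Grading.trivial (𝟙_ D)) (symEta X) := fun N =>
    congrArg (symTrunc X N ≫ ·) (Category.comp_id _)
  refine symCofree_hom_ext_of_isFiltered (G := symGrading Y)
    ((isFiltered_symDelta p q).comp ((he.whiskerRight (symGrading Y)).comp hl))
    (isFiltered_symCofreeMap q) fun (n : ℕ) => ?_
  change (symDelta p q ≫ symEta X ▷ symCofree Y ≫ (λ_ (symCofree Y)).hom) ≫ symProj Y n =
    symCofreeMap q ≫ symProj Y n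
  have h1 : symEta X ▷ symCofree Y ≫ (λ_ (symCofree Y)).hom ≫ symProj Y n =
      (symProj X 0 ⊗ₘ symProj Y n) ≫ symIncl X 0 ▷ symInv Y n ≫ (λ_ (symInv Y n)).hom := by
    have key : ∀ {P Q R V : D} (f : P ⟶ Q) (g : Q ⟶ 𝟙_ D) (h : R ⟶ V),
        (f ≫ g) ▷ R ≫ (λ_ R).hom ≫ h = (f ⊗ₘ h) ≫ g ▷ V ≫ (λ_ V).hom := by
      intro P Q R V f g h
      simp [MonoidalCategory.tensorHom_def, whisker_exchange_assoc]
    exact key _ _ _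
  rw [Category.assoc, Category.assoc, h1, ← Category.assoc, symDelta_symProj p q rfl,
    Category.assoc, symCofreeMap_symProj]
  exact congrArg (symProj Z n ≫ ·) (symSplit_left_zero p q n)

lemma symDelta_symEta_right :
    symDelta p q ≫ symCofree X ◁ symEta Y ≫ (ρ_ (symCofree X)).hom = symCofreeMap p := by
  rw [← symDelta_symEta_left q p, ← symDelta_braiding p q, Category.assoc,
    ← BraidedCategory.braiding_naturality_right_assoc, braiding_leftUnitor]

/-- The inverse is assembled from the summand inclusions of `exists_symShuffle`, as `⊗` preserves
the sums. One composite is compared with the identity through the components of `symInv Z n`, the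
other on each `symInv X a ⊗ symInv Y b`. -/
lemma isIso_symDelta (hpq : IsBinProd p q) : IsIso (symDelta p q) := by
  choose e he he' using fun a b => exists_symShuffle hpq a b (b + a) rfl
  obtain ⟨m, hm⟩ := exists_symCofree_tensor_desc (V := symCofree Z)
    fun a b => e a b ≫ symι Z (b + a)
  -- A restatement with variable `n`, so that it applies to all pairs in the antidiagonal of `n`
  -- without transports.
  have hm' : ∀ a b n (h : b + a = n), ∃ e : symInv X a ⊗ symInv Y b ⟶ symInv Z n,
      (symι X a ⊗ₘ symι Y b) ≫ m = e ≫ symι Z n ∧ e ≫ symSplit p q a b n h = 𝟙 _ ∧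
        ∀ a' b' (h' : b' + a' = n), (a', b') ≠ (a, b) → e ≫ symSplit p q a' b' n h' = 0 := by
    intro a b n h
    subst h
    exact ⟨e a b, hm a b, he a b, fun a' b' h hne =>
      he' a b a' b' h fun h' => hne (by rw [Prod.mk.injEq]; omega)⟩
  refine ⟨m, symCofree_hom_ext fun n => ?_, symCofree_tensor_hom_ext fun a b => ?_⟩
  · choose e' h1 h2 h3 using fun x : Finset.HasAntidiagonal.antidiagonal n => hm' x.1.1 x.1.2 n
      ((Nat.add_comm _ _).trans (Finset.HasAntidiagonal.mem_antidiagonal.1 x.2))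
    rw [← Category.assoc, symι_symDelta, sumHom_comp]
    simp only [Category.assoc, h1]
    have h4 := sumHom_comp (fun x : Finset.HasAntidiagonal.antidiagonal n =>
      symSplit p q x.1.1 x.1.2 n
        ((Nat.add_comm _ _).trans (Finset.HasAntidiagonal.mem_antidiagonal.1 x.2)) ≫ e' x)
      (symι Z n)
    simp only [Category.assoc] at h4
    rw [← h4, Category.comp_id]
    refine (congrArg (· ≫ symι Z n) ?_).trans (Category.id_comp _)
    refine symInv_hom_ext_of_symSplit hpq fun a b hab => ?_
    rw [sumHom_comp, Category.id_comp, sumHom_eq_single _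
      ⟨(a, b), Finset.HasAntidiagonal.mem_antidiagonal.2 ((Nat.add_comm _ _).trans hab)⟩]
    · rw [Category.assoc, h2, Category.comp_id]
    · intro x hx
      rw [Category.assoc, h3 _ _ _ _ (fun h => hx (Subtype.ext h.symm)), comp_zero]
  · obtain ⟨e', h1, h2, h3⟩ := hm' a b (b + a) rfl
    rw [← Category.assoc, h1, Category.assoc, symι_symDelta, comp_sumHom, sumHom_eq_single _
      ⟨(a, b), Finset.HasAntidiagonal.mem_antidiagonal.2 (Nat.add_comm a b)⟩]
    · rw [← Category.assoc, h2, Category.id_comp, Category.comp_id]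
    · intro x hx
      rw [← Category.assoc, h3 _ _ _ (fun h => hx (Subtype.ext h)), zero_comp]

omit [HasZeroObject D] [CofreeFriendly D] [PermutationFriendly D] in
lemma symCofreeMap_symEta (f : X ⟶ Y) : symCofreeMap f ≫ symEta Y = symEta X := by
  have h : symInvMap f 0 ≫ symIncl Y 0 = symIncl X 0 :=
    (symInvMap_symIncl f 0).trans (Category.comp_id _)
  refine (Category.assoc _ _ _).symm.trans ?_
  refine (congrArg (· ≫ symIncl Y 0) (symCofreeMap_symProj f 0)).trans ?_
  exact (Category.assoc _ _ _).trans (congrArg (symProj X 0 ≫ ·) h)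

omit [HasZeroObject D] [CofreeFriendly D] [PermutationFriendly D] in
lemma symEta_eq_symCounit : symEta X = symCounit X := by
  refine symCofree_hom_ext fun n => ?_
  rw [symCounit, Limits.Sigma.ι_desc]
  refine (Category.assoc _ _ _).symm.trans ?_
  cases n with
  | zero => exact (congrArg (· ≫ symIncl X 0) (symι_symProj 0)).trans (Category.id_comp _)
  | succ n =>
    exact (congrArg (· ≫ symIncl X 0) (symι_symProj_of_ne (Nat.succ_ne_zero n))).trans zero_comp

omit [PermutationFriendly D] in
-- All positive tensor powers of a zero object vanish, so only the summand of index `0` survives,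
-- and `Σ_0` acts trivially on the unit.
lemma isIso_symEta (h : 𝟙 Z = 0) : IsIso (symEta Z) := by
  have h1 : IsIso (symIncl Z 0) := by
    refine ⟨fixedPoints.lift (𝟙 _) fun σ => ?_, fixedPoints.hom_ext ?_, fixedPoints.lift_ι _ _⟩
    · rw [Subsingleton.elim σ 1, permMap_one, Category.comp_id]
    · rw [Category.assoc, fixedPoints.lift_ι, Category.comp_id, Category.id_comp]
  have h2 : IsIso (symProj Z 0) := by
    refine ⟨symι Z 0, symCofree_hom_ext fun n => ?_, symι_symProj 0⟩
    rw [← Category.assoc, Category.comp_id]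
    cases n with
    | zero => rw [symι_symProj, Category.id_comp]
    | succ n =>
      have h3 : 𝟙 (tpow Z (n + 1)) = 0 := by
        change 𝟙 (Z ⊗ tpow Z n) = 0
        rw [← id_tensorHom_id, h, tensor_zero_tensorHom]
      have h4 : 𝟙 (symInv Z (n + 1)) = 0 := fixedPoints.hom_ext (by
        rw [Category.id_comp, zero_comp, ← Category.comp_id (fixedPoints.ι _), h3, comp_zero])
      rw [symι_symProj_of_ne (Nat.succ_ne_zero n), zero_comp, ← Category.id_comp (symι Z (n + 1)),
        h4, zero_comp]
  exact @IsIso.comp_isIso _ _ _ _ _ (symProj Z 0) (symIncl Z 0) h2 h1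

/-- Through this identification, the properties of the comparison become properties of the
prescribed comultiplication. -/
lemma symDelta_id : symDelta (𝟙 X) (𝟙 X) = symComul X := by
  have key : ∀ (a b n : ℕ) (h : b + a = n) (h' : symInv X n = symInv X (b + a)),
      symSplit (𝟙 X) (𝟙 X) a b n h = eqToHom h' ≫ resMap X a b ≫ inv (tensorInv X a b) := by
    intro a b n h h'
    subst h
    rw [eqToHom_refl, Category.id_comp, IsIso.eq_comp_inv]
    refine fixedPoints.hom_ext ?_
    rw [Category.assoc, tensorInv_ι, symSplit_symIncl, tpowSplit_id]
    exact (fixedPoints.lift_ι _ _).symm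
  refine symCofree_hom_ext fun n => ?_
  rw [symι_symDelta, symComul, Limits.Sigma.ι_desc]
  -- On each summand, `symComul` is by definition a `sumHom`, so only its terms have to be compared.
  refine congrArg sumHom (funext fun x => ?_)
  have hx := Finset.HasAntidiagonal.mem_antidiagonal.1 x.2
  rw [symComulComponent, key _ _ _ _ (congrArg (symInv X) (by omega))]
  simp only [Category.assoc]

end CofreeComparison

/-! ### `S^c` as an oplax monoidal functor on a cartesian category. -/

section CofreeMonoidal

open CartesianMonoidalCategory

variable {D : Type u} [Category.{v} D] [MonoidalCategory D] [SymmetricCategory D]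
  [HasZeroObject D] [HasZeroMorphisms D] [HasLimits D] [HasColimits D] [CofreeFriendly D]
  [PermutationFriendly D] {C : Type u} [Category.{v} C] [CartesianMonoidalCategory C] (U : C ⥤ D)

lemma map_symDelta {X Y X' Y' : C} {h : X ⊗ Y ⟶ X' ⊗ Y'} {f : X ⟶ X'} {g : Y ⟶ Y'}
    (hf : h ≫ fst X' Y' = fst X Y ≫ f) (hg : h ≫ snd X' Y' = snd X Y ≫ g) :
    symCofreeMap (U.map h) ≫ symDelta (U.map (fst X' Y')) (U.map (snd X' Y')) =
      symDelta (U.map (fst X Y)) (U.map (snd X Y)) ≫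
        (symCofreeMap (U.map f) ⊗ₘ symCofreeMap (U.map g)) :=
  symDelta_naturality _ _ (by rw [← U.map_comp, hf, U.map_comp])
    (by rw [← U.map_comp, hg, U.map_comp])

omit [HasZeroObject D] [HasZeroMorphisms D] [CofreeFriendly D] [PermutationFriendly D] in
lemma symCofreeMap_id (X : D) : symCofreeMap (𝟙 X) = 𝟙 (symCofree X) :=
  (symCofreeFunctor D).map_id X

lemma symCofreeMap_symDelta {X Y Z Z' : D} (h : Z' ⟶ Z) (p : Z ⟶ X) (q : Z ⟶ Y) :
    symCofreeMap h ≫ symDelta p q = symDelta (h ≫ p) (h ≫ q) := by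
  rw [symDelta_naturality (h ≫ p) (h ≫ q) (f := 𝟙 X) (g := 𝟙 Y) (Category.comp_id _).symm
    (Category.comp_id _).symm, symCofreeMap_id, symCofreeMap_id, id_tensorHom_id, Category.comp_id]

/-- `S^c` is an oplax monoidal functor from the cartesian to the given monoidal structure. -/
noncomputable instance oplaxMonoidalSymCofree : (U ⋙ symCofreeFunctor D).OplaxMonoidal where
  η := symEta (U.obj (𝟙_ C))
  δ X Y := symDelta (U.map (fst X Y)) (U.map (snd X Y))
  δ_natural_left {X Y} f X' := by
    refine Eq.trans ?_ (map_symDelta U (h := f ▷ X') (f := f) (g := 𝟙 X') (by simp)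
      (by simp)).symm
    rw [← tensorHom_id]
    exact congrArg (fun t => _ ≫ (_ ⊗ₘ t)) ((U ⋙ symCofreeFunctor D).map_id X').symm
  δ_natural_right {X Y} X' f := by
    refine Eq.trans ?_ (map_symDelta U (h := X' ◁ f) (f := 𝟙 X') (g := f) (by simp)
      (by simp)).symm
    rw [← id_tensorHom]
    exact congrArg (fun t => _ ≫ (t ⊗ₘ _)) ((U ⋙ symCofreeFunctor D).map_id X').symm
  oplax_associativity X Y Z := by
    refine (symDelta_assoc (U.map (fst (X ⊗ Y) Z)) (U.map (snd (X ⊗ Y) Z)) (U.map (fst X Y))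
      (U.map (snd X Y)) (U.map (α_ X Y Z).hom ≫ U.map (fst X (Y ⊗ Z)))
      (U.map (α_ X Y Z).hom ≫ U.map (snd X (Y ⊗ Z))) (U.map (fst Y Z)) (U.map (snd Y Z))
      ?_ ?_ ?_).trans ?_
    · rw [← U.map_comp, ← U.map_comp, associator_hom_fst]
    · rw [← U.map_comp, ← U.map_comp, ← U.map_comp, Category.assoc, associator_hom_snd_fst]
    · rw [← U.map_comp, ← U.map_comp, Category.assoc, associator_hom_snd_snd]
    · rw [← symCofreeMap_symDelta]
      exact Category.assoc _ _ _
  oplax_left_unitality X := by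
    -- Once the unitor is absorbed into the comparison, its second leg is the identity, and
    -- unitality becomes the counit law `symDelta_symEta_left`.
    have h : symDelta (U.map (λ_ X).inv ≫ U.map (fst (𝟙_ C) X)) (𝟙 (U.obj X)) ≫
        symEta (U.obj (𝟙_ C)) ▷ symCofree (U.obj X) = (λ_ (symCofree (U.obj X))).inv := by
      rw [← cancel_mono (λ_ _).hom, Category.assoc, symDelta_symEta_left, Iso.inv_hom_id,
        symCofreeMap_id]
    have h1 : U.map (λ_ X).inv ≫ U.map (snd (𝟙_ C) X) = 𝟙 (U.obj X) := by
      rw [← U.map_comp, leftUnitor_inv_snd, U.map_id]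
    rw [← h1, ← symCofreeMap_symDelta] at h
    exact h.symm.trans (Category.assoc _ _ _)
  oplax_right_unitality X := by
    have h : symDelta (𝟙 (U.obj X)) (U.map (ρ_ X).inv ≫ U.map (snd X (𝟙_ C))) ≫
        symCofree (U.obj X) ◁ symEta (U.obj (𝟙_ C)) = (ρ_ (symCofree (U.obj X))).inv := by
      rw [← cancel_mono (ρ_ _).hom, Category.assoc, symDelta_symEta_right, Iso.inv_hom_id,
        symCofreeMap_id]
    have h1 : U.map (ρ_ X).inv ≫ U.map (fst X (𝟙_ C)) = 𝟙 (U.obj X) := by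
      rw [← U.map_comp, rightUnitor_inv_fst, U.map_id]
    rw [← h1, ← symCofreeMap_symDelta] at h
    exact h.symm.trans (Category.assoc _ _ _)

lemma map_braiding_symCofree [BraidedCategory C] (X Y : C) :
    (U ⋙ symCofreeFunctor D).map (β_ X Y).hom ≫
        Functor.OplaxMonoidal.δ (U ⋙ symCofreeFunctor D) Y X =
      Functor.OplaxMonoidal.δ (U ⋙ symCofreeFunctor D) X Y ≫
        (β_ ((U ⋙ symCofreeFunctor D).obj X) ((U ⋙ symCofreeFunctor D).obj Y)).hom := by
  refine (symCofreeMap_symDelta (U.map (β_ X Y).hom) (U.map (fst Y X)) (U.map (snd Y X))).trans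
    (Eq.trans ?_ (symDelta_braiding (U.map (fst X Y)) (U.map (snd X Y))).symm)
  rw [← U.map_comp, ← U.map_comp, braiding_hom_fst,
    braiding_hom_snd]

end CofreeMonoidal

/-! ### The cartesian structure on `D`, and the conclusion. -/

section Cartesian

/-- A category, seen with its cartesian monoidal structure. -/
def Cart (D : Type u) : Type u := D

variable {D : Type u} [Category.{v} D]

instance : Category.{v} (Cart D) := inferInstanceAs (Category.{v} D)

noncomputable instance [HasFiniteProducts D] : CartesianMonoidalCategory (Cart D) :=
  @CartesianMonoidalCategory.ofHasFiniteProducts D _ _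

noncomputable instance [HasFiniteProducts D] : BraidedCategory (Cart D) :=
  BraidedCategory.ofCartesianMonoidalCategory

variable (D) in
/-- The identity functor, from the category with its cartesian monoidal structure. -/
def cartForget : Cart D ⥤ D where
  obj X := X
  map f := f

section

variable [MonoidalCategory D] [SymmetricCategory D] [HasZeroObject D] [HasZeroMorphisms D]
  [HasLimits D] [HasColimits D] [CofreeFriendly D] [PermutationFriendly D]

/-- The identity of a terminal object is zero, by uniqueness of morphisms into it. -/
instance isIso_η_cartForget :
    IsIso (Functor.OplaxMonoidal.η (cartForget D ⋙ symCofreeFunctor D)) :=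
  isIso_symEta (Z := (cartForget D).obj (𝟙_ (Cart D)))
    (CartesianMonoidalCategory.toUnit_unique (C := Cart D) (X := 𝟙_ (Cart D)) _ _)

instance isIso_δ_cartForget (X Y : Cart D) :
    IsIso (Functor.OplaxMonoidal.δ (cartForget D ⋙ symCofreeFunctor D) X Y) :=
  isIso_symDelta _ _
    { hom_ext := fun {W} f g h h' =>
        CartesianMonoidalCategory.hom_ext (C := Cart D) (T := W) f g h h'
      exists_lift := fun {W} f g => ⟨CartesianMonoidalCategory.lift (C := Cart D) (T := W) f g,
        CartesianMonoidalCategory.lift_fst (C := Cart D) (T := W) f g,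
        CartesianMonoidalCategory.lift_snd (C := Cart D) (T := W) f g⟩ }

variable (X : D)

/-- The coalgebra `S^c(X)`, as the image of the coalgebra `X` in `(D, ×, *)`. -/
noncomputable abbrev symComon : Comon D :=
  (cartForget D ⋙ symCofreeFunctor D).mapComon.obj ((cartesianComon (Cart D)).obj X)

/-- The image of the diagonal followed by the comparison is the comparison along the two composites
of the diagonal with the projections, both of which are identities. -/
lemma symComon_comul : (symComon X).comon.comul = symComul X := by
  refine (symCofreeMap_symDelta (D := D) (Z' := X) _ _ _).trans ?_
  rw [← symDelta_id]
  exact congrArg₂ symDelta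
    (CartesianMonoidalCategory.lift_fst (C := Cart D) (T := X) (X := X) (Y := X) (𝟙 _) (𝟙 _))
    (CartesianMonoidalCategory.lift_snd (C := Cart D) (T := X) (X := X) (Y := X) (𝟙 _) (𝟙 _))

lemma symComon_counit : (symComon X).comon.counit = symCounit X :=
  (symCofreeMap_symEta (X := X) _).trans symEta_eq_symCounit

lemma symComul_braiding :
    symComul X ≫ (β_ (symCofree X) (symCofree X)).hom = symComul X := by
  rw [← symDelta_id, symDelta_braiding]

/-- The cosimplicial objects `S^c(coTHH^•_×(X))` and `coTHH^•_⊗(S^c(X))` are isomorphic. -/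
noncomputable def coTHHCartCompIso :
    coTHHCart X ⋙ symCofreeFunctor D ≅ coTHHObj (symComon X) :=
  coTHHObjCompIso (cartForget D ⋙ symCofreeFunctor D) (map_braiding_symCofree (cartForget D))
    ((cartesianComon (Cart D)).obj X)

end

end Cartesian

theorem mainTheorem9 {D : Type u} [Category.{v} D] [MonoidalCategory D] [SymmetricCategory D]
    [HasZeroObject D] [HasZeroMorphisms D] [HasLimits D] [HasColimits D]
    [CofreeFriendly D] [PermutationFriendly D] [ModelCategory D] (X : D) :
    ∃ S : ComonObj (symCofree X),
      S.comul = symComul X ∧ S.counit = symCounit X ∧ IsCommComonObj (symCofree X) ∧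
      (∀ H : D, IsCoTHH (Comon.mk (symCofree X)) H ↔
        IsHolim (coTHHCart X ⋙ symCofreeFunctor D) H) ∧
      (∀ R : HolimFunctor D, WeaklyEquivalent (R.coTHH (Comon.mk (symCofree X)))
        (R.holim (coTHHCart X ⋙ symCofreeFunctor D))) := by
  -- Counitality and coassociativity are part of the witness, which is the image of a coalgebra
  -- under an oplax monoidal functor.
  refine ⟨(symComon X).comon, symComon_comul X, symComon_counit X,
    @IsCommComonObj.mk _ _ _ _ _ (symComon X).comon ?_, fun H => ⟨fun h => ?_, fun h => ?_⟩,
    fun R => ?_⟩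
  · have h := symComul_braiding X
    rw [← symComon_comul] at h
    exact h
  · exact IsHolim.of_iso (coTHHCartCompIso X).symm h
  · exact IsHolim.of_iso (coTHHCartCompIso X) h
  · exact WeaklyEquivalent.of_iso (R.mapIso (coTHHCartCompIso X).symm)
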